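/- Fix an integer $m\ge 2$ and a real $\varepsilon>0$. For a finitely supported probability vector $q$ let $H(q)=\sum_x q(x)\log_2(1/q(x))$, with $0\log_2(1/0)=0$. Given probability distributions $p_1,\dots,p_m$ on $[n]$ (zero probabilities allowed, so each has at most $n$ states), a coupling is a probability distribution on $[n]^m$ whose $i$-th marginal is $p_i$ for every $i$, and $\mathrm{OPT}$ denotes a coupling of minimum entropy. Then there is an algorithm, depending only on $m$ and $\varepsilon$, which on every input $n,p_1,\dots,p_m$ (real probabilities) outputs a coupling $\mathrm{ALG}$ of $p_1,\dots,p_m$, as a table of its $n^m$ entries, with $$H(\mathrm{ALG})\le H(\mathrm{OPT})+\varepsilon$$ in running time $n^{O(1)}$, that is, in at most $C\,n^{C}$ steps for a constant $C$ depending only on $m$ and $\varepsilon$. So for fixed $m$ the minimum-entropy coupling problem has a polynomial-time approximation scheme (with additive error). Here an algorithm is a finite program (assignments, conditionals and while-loops) for a random access machine whose memory consists of integer cells and real-number cells. It can use natural-number constants, can address cells by computed integers, and performs the following operations at unit cost: addition, truncated subtraction and comparison of integers; exact addition, subtraction, halving and comparison of real numbers. It has no multiplication, division, rounding or logarithm.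 -/

import Mathlib

/-! Couplings, Shannon entropy in bits, and a random access machine over the reals
with a step count. -/

namespace MinEntropyCoupling

/-! ### Couplings and entropy -/

/-- Shannon entropy `∑ q(x) log₂ (1 / q(x))`; a state of probability `0` contributes `0`. -/
noncomputable def entropy {S : Type*} [Fintype S] (q : S → ℝ) : ℝ :=
  ∑ x, q x * Real.logb 2 (1 / q x)

/-- `q` is a joint distribution on `[n]^m` whose `i`-th marginal is `p i` for every `i`. -/
def IsCoupling {m n : ℕ} (p : Fin m → Fin n → ℝ) (q : (Fin m → Fin n) → ℝ) : Prop :=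
  q ∈ stdSimplex ℝ (Fin m → Fin n) ∧ ∀ i a, ∑ x with x i = a, q x = p i a

/-- `q` is a coupling of `p` of least entropy. -/
def IsMinEntropyCoupling {m n : ℕ} (p : Fin m → Fin n → ℝ) (q : (Fin m → Fin n) → ℝ) : Prop :=
  IsCoupling p q ∧ ∀ r, IsCoupling p r → entropy q ≤ entropy r

/-! ### The machine

The memory consists of integer arrays and of number arrays, both named `0, 1, 2, …`. An integer
cell holds a natural number, a number cell holds a real number. Indices are computed from integer
cells (indirect addressing). A program is a finite text, so it uses finitely many arrays and
constants.

Integers can be added, subtracted (truncated at `0`) and compared. Real numbers can be added,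
subtracted, halved and compared, at unit cost and exactly. There is no multiplication or division
of two memory cells, no rounding of a real number to an integer, and no logarithm: after `t` steps
every integer has `O(t)` more bits than the input integer at most, and every real number in memory
is a combination of `1` and the input numbers with dyadic coefficients of `O(t)` bits. -/

/-- Contents of the memory: `int a j` and `num a j` are the cells with index `j` of the integer
array `a` and of the number array `a`. -/
structure Store where
  int : ℕ → ℕ → ℕ
  num : ℕ → ℕ → ℝ

/-- Integer expressions. -/
inductive IntExp where
  | const (k : ℕ)
  | get (a : ℕ) (e : IntExp)
  | add (e f : IntExp)
  | sub (e f : IntExp)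

/-- Number expressions. -/
inductive NumExp where
  | const (k : ℕ)
  | get (a : ℕ) (e : IntExp)
  | add (x y : NumExp)
  | sub (x y : NumExp)
  | half (x : NumExp)

/-- Tests: comparison of two integers or of two real numbers. -/
inductive Test where
  | intLE (e f : IntExp)
  | intLT (e f : IntExp)
  | numLE (x y : NumExp)
  | numLT (x y : NumExp)

/-- Programs. `setInt a e f` and `setNum a e x` write the value of `f`, respectively `x`, into the
cell with index `e` of the array `a`; `loop b P` is "while `b` do `P`". -/
inductive Prog where
  | skip
  | setInt (a : ℕ) (e f : IntExp)
  | setNum (a : ℕ) (e : IntExp) (x : NumExp)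
  | seq (P Q : Prog)
  | ite (b : Test) (P Q : Prog)
  | loop (b : Test) (P : Prog)

/-- Value of an integer expression. -/
def IntExp.eval (s : Store) : IntExp → ℕ
  | .const k => k
  | .get a e => s.int a (e.eval s)
  | .add e f => e.eval s + f.eval s
  | .sub e f => e.eval s - f.eval s

/-- Number of elementary operations in an integer expression. -/
def IntExp.cost : IntExp → ℕ
  | .const _ => 1
  | .get _ e => e.cost + 1
  | .add e f => e.cost + f.cost + 1
  | .sub e f => e.cost + f.cost + 1

/-- Value of a number expression. -/
noncomputable def NumExp.eval (s : Store) : NumExp → ℝ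
  | .const k => k
  | .get a e => s.num a (e.eval s)
  | .add x y => x.eval s + y.eval s
  | .sub x y => x.eval s - y.eval s
  | .half x => x.eval s / 2

/-- Number of elementary operations in a number expression. -/
def NumExp.cost : NumExp → ℕ
  | .const _ => 1
  | .get _ e => e.cost + 1
  | .add x y => x.cost + y.cost + 1
  | .sub x y => x.cost + y.cost + 1
  | .half x => x.cost + 1

/-- Outcome of a test. -/
def Test.Holds (s : Store) : Test → Prop
  | .intLE e f => e.eval s ≤ f.eval s
  | .intLT e f => e.eval s < f.eval s
  | .numLE x y => x.eval s ≤ y.eval s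
  | .numLT x y => x.eval s < y.eval s

/-- Number of elementary operations in a test. -/
def Test.cost : Test → ℕ
  | .intLE e f => e.cost + f.cost + 1
  | .intLT e f => e.cost + f.cost + 1
  | .numLE x y => x.cost + y.cost + 1
  | .numLT x y => x.cost + y.cost + 1

/-- Write `v` into the integer cell with index `j` of the array `a`. -/
def Store.writeInt (s : Store) (a j v : ℕ) : Store :=
  { s with int := Function.update s.int a (Function.update (s.int a) j v) }

/-- Write `v` into the number cell with index `j` of the array `a`. -/
noncomputable def Store.writeNum (s : Store) (a j : ℕ) (v : ℝ) : Store :=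
  { s with num := Function.update s.num a (Function.update (s.num a) j v) }

/-- `Run P s t s'`: started on the memory contents `s`, the program `P` halts after exactly `t`
elementary operations with memory contents `s'`. -/
inductive Run : Prog → Store → ℕ → Store → Prop
  | skip (s : Store) : Run .skip s 1 s
  | setInt (a : ℕ) (e f : IntExp) (s : Store) :
      Run (.setInt a e f) s (e.cost + f.cost + 1) (s.writeInt a (e.eval s) (f.eval s))
  | setNum (a : ℕ) (e : IntExp) (x : NumExp) (s : Store) :
      Run (.setNum a e x) s (e.cost + x.cost + 1) (s.writeNum a (e.eval s) (x.eval s))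
  | seq {P Q : Prog} {s s' s'' : Store} {t t' : ℕ} (hP : Run P s t s') (hQ : Run Q s' t' s'') :
      Run (.seq P Q) s (t + t') s''
  | iteTrue {b : Test} {P Q : Prog} {s s' : Store} {t : ℕ} (hb : b.Holds s) (hP : Run P s t s') :
      Run (.ite b P Q) s (b.cost + t) s'
  | iteFalse {b : Test} {P Q : Prog} {s s' : Store} {t : ℕ} (hb : ¬ b.Holds s)
      (hQ : Run Q s t s') : Run (.ite b P Q) s (b.cost + t) s'
  | loopTrue {b : Test} {P : Prog} {s s' s'' : Store} {t t' : ℕ} (hb : b.Holds s)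
      (hP : Run P s t s') (hL : Run (.loop b P) s' t' s'') :
      Run (.loop b P) s (b.cost + t + t') s''
  | loopFalse {b : Test} {P : Prog} {s : Store} (hb : ¬ b.Holds s) :
      Run (.loop b P) s b.cost s

/-- The memory at the start: `n` is in the first cell of the integer array `0`, the list
`p i 0, …, p i (n - 1)` is at the beginning of the number array `i`, for `i < m`, and every other
cell holds `0`. -/
noncomputable def inputStore {m n : ℕ} (p : Fin m → Fin n → ℝ) : Store where
  int a j := if a = 0 ∧ j = 0 then n else 0
  num a j := if h : a < m ∧ j < n then p ⟨a, h.1⟩ ⟨j, h.2⟩ else 0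

/-- The joint table on `[n]^m` that is read off the memory at the end: the entry of
`x = (x₀, …, x_{m-1})` is in the number array `m`, at the index `∑ xᵢ nⁱ`. -/
def outputTable (m n : ℕ) (s : Store) (x : Fin m → Fin n) : ℝ :=
  s.num m (∑ i, (x i : ℕ) * n ^ (i : ℕ))

end MinEntropyCoupling

/-! A coupling can be read off from `m` labelings of the unit interval: if the `i`-th labeling gives
the label `a` the length `p i a`, then the lengths of the sets with a prescribed vector of labels
form a coupling (`isCoupling_joint`). Cut the interval into pieces. If a piece of length `w` carries
`N i` labels of the marginal `i`, at most `∏ N i` vectors occur on it, and `log₂ N ≤ N - 1`. Hence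
the entropy of the coupling is at most the entropy of the list of piece lengths plus the sum of all
`w (N i - 1)` (`sum_eta_joint_le`). It suffices to find a common list of pieces whose entropy is
close to that of OPT and on which the label changes inside pieces, weighted by piece length, are
cheap for every marginal.

Masses are rounded to powers of a ratio `ρ < 1` close to 1. From a state `x` of OPT one cuts a piece
of size `ρ ^ (cls (q x) + 1)`; only a small fraction is left over, so this costs little entropy
(`eta_split`, `Par.eta_add_eta_le`). From a state of a marginal, of class `c`, only the pieces of
class below `c + U` are cut explicitly. What remains of it enters a pool at class `c + U`, and
pieces that a marginal lacks are served from its pool. A label changes inside such a piece only when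
it is exhausted, and the piece then has size at most `ρ ^ (c + U)`; over all labels this sums to
about `ρ ^ U` (`LineData.crossing_blocks_le`). The final content of the pool is laid out by entry
class and compared with the remaining masses of OPT, also arranged by class. The labels that entered
early always have enough mass left for the pieces of early classes (`Par.heights`), so a piece never
contains the end of a fragment whose label entered at a later class, and each label pays a second
time an amount comparable to `ρ ^ (c + U)` (`LineData.crossing_frags_le`).

OPT is unknown, but only the numbers of explicit pieces matter. They form one of boundedly many
patterns per state. Two states of the same class differ in mass by at most the factor `ρ`, and the
explicit pieces use at most the share `ρ` of their state, so patterns may be permuted within a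
class. After sorting, all but few of `D` groups of a class have a constant pattern
(`exists_perm_few_mixed`); a state of a mixed group is not cut at all and enters the pool at its own
class. A bounded number of digits for each of the `O(log n)` classes therefore describes everything
that is needed: there are `n ^ O(1)` such advices, each gives a coupling
(`Par.isCoupling_coupling`), and one of them is good (`Par.exists_goodAdvice`,
`Par.entropy_coupling_le`).

The program tries all advices and computes each table as a common refinement of the labelled lines
(`weight_overlay`). Without logarithms it compares the sums of `cls (T c) * T c`, which up to the
factor `log₂ (1 / ρ)` and a small error are the entropies (`Par.entropy_le_of_cost_le`). The text of
the program is fixed and every loop has polynomially many passes (`Prog.exists_time_le`,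
`polyBounded_bound`). -/

namespace MinEntropyCoupling
open MeasureTheory Set

/-! ### The entropy function -/

/-- The contribution of a state of probability `x` to the entropy. -/
noncomputable def eta (x : ℝ) : ℝ := x * Real.logb 2 (1 / x)

theorem entropy_eq_sum_eta {S : Type*} [Fintype S] (q : S → ℝ) : entropy q = ∑ x, eta (q x) := rfl

theorem eta_eq_negMulLog (x : ℝ) : eta x = Real.negMulLog x / Real.log 2 := by
  simp [eta, Real.negMulLog, Real.logb, neg_div, mul_div_assoc]

@[simp] theorem eta_zero : eta 0 = 0 := by simp [eta]

theorem continuous_eta : Continuous eta := by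
  have : eta = fun x => Real.negMulLog x / Real.log 2 := funext eta_eq_negMulLog
  rw [this]
  exact Real.continuous_negMulLog.div_const _

theorem eta_nonneg {x : ℝ} (h0 : 0 ≤ x) (h1 : x ≤ 1) : 0 ≤ eta x := by
  rw [eta_eq_negMulLog]
  exact div_nonneg (Real.negMulLog_nonneg h0 h1) (Real.log_nonneg (by norm_num))

theorem eta_of_pos {x : ℝ} : eta x = -(x * Real.log x) / Real.log 2 := by
  rw [eta_eq_negMulLog, Real.negMulLog]; ring

/-- Replacing `log (x + y)` by the smaller `log x` and `log y` only increases the right side. It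
lets a state that occurs on several pieces be counted on each of them separately. -/
theorem eta_add_le {x y : ℝ} (hx : 0 ≤ x) (hy : 0 ≤ y) : eta (x + y) ≤ eta x + eta y := by
  rcases hx.eq_or_lt with rfl | hx
  · simp
  rcases hy.eq_or_lt with rfl | hy
  · simp
  rw [eta_of_pos, eta_of_pos, eta_of_pos, ← add_div]
  have h2 : 0 < Real.log 2 := Real.log_pos (by norm_num)
  gcongr
  have h3 : Real.log x ≤ Real.log (x + y) := Real.log_le_log hx (by linarith)
  have h4 : Real.log y ≤ Real.log (x + y) := Real.log_le_log hy (by linarith)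
  nlinarith [mul_le_mul_of_nonneg_left h3 hx.le, mul_le_mul_of_nonneg_left h4 hy.le]

/-- A mass `w` spread over at most `M` states has entropy at most `eta w + w log₂ M`. -/
theorem sum_eta_le {X : Type*} [Fintype X] (y : X → ℝ) (hy : ∀ x, 0 ≤ y x) {M : ℝ} (hM : 0 < M)
    (hcard : ((Finset.univ.filter fun x => 0 < y x).card : ℝ) ≤ M) :
    ∑ x, eta (y x) ≤ eta (∑ x, y x) + (∑ x, y x) * Real.logb 2 M := by
  classical
  set w := ∑ x, y x with hw
  have h2 : 0 < Real.log 2 := Real.log_pos (by norm_num)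
  have hw0 : 0 ≤ w := Finset.sum_nonneg fun x _ => hy x
  rcases hw0.eq_or_lt with h | hwpos
  · have : ∀ x, y x = 0 := fun x =>
      (Finset.sum_eq_zero_iff_of_nonneg fun x _ => hy x).1 h.symm x (Finset.mem_univ x)
    simp [this, ← h]
  -- Comparison with the uniform distribution on `M` states: `log t ≤ t - 1` at `t = w / (M * y x)`.
  -- The indicator keeps states of mass zero from contributing `w / M`.
  have key : ∀ x, -(y x * Real.log (y x)) ≤
      y x * (Real.log M - Real.log w) + ((if 0 < y x then w / M else 0) - y x) := by
    intro x
    rcases (hy x).eq_or_lt with h | h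
    · simp [← h]
    · rw [if_pos h]
      have h3 := Real.log_le_sub_one_of_pos (show 0 < w / (M * y x) by positivity)
      rw [Real.log_div hwpos.ne' (by positivity), Real.log_mul hM.ne' h.ne'] at h3
      have h4 := mul_le_mul_of_nonneg_left h3 h.le
      have h5 : y x * (w / (M * y x) - 1) = w / M - y x := by field_simp
      rw [h5] at h4
      linarith
  have hsum : ∑ x, (if 0 < y x then w / M else 0) ≤ w := by
    rw [← Finset.sum_filter, Finset.sum_const, nsmul_eq_mul]
    calc _ ≤ M * (w / M) := by gcongr
      _ = w := by field_simp
  have hle : ∑ x, -(y x * Real.log (y x)) ≤ w * (Real.log M - Real.log w) := by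
    calc _ ≤ ∑ x, (y x * (Real.log M - Real.log w) + ((if 0 < y x then w / M else 0) - y x)) :=
          Finset.sum_le_sum fun x _ => key x
      _ = w * (Real.log M - Real.log w) + (∑ x, (if 0 < y x then w / M else 0) - w) := by
          rw [Finset.sum_add_distrib, ← Finset.sum_mul, Finset.sum_sub_distrib]
      _ ≤ _ := by linarith
  simp only [eta_of_pos]
  rw [← Finset.sum_div, Real.logb, ← mul_div_assoc, ← add_div]
  gcongr
  linarith

/-- From `log (1 / √x) ≤ 1 / √x - 1` and `2 / log 2 < 3`. A power bound is enough for tiny masses,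
whose number is only polynomial. -/
theorem eta_le_sqrt {x : ℝ} (hx : 0 ≤ x) : eta x ≤ 3 * √x := by
  rcases hx.eq_or_lt with rfl | hx
  · simp
  have hs : 0 < √x := Real.sqrt_pos.2 hx
  have h2 : 0.6931471803 < Real.log 2 := Real.log_two_gt_d9
  have h3 := Real.log_le_sub_one_of_pos (inv_pos.2 hs)
  rw [Real.log_inv] at h3
  have h4 : Real.log x = 2 * Real.log (√x) := by
    conv_lhs => rw [← Real.sq_sqrt hx.le]
    rw [Real.log_pow]; norm_num
  rw [eta_of_pos, div_le_iff₀ (by linarith), h4]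
  have h5 : x * (-Real.log √x) ≤ √x := by
    calc x * (-Real.log √x) ≤ x * (√x)⁻¹ := by gcongr; linarith
      _ = √x := by
        field_simp
        rw [Real.sq_sqrt hx.le]
  nlinarith

/-- The chain rule for cutting a mass `q` in the ratio `x : 1 - x`; the extra entropy is
proportional to `q`, so it adds up to at most one binary entropy over a whole distribution. -/
theorem eta_split {x q : ℝ} (hx : 0 < x) (hx1 : x < 1) (hq : 0 < q) :
    eta (x * q) + eta ((1 - x) * q) = eta q + q * (eta x + eta (1 - x)) := by
  simp only [eta_of_pos]
  rw [Real.log_mul hx.ne' hq.ne', Real.log_mul (by linarith) hq.ne']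
  ring

/-! ### Labelings of the line -/

/-- The number of labels below `n` that occur on `[x, y)` with positive length. -/
noncomputable def labelCount (n : ℕ) (l : ℝ → ℕ) (x y : ℝ) : ℕ :=
  ((Finset.range n).filter fun a => 0 < volume.real (Ico x y ∩ {t | l t = a})).card

/-- The cost of the label changes inside the consecutive pieces of lengths `P`, the first of which
starts at `o`. -/
noncomputable def crossing (n : ℕ) (l : ℝ → ℕ) : ℝ → List ℝ → ℝ
  | _, [] => 0
  | o, w :: P => w * ((labelCount n l o (o + w) : ℝ) - 1) + crossing n l (o + w) P

/-- The length of the set of points of `[x, y)` with labels `x₀, …, x_{m-1}`. -/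
noncomputable def joint {m n : ℕ} (l : Fin m → ℝ → ℕ) (o y : ℝ) (x : Fin m → Fin n) : ℝ :=
  volume.real (Ico o y ∩ {t | ∀ i, l i t = x i})

theorem volume_Ico_inter_lt_top (x y : ℝ) (s : Set ℝ) : volume (Ico x y ∩ s) < ⊤ :=
  (measure_mono inter_subset_left).trans_lt (by simp)

section joint
variable {m n : ℕ} {l : Fin m → ℝ → ℕ}

theorem joint_nonneg (o y : ℝ) (x : Fin m → Fin n) : 0 ≤ joint l o y x := measureReal_nonneg

theorem measurableSet_labels (hl : ∀ i, Measurable (l i)) (x : Fin m → ℕ) :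
    MeasurableSet {t | ∀ i, l i t = x i} := by
  have : {t | ∀ i, l i t = x i} = ⋂ i, (l i) ⁻¹' {x i} := by ext; simp
  rw [this]
  exact MeasurableSet.iInter fun i => hl i (measurableSet_singleton _)

theorem sum_joint_filter (hl : ∀ i, Measurable (l i)) {o y : ℝ}
    (hlt : ∀ i, ∀ t ∈ Ico o y, l i t < n) (i : Fin m) (a : Fin n) :
    ∑ x : Fin m → Fin n with x i = a, joint l o y x =
      volume.real (Ico o y ∩ {t | l i t = a}) := by
  classical
  have hU : Ico o y ∩ {t | l i t = a} =
      ⋃ x ∈ (Finset.univ.filter fun x : Fin m → Fin n => x i = a),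
        (Ico o y ∩ {t | ∀ i, l i t = x i}) := by
    ext t
    simp only [mem_inter_iff, mem_ofPred_eq, Finset.mem_filter, Finset.mem_univ, true_and,
      mem_iUnion, exists_prop]
    constructor
    · rintro ⟨ht, ha⟩
      exact ⟨fun i => ⟨l i t, hlt i t ht⟩, Fin.ext ha, ht, fun i => rfl⟩
    · rintro ⟨x, hx, ht, h⟩
      exact ⟨ht, by rw [h, hx]⟩
  rw [hU, measureReal_biUnion_finset (h := fun x _ => (volume_Ico_inter_lt_top _ _ _).ne)]
  · rfl
  · intro x _ x' _ hne
    refine Set.disjoint_left.2 fun t ht ht' => hne ?_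
    funext i
    exact Fin.ext ((ht.2 i).symm.trans (ht'.2 i))
  · intro x _
    exact measurableSet_Ico.inter (measurableSet_labels hl fun i => x i)

theorem sum_joint (hl : ∀ i, Measurable (l i)) {o y : ℝ} (hoy : o ≤ y)
    (hlt : ∀ i, ∀ t ∈ Ico o y, l i t < n) :
    ∑ x : Fin m → Fin n, joint l o y x = y - o := by
  classical
  have hU : Ico o y =
      ⋃ x ∈ (Finset.univ : Finset (Fin m → Fin n)), (Ico o y ∩ {t | ∀ i, l i t = x i}) := by
    ext t
    simp only [mem_inter_iff, mem_ofPred_eq, Finset.mem_univ, iUnion_true, mem_iUnion]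
    constructor
    · intro ht
      exact ⟨fun i => ⟨l i t, hlt i t ht⟩, ht, fun i => rfl⟩
    · rintro ⟨x, ht, h⟩
      exact ht
  have h1 : volume.real (Ico o y) = y - o := by simp [Real.volume_real_Ico_of_le hoy]
  rw [← h1]
  conv_rhs => rw [hU]
  rw [measureReal_biUnion_finset (h := fun x _ => (volume_Ico_inter_lt_top _ _ _).ne)]
  · rfl
  · intro x _ x' _ hne
    refine Set.disjoint_left.2 fun t ht ht' => hne ?_
    funext i
    exact Fin.ext ((ht.2 i).symm.trans (ht'.2 i))
  · intro x _
    exact measurableSet_Ico.inter (measurableSet_labels hl fun i => x i)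

theorem joint_append (hl : ∀ i, Measurable (l i)) {o y z : ℝ} (hoy : o ≤ y) (hyz : y ≤ z)
    (x : Fin m → Fin n) : joint l o z x = joint l o y x + joint l y z x := by
  unfold joint
  rw [← measureReal_union (h₁ := (volume_Ico_inter_lt_top _ _ _).ne)
    (h₂ := (volume_Ico_inter_lt_top _ _ _).ne)]
  · rw [← Set.union_inter_distrib_right, Ico_union_Ico_eq_Ico hoy hyz]
  · refine Set.disjoint_left.2 fun t ht ht' => ?_
    exact absurd ht.1.2 (not_lt.2 ht'.1.1)
  · exact measurableSet_Ico.inter (measurableSet_labels hl fun i => x i)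

/-- Feasibility is automatic for labelings with the right label lengths, however they are arranged;
only the entropy depends on the arrangement. -/
theorem isCoupling_joint {p : Fin m → Fin n → ℝ} (hl : ∀ i, Measurable (l i))
    (hlt : ∀ i, ∀ t ∈ Ico (0 : ℝ) 1, l i t < n)
    (hp : ∀ i a, volume.real (Ico (0 : ℝ) 1 ∩ {t | l i t = (a : Fin n)}) = p i a) :
    IsCoupling p (joint l 0 1) := by
  refine ⟨⟨fun x => joint_nonneg _ _ _, ?_⟩, fun i a => ?_⟩
  · rw [sum_joint hl zero_le_one hlt, sub_zero]
  · rw [sum_joint_filter hl hlt, hp]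

/-- This linearization makes the cost of a piece additive over its label changes, so that each
change can be charged to one fragment. -/
theorem logb_two_le_sub_one {N : ℕ} (hN : 1 ≤ N) : Real.logb 2 N ≤ N - 1 := by
  obtain ⟨k, rfl⟩ := Nat.exists_eq_add_of_le' hN
  rw [Real.logb_le_iff_le_rpow (by norm_num) (by positivity)]
  push_cast
  rw [add_sub_cancel_right, Real.rpow_natCast]
  exact_mod_cast Nat.lt_two_pow_self

/-- A label vector of positive length has in each coordinate a label of positive length, so at most
the product of the label counts occur. The logarithm turns the product into a sum over the
marginals. -/
theorem sum_eta_joint_piece (hl : ∀ i, Measurable (l i)) {o w : ℝ} (hw : 0 ≤ w)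
    (hlt : ∀ i, ∀ t ∈ Ico o (o + w), l i t < n) :
    ∑ x : Fin m → Fin n, eta (joint l o (o + w) x) ≤
      eta w + ∑ i, w * ((labelCount n (l i) o (o + w) : ℝ) - 1) := by
  classical
  rcases hw.eq_or_lt with rfl | hwpos
  · simp [joint]
  have hsum : ∑ x : Fin m → Fin n, joint l o (o + w) x = w := by
    rw [sum_joint hl (by linarith) hlt]; ring
  have hpos : ∃ x : Fin m → Fin n, 0 < joint l o (o + w) x := by
    by_contra! h
    have : ∑ x : Fin m → Fin n, joint l o (o + w) x ≤ 0 := Finset.sum_nonpos fun x _ => h x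
    linarith
  have hmem : ∀ (x : Fin m → Fin n), 0 < joint l o (o + w) x → ∀ i, (x i : ℕ) ∈
      (Finset.range n).filter fun a => 0 < volume.real (Ico o (o + w) ∩ {t | l i t = a}) := by
    intro x hx i
    refine Finset.mem_filter.2 ⟨Finset.mem_range.2 (x i).2, hx.trans_le ?_⟩
    exact measureReal_mono (fun t ht => ⟨ht.1, ht.2 i⟩)
      (volume_Ico_inter_lt_top _ _ _).ne
  have hN : ∀ i, 1 ≤ labelCount n (l i) o (o + w) := by
    obtain ⟨x, hx⟩ := hpos
    exact fun i => Finset.card_pos.2 ⟨_, hmem x hx i⟩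
  have hcard : (Finset.univ.filter fun x : Fin m → Fin n => 0 < joint l o (o + w) x).card ≤
      ∏ i, labelCount n (l i) o (o + w) := by
    unfold labelCount
    rw [← Fintype.card_piFinset]
    refine Finset.card_le_card_of_injOn (fun x i => (x i : ℕ)) ?_ ?_
    · intro x hx
      rw [Finset.mem_coe, Fintype.mem_piFinset]
      exact hmem x (Finset.mem_filter.1 hx).2
    · intro x _ y _ h
      funext i
      exact Fin.ext (congrFun h i)
  have hM : (0 : ℝ) < ∏ i, (labelCount n (l i) o (o + w) : ℝ) :=
    Finset.prod_pos fun i _ => by exact_mod_cast hN i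
  have h := sum_eta_le (fun x => joint l o (o + w) x) (fun x => joint_nonneg _ _ x) hM
    (by exact_mod_cast hcard)
  rw [hsum] at h
  refine h.trans (add_le_add le_rfl ?_)
  rw [← Finset.mul_sum]
  gcongr
  rw [Real.logb_prod _ _ fun i _ => by exact_mod_cast (Nat.pos_of_ne_zero (by have := hN i; omega)).ne']
  · exact Finset.sum_le_sum fun i _ => logb_two_le_sub_one (hN i)

/-- Cutting the line into pieces of lengths `P`, the entropy of the joint labeling is at most the
entropy of `P` plus the cost of the label changes inside the pieces. -/
theorem sum_eta_joint_le (hl : ∀ i, Measurable (l i)) (P : List ℝ) (hP : ∀ w ∈ P, 0 ≤ w) (o : ℝ)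
    (hlt : ∀ i, ∀ t ∈ Ico o (o + P.sum), l i t < n) :
    ∑ x : Fin m → Fin n, eta (joint l o (o + P.sum) x) ≤
      (P.map eta).sum + ∑ i, crossing n (l i) o P := by
  induction P generalizing o with
  | nil => simp [joint, crossing]
  | cons w P ih =>
    have hw : 0 ≤ w := hP w (by simp)
    have hPs : 0 ≤ P.sum := List.sum_nonneg fun v hv => hP v (by simp [hv])
    simp only [List.sum_cons, List.map_cons, crossing]
    rw [Finset.sum_add_distrib]
    simp only [List.sum_cons] at hlt
    have h1 := sum_eta_joint_piece (n := n) hl hw (o := o) fun i t ht =>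
      hlt i t ⟨ht.1, ht.2.trans_le (by linarith)⟩
    have h2 := ih (fun v hv => hP v (by simp [hv])) (o + w) fun i t ht =>
      hlt i t ⟨by linarith [ht.1], by linarith [ht.2]⟩
    have h3 : ∀ x : Fin m → Fin n, eta (joint l o (o + (w + P.sum)) x) ≤
        eta (joint l o (o + w) x) + eta (joint l (o + w) (o + w + P.sum) x) := by
      intro x
      rw [← add_assoc, joint_append hl (y := o + w) (by linarith) (by linarith)]
      exact eta_add_le (joint_nonneg _ _ _) (joint_nonneg _ _ _)
    have h4 := Finset.sum_le_sum fun (x : Fin m → Fin n) (_ : x ∈ Finset.univ) => h3 x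
    rw [Finset.sum_add_distrib] at h4
    linarith

end joint

/-! ### Labelings given by lists of fragments -/

/-- The total length of a list of fragments (label, length). -/
noncomputable def total (L : List (ℕ × ℝ)) : ℝ := (L.map Prod.snd).sum

@[simp] theorem total_nil : total [] = 0 := rfl
@[simp] theorem total_cons (a : ℕ × ℝ) (L : List (ℕ × ℝ)) : total (a :: L) = a.2 + total L := by
  simp [total]
@[simp] theorem total_append (L L' : List (ℕ × ℝ)) : total (L ++ L') = total L + total L' := by
  simp [total]

theorem total_nonneg {L : List (ℕ × ℝ)} (h : ∀ a ∈ L, 0 ≤ a.2) : 0 ≤ total L :=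
  List.sum_nonneg fun v hv => by
    obtain ⟨a, ha, rfl⟩ := List.mem_map.1 hv
    exact h a ha

/-- The label of the point `t` when the fragments `L` are laid out from `o` on. -/
noncomputable def labelAt : ℝ → List (ℕ × ℝ) → ℝ → ℕ
  | _, [], _ => 0
  | o, a :: L, t => if t < o + a.2 then a.1 else labelAt (o + a.2) L t

theorem measurable_labelAt (o : ℝ) (L : List (ℕ × ℝ)) : Measurable (labelAt o L) := by
  induction L generalizing o with
  | nil => exact measurable_const
  | cons a L ih => exact Measurable.ite measurableSet_Iio measurable_const (ih _)

theorem labelAt_lt {n : ℕ} {L : List (ℕ × ℝ)} (h : ∀ a ∈ L, a.1 < n) {o t : ℝ}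
    (ht : t < o + total L) (hot : o ≤ t) : labelAt o L t < n := by
  induction L generalizing o with
  | nil => simp at ht; linarith
  | cons a L ih =>
    simp only [labelAt]
    split_ifs with h1
    · exact h a (by simp)
    · refine ih (fun b hb => h b (by simp [hb])) ?_ (not_lt.1 h1)
      simp at ht; linarith

theorem labelAt_append_left {L L' : List (ℕ × ℝ)} (h : ∀ a ∈ L, 0 ≤ a.2) {o t : ℝ}
    (ht : t < o + total L) (hot : o ≤ t) : labelAt o (L ++ L') t = labelAt o L t := by
  induction L generalizing o with
  | nil => simp at ht; linarith
  | cons a L ih =>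
    simp only [labelAt, List.cons_append]
    split_ifs with h1
    · rfl
    · refine ih (fun b hb => h b (by simp [hb])) ?_ (not_lt.1 h1)
      simp at ht; linarith

theorem labelAt_append_right {L L' : List (ℕ × ℝ)} (h : ∀ a ∈ L, 0 ≤ a.2) {o t : ℝ}
    (ht : o + total L ≤ t) : labelAt o (L ++ L') t = labelAt (o + total L) L' t := by
  induction L generalizing o with
  | nil => simp
  | cons a L ih =>
    have h0 := total_nonneg fun b hb => h b (List.mem_cons_of_mem _ hb)
    simp only [total_cons] at ht
    simp only [labelAt, List.cons_append]
    rw [if_neg (by linarith), ih (fun b hb => h b (by simp [hb])) (by linarith)]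
    simp [add_assoc]

theorem volume_labelAt {L : List (ℕ × ℝ)} (h : ∀ a ∈ L, 0 ≤ a.2) (o : ℝ) (b : ℕ) :
    volume.real (Ico o (o + total L) ∩ {t | labelAt o L t = b}) =
      total (L.filter fun a => a.1 = b) := by
  induction L generalizing o with
  | nil => simp
  | cons a L ih =>
    have ha := h a (by simp)
    have h0 := total_nonneg fun b hb => h b (List.mem_cons_of_mem _ hb)
    have hsplit : Ico o (o + total (a :: L)) ∩ {t | labelAt o (a :: L) t = b} =
        (Ico o (o + a.2) ∩ {t | a.1 = b}) ∪
          (Ico (o + a.2) (o + a.2 + total L) ∩ {t | labelAt (o + a.2) L t = b}) := by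
      ext t
      simp only [labelAt, total_cons, mem_inter_iff, mem_Ico, mem_ofPred_eq, mem_union]
      by_cases h1 : t < o + a.2
      · simp [h1, not_le.2 h1, show t < o + (a.2 + total L) by linarith]
      · simp [h1, not_lt.1 h1, add_assoc, show o ≤ t by linarith]
    rw [hsplit, measureReal_union (h₁ := (volume_Ico_inter_lt_top _ _ _).ne)
      (h₂ := (volume_Ico_inter_lt_top _ _ _).ne), ih (fun b hb => h b (by simp [hb]))]
    · by_cases hb : a.1 = b
      · simp [hb, ha]
      · simp [hb]
    · refine Set.disjoint_left.2 fun t ht ht' => ?_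
      exact absurd ht.1.2 (not_lt.2 ht'.1.1)
    · exact measurableSet_Ico.inter (measurable_labelAt _ _ (measurableSet_singleton b))

theorem labelCount_congr {n : ℕ} {l l' : ℝ → ℕ} {x y : ℝ} (h : ∀ t ∈ Ico x y, l t = l' t) :
    labelCount n l x y = labelCount n l' x y := by
  unfold labelCount
  congr 1
  refine Finset.filter_congr fun a _ => ?_
  have : Ico x y ∩ {t | l t = a} = Ico x y ∩ {t | l' t = a} := by
    ext t
    simp only [mem_inter_iff, mem_ofPred_eq]
    exact and_congr_right fun ht => by rw [h t ht]
  rw [this]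

theorem crossing_congr {n : ℕ} {l l' : ℝ → ℕ} {P : List ℝ} (hP : ∀ w ∈ P, 0 ≤ w) {o : ℝ}
    (h : ∀ t ∈ Ico o (o + P.sum), l t = l' t) : crossing n l o P = crossing n l' o P := by
  induction P generalizing o with
  | nil => rfl
  | cons w P ih =>
    have hw := hP w (by simp)
    have hs : 0 ≤ P.sum := List.sum_nonneg fun v hv => hP v (by simp [hv])
    simp only [List.sum_cons] at h
    rw [crossing, crossing, ih (fun v hv => hP v (by simp [hv])) fun t ht => h t ⟨by
      linarith [ht.1], by linarith [ht.2]⟩, labelCount_congr fun t ht => h t ⟨ht.1, by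
      linarith [ht.2]⟩]

theorem crossing_append (n : ℕ) (l : ℝ → ℕ) (o : ℝ) (P P' : List ℝ) :
    crossing n l o (P ++ P') = crossing n l o P + crossing n l (o + P.sum) P' := by
  induction P generalizing o with
  | nil => simp [crossing]
  | cons w P ih => simp [crossing, ih, add_assoc]

/-- The first fragments and the first pieces end at the same point, so no piece meets both halves.
-/
theorem crossing_labelAt_append (n : ℕ) {o : ℝ} {P P' : List ℝ} {L L' : List (ℕ × ℝ)}
    (hP : ∀ w ∈ P, 0 ≤ w) (hP' : ∀ w ∈ P', 0 ≤ w) (hL : ∀ a ∈ L, 0 ≤ a.2) (h : total L = P.sum) :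
    crossing n (labelAt o (L ++ L')) o (P ++ P') =
      crossing n (labelAt o L) o P + crossing n (labelAt (o + P.sum) L') (o + P.sum) P' := by
  rw [crossing_append]
  congr 1
  · exact crossing_congr hP fun t ht => labelAt_append_left hL (by rw [h]; exact ht.2) ht.1
  · refine crossing_congr hP' fun t ht => ?_
    rw [labelAt_append_right hL (by rw [h]; exact ht.1), h]

theorem labelCount_const_le {n : ℕ} {l : ℝ → ℕ} {x y : ℝ} {b : ℕ} (h : ∀ t ∈ Ico x y, l t = b) :
    labelCount n l x y ≤ 1 := by
  unfold labelCount
  rw [← Finset.card_singleton b]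
  refine Finset.card_le_card fun a ha => ?_
  rw [Finset.mem_singleton]
  by_contra hne
  have : Ico x y ∩ {t | l t = a} = ∅ := by
    ext t
    simp only [mem_inter_iff, mem_ofPred_eq, mem_empty_iff_false, iff_false, not_and]
    intro ht
    rw [h t ht]
    exact Ne.symm hne
  have h2 := (Finset.mem_filter.1 ha).2
  rw [this] at h2
  simp at h2

theorem labelCount_union_le {n : ℕ} {l : ℝ → ℕ} {x y z : ℝ} (hxy : x ≤ y) (hyz : y ≤ z) :
    labelCount n l x z ≤ labelCount n l x y + labelCount n l y z := by
  classical
  unfold labelCount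
  refine le_trans (Finset.card_le_card ?_) (Finset.card_union_le _ _)
  intro a ha
  obtain ⟨h1, h2⟩ := Finset.mem_filter.1 ha
  rw [Finset.mem_union, Finset.mem_filter, Finset.mem_filter]
  by_contra hcon
  push Not at hcon
  have e : Ico x z ∩ {t | l t = a} = (Ico x y ∩ {t | l t = a}) ∪ (Ico y z ∩ {t | l t = a}) := by
    rw [← Set.union_inter_distrib_right, Ico_union_Ico_eq_Ico hxy hyz]
  have h3 := measureReal_union_le (μ := volume) (Ico x y ∩ {t | l t = a}) (Ico y z ∩ {t | l t = a})
  rw [e] at h2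
  linarith [hcon.1 h1, hcon.2 h1]

/-- The fragments with their end points. -/
noncomputable def ends : ℝ → List (ℕ × ℝ) → List (ℕ × ℝ × ℝ)
  | _, [] => []
  | o, a :: L => (a.1, a.2, o + a.2) :: ends (o + a.2) L

theorem mem_ends {o : ℝ} {L : List (ℕ × ℝ)} {b : ℕ × ℝ × ℝ} (hb : b ∈ ends o L) :
    ∃ L₁ L₂, L = L₁ ++ (b.1, b.2.1) :: L₂ ∧ b.2.2 = o + total L₁ + b.2.1 := by
  induction L generalizing o with
  | nil => simp [ends] at hb
  | cons a L ih =>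
    rcases List.mem_cons.1 hb with rfl | hb
    · exact ⟨[], L, by simp, by simp⟩
    · obtain ⟨L₁, L₂, h, h'⟩ := ih hb
      exact ⟨a :: L₁, L₂, by simp [h], by simp [h', add_assoc]⟩

/-- The sum of `χ` over the fragments that end strictly between `x` and `y`. -/
noncomputable def charge (χ : ℕ → ℝ) (o : ℝ) (L : List (ℕ × ℝ)) (x y : ℝ) : ℝ :=
  ((ends o L).map fun b => if x < b.2.2 ∧ b.2.2 < y ∧ 0 < b.2.1 then χ b.1 else 0).sum

theorem charge_cons (χ : ℕ → ℝ) (o : ℝ) (a : ℕ × ℝ) (L : List (ℕ × ℝ)) (x y : ℝ) :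
    charge χ o (a :: L) x y =
      (if x < o + a.2 ∧ o + a.2 < y ∧ 0 < a.2 then χ a.1 else 0) + charge χ (o + a.2) L x y := by
  simp [charge, ends]

theorem charge_nonneg {χ : ℕ → ℝ} (hχ : ∀ a, 0 ≤ χ a) (o : ℝ) (L : List (ℕ × ℝ)) (x y : ℝ) :
    0 ≤ charge χ o L x y := by
  refine List.sum_nonneg fun v hv => ?_
  obtain ⟨b, _, rfl⟩ := List.mem_map.1 hv
  split_ifs
  · exact hχ _
  · rfl

theorem charge_mono_left {χ : ℕ → ℝ} (hχ : ∀ a, 0 ≤ χ a) (o : ℝ) (L : List (ℕ × ℝ))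
    {x x' : ℝ} (h : x ≤ x') (y : ℝ) : charge χ o L x' y ≤ charge χ o L x y := by
  refine List.sum_le_sum fun b _ => ?_
  split_ifs with h1 h2 h2
  · rfl
  · exact absurd ⟨h.trans_lt h1.1, h1.2⟩ h2
  · exact hχ _
  · rfl

/-- Every label on `[x, y)` after the first one is preceded by the end of a fragment strictly
inside. Empty fragments need not be charged, since they are not seen by the length of a label set.
-/
theorem labelCount_labelAt_le (n : ℕ) {o x y : ℝ} {L : List (ℕ × ℝ)} (hL : ∀ a ∈ L, 0 ≤ a.2)
    (hox : o ≤ x) (hxy : x < y) (hy : y ≤ o + total L) :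
    (labelCount n (labelAt o L) x y : ℝ) ≤ 1 + charge (fun _ => 1) o L x y := by
  induction L generalizing o x with
  | nil => simp at hy; linarith
  | cons a L ih =>
    have ha := hL a (by simp)
    have hL' : ∀ b ∈ L, 0 ≤ b.2 := fun b hb => hL b (by simp [hb])
    rw [charge_cons]
    simp only [total_cons] at hy
    rcases le_or_gt (o + a.2) x with h1 | h1
    · rw [if_neg (by intro h; linarith [h.1]), zero_add, labelCount_congr (l' := labelAt (o + a.2) L)]
      · exact ih hL' h1 hxy (by linarith)
      · intro t ht
        simp only [labelAt]
        rw [if_neg (by linarith [ht.1])]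
    · rcases le_or_gt y (o + a.2) with h2 | h2
      · have h3 : labelCount n (labelAt o (a :: L)) x y ≤ 1 := labelCount_const_le (b := a.1)
          fun t ht => by simp only [labelAt]; rw [if_pos (by linarith [ht.2])]
        have h4 : (labelCount n (labelAt o (a :: L)) x y : ℝ) ≤ 1 := by exact_mod_cast h3
        have h5 := charge_nonneg (χ := fun _ => 1) (fun _ => zero_le_one) (o + a.2) L x y
        split_ifs <;> linarith
      · rw [if_pos ⟨h1, h2, by linarith⟩]
        have h3 : labelCount n (labelAt o (a :: L)) x (o + a.2) ≤ 1 :=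
          labelCount_const_le (b := a.1)
            fun t ht => by simp only [labelAt]; rw [if_pos (by linarith [ht.2])]
        have h4 : labelCount n (labelAt o (a :: L)) (o + a.2) y =
            labelCount n (labelAt (o + a.2) L) (o + a.2) y := labelCount_congr fun t ht => by
          simp only [labelAt]; rw [if_neg (by linarith [ht.1])]
        have h5 := labelCount_union_le (n := n) (l := labelAt o (a :: L)) h1.le h2.le
        have h6 := ih hL' le_rfl h2 (by linarith)
        have h7 := charge_mono_left (χ := fun _ => 1) (fun _ => zero_le_one) (o + a.2) L h1.le y
        rw [h4] at h5
        have h8 : (labelCount n (labelAt o (a :: L)) x y : ℝ) ≤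
          1 + (labelCount n (labelAt (o + a.2) L) (o + a.2) y : ℝ) := by
          exact_mod_cast h5.trans (Nat.add_le_add_right h3 _)
        linarith

/-- If every piece that contains the end of a fragment with label `a` in its interior has length
at most `χ a`, then the label changes cost at most the sum of `χ` over the fragments. -/
theorem crossing_le_charge (n : ℕ) {o x : ℝ} {P : List ℝ} {L : List (ℕ × ℝ)} {χ : ℕ → ℝ}
    (hχ : ∀ a, 0 ≤ χ a) (hP : ∀ w ∈ P, 0 ≤ w) (hL : ∀ a ∈ L, 0 ≤ a.2) (hox : o ≤ x)
    (hy : x + P.sum ≤ o + total L)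
    (h : ∀ P₁ w P₂ L₁ a L₂, P = P₁ ++ w :: P₂ → L = L₁ ++ a :: L₂ →
      x + P₁.sum < o + total L₁ + a.2 → o + total L₁ + a.2 < x + P₁.sum + w → 0 < a.2 →
      w ≤ χ a.1) :
    crossing n (labelAt o L) x P ≤ charge χ o L x (x + P.sum) := by
  induction P generalizing x with
  | nil => exact charge_nonneg hχ _ _ _ _
  | cons w P ih =>
    have hw := hP w (by simp)
    have hP' : ∀ v ∈ P, 0 ≤ v := fun v hv => hP v (by simp [hv])
    have hs : 0 ≤ P.sum := List.sum_nonneg hP'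
    simp only [List.sum_cons] at hy ⊢
    have h1 := ih (x := x + w) hP' (by linarith) (by linarith) fun P₁ v P₂ L₁ a L₂ e1 e2 h3 h4 h5 =>
      h (w :: P₁) v P₂ L₁ a L₂ (by simp [e1]) e2 (by simpa [add_assoc] using h3)
        (by simpa [add_assoc] using h4) h5
    have h2 : w * ((labelCount n (labelAt o L) x (x + w) : ℝ) - 1) ≤ charge χ o L x (x + w) := by
      rcases hw.eq_or_lt with rfl | hwpos
      · rw [zero_mul]
        exact charge_nonneg hχ _ _ _ _
      · have h3 := labelCount_labelAt_le n hL hox (y := x + w) (by linarith) (by linarith)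
        calc _ ≤ w * charge (fun _ => 1) o L x (x + w) := by gcongr; linarith
          _ ≤ _ := by
            unfold charge
            rw [← List.sum_map_mul_left]
            refine List.sum_le_sum fun b hb => ?_
            split_ifs with h4
            · rw [mul_one]
              obtain ⟨L₁, L₂, e, e'⟩ := mem_ends hb
              exact h [] w P L₁ _ L₂ rfl e (by simpa [← e'] using h4.1)
                (by simpa [← e'] using h4.2.1) h4.2.2
            · simp
    rw [crossing]
    -- No end lies strictly inside both the first piece and the union of the others, so the two
    -- charges are together at most the charge of the whole; ends at the seam are free.
    refine (add_le_add h2 h1).trans ?_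
    unfold charge
    rw [← List.sum_map_add]
    refine List.sum_le_sum fun b _ => ?_
    split_ifs with h3 h4 h5 h5 h6 h7
    · linarith [h3.2.1, h4.1]
    · linarith [h3.2.1, h4.1]
    · rw [add_zero]
    · exact absurd ⟨h3.1, by linarith [h3.2.1], h3.2.2⟩ h5
    · rw [zero_add]
    · exact absurd ⟨by linarith [h6.1], by linarith [h6.2.1], h6.2.2⟩ h7
    · rw [add_zero]; exact hχ _
    · rw [add_zero]

/-- Pieces and fragments have the same partial sums, so no end is interior to a piece and the weight
`χ = 0` is admissible in `crossing_le_charge`. The case analysis compares the prefix before the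
piece with the prefix before the fragment. -/
theorem crossing_aligned (n : ℕ) (o : ℝ) {L : List (ℕ × ℝ)} (hL : ∀ a ∈ L, 0 ≤ a.2) :
    crossing n (labelAt o L) o (L.map Prod.snd) ≤ 0 := by
  refine (crossing_le_charge n (χ := fun _ => 0) (fun _ => le_rfl) ?_ hL le_rfl le_rfl ?_).trans
    (by simp [charge])
  · intro w hw
    obtain ⟨a, ha, rfl⟩ := List.mem_map.1 hw
    exact hL a ha
  · intro P₁ w P₂ L₁ a L₂ e1 e2 h1 h2 h3
    exfalso
    obtain ⟨M₁, M₂, rfl, rfl, e3⟩ := List.map_eq_append_iff.1 e1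
    obtain ⟨b, M₃, rfl, rfl, rfl⟩ := List.map_eq_cons_iff.1 e3
    change o + total M₁ < _ at h1
    change _ < o + total M₁ + _ at h2
    rcases List.append_eq_append_iff.1 e2 with ⟨N, rfl, e4⟩ | ⟨N, rfl, e4⟩
    · cases N with
      | nil => simp at e4 h1 h2; obtain ⟨rfl, rfl⟩ := e4; linarith
      | cons c N =>
        simp only [List.cons_append, List.cons.injEq] at e4
        obtain ⟨rfl, rfl⟩ := e4
        have := total_nonneg (L := N) fun d hd => hL d (by simp [hd])
        simp at h1 h2; linarith
    · cases N with
      | nil => simp at e4 h1 h2; obtain ⟨rfl, rfl⟩ := e4; linarith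
      | cons c N =>
        simp only [List.cons_append, List.cons.injEq] at e4
        obtain ⟨rfl, rfl⟩ := e4
        have := total_nonneg (L := N) fun d hd => hL d (by simp [hd])
        simp at h1 h2; linarith

/-! ### Filling a demand from a pool -/

/-- Serve the demand `x` from the amounts `r` of the labels in the list, in this order. -/
noncomputable def fill : (ℕ → ℝ) → ℝ → List ℕ → List (ℕ × ℝ)
  | _, _, [] => []
  | r, x, a :: l => (a, min (r a) x) ::
      fill (Function.update r a (r a - min (r a) x)) (x - min (r a) x) l

/-- The amounts that are left by `fill`. -/
noncomputable def drain : (ℕ → ℝ) → ℝ → List ℕ → ℕ → ℝ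
  | r, _, [] => r
  | r, x, a :: l => drain (Function.update r a (r a - min (r a) x)) (x - min (r a) x) l

theorem drain_append (r : ℕ → ℝ) (x : ℝ) (l l' : List ℕ) :
    drain r x (l ++ l') = drain (drain r x l) (x - total (fill r x l)) l' := by
  induction l generalizing r x with
  | nil => simp [drain, fill]
  | cons a l ih => simp [drain, fill, ih, sub_sub]

theorem fill_append (r : ℕ → ℝ) (x : ℝ) (l l' : List ℕ) :
    fill r x (l ++ l') = fill r x l ++ fill (drain r x l) (x - total (fill r x l)) l' := by
  induction l generalizing r x with
  | nil => simp [drain, fill]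
  | cons a l ih => simp [drain, fill, ih, sub_sub]

theorem fill_label_mem {r : ℕ → ℝ} {x : ℝ} {l : List ℕ} {b : ℕ × ℝ} (h : b ∈ fill r x l) :
    b.1 ∈ l := by
  induction l generalizing r x with
  | nil => simp [fill] at h
  | cons a l ih =>
    rcases List.mem_cons.1 h with rfl | h
    · simp
    · exact List.mem_cons_of_mem _ (ih h)

theorem update_sub_min_nonneg {r : ℕ → ℝ} {x : ℝ} {a : ℕ} (hr : ∀ b, 0 ≤ r b) (b : ℕ) :
    0 ≤ Function.update r a (r a - min (r a) x) b := by
  by_cases h : b = a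
  · subst h
    simp
  · simpa [h] using hr b

theorem fill_nonneg {r : ℕ → ℝ} {x : ℝ} {l : List ℕ} (hr : ∀ b, 0 ≤ r b) (hx : 0 ≤ x) :
    ∀ b ∈ fill r x l, 0 ≤ b.2 := by
  induction l generalizing r x with
  | nil => simp [fill]
  | cons a l ih =>
    intro b hb
    rcases List.mem_cons.1 hb with rfl | hb
    · exact le_min (hr a) hx
    · exact ih (update_sub_min_nonneg hr) (by simp) b hb

theorem drain_nonneg {r : ℕ → ℝ} {x : ℝ} {l : List ℕ} (hr : ∀ b, 0 ≤ r b) (b : ℕ) :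
    0 ≤ drain r x l b := by
  induction l generalizing r x with
  | nil => exact hr b
  | cons a l ih => exact ih (update_sub_min_nonneg hr)

theorem total_filter_fill_add_drain (r : ℕ → ℝ) (x : ℝ) (l : List ℕ) (b : ℕ) :
    total ((fill r x l).filter fun c => c.1 = b) + drain r x l b = r b := by
  induction l generalizing r x with
  | nil => simp [fill, drain]
  | cons a l ih =>
    have := ih (Function.update r a (r a - min (r a) x)) (x - min (r a) x)
    by_cases h : a = b
    · subst h
      simp [fill, drain] at this ⊢
      linarith
    · simp [fill, drain, h, Ne.symm h] at this ⊢
      linarith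

theorem drain_le {r : ℕ → ℝ} {x : ℝ} {l : List ℕ} (hr : ∀ b, 0 ≤ r b) (hx : 0 ≤ x) (b : ℕ) :
    drain r x l b ≤ r b := by
  have h := total_filter_fill_add_drain r x l b
  have h1 : 0 ≤ total ((fill r x l).filter fun c => c.1 = b) :=
    total_nonneg fun c hc => fill_nonneg hr hx c (List.mem_of_mem_filter hc)
  linarith

theorem drain_of_notMem {r : ℕ → ℝ} {x : ℝ} {l : List ℕ} {b : ℕ} (hb : b ∉ l) :
    drain r x l b = r b := by
  induction l generalizing r x with
  | nil => rfl
  | cons a l ih =>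
    rw [List.mem_cons, not_or] at hb
    rw [drain, ih hb.2, Function.update_of_ne hb.1]

theorem map_update_of_notMem {r : ℕ → ℝ} {l : List ℕ} {a : ℕ} (ha : a ∉ l) (v : ℝ) :
    l.map (Function.update r a v) = l.map r :=
  List.map_congr_left fun _ hb => Function.update_of_ne (ne_of_mem_of_not_mem hb ha) _ _

theorem total_fill {r : ℕ → ℝ} {x : ℝ} {l : List ℕ} (hl : l.Nodup) (hr : ∀ b, 0 ≤ r b)
    (hx : 0 ≤ x) : total (fill r x l) = min x (l.map r).sum := by
  induction l generalizing r x with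
  | nil => simp [fill, hx]
  | cons a l ih =>
    obtain ⟨ha, hl⟩ := List.nodup_cons.1 hl
    have h0 : 0 ≤ (l.map r).sum := List.sum_nonneg fun v hv => by
      obtain ⟨b, _, rfl⟩ := List.mem_map.1 hv
      exact hr b
    rw [fill, total_cons, ih hl (update_sub_min_nonneg hr) (by simp), map_update_of_notMem ha]
    have := hr a
    simp only [List.map_cons, List.sum_cons]
    rcases le_total (r a) x with h | h
    · rw [min_eq_left h, ← min_add_add_left]; ring_nf
    · rw [min_eq_right h, min_eq_left (a := x) (by linarith), sub_self, min_eq_left h0, add_zero]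

theorem sum_drain {r : ℕ → ℝ} {x : ℝ} {l : List ℕ} (hl : l.Nodup) :
    (l.map (drain r x l)).sum = (l.map r).sum - total (fill r x l) := by
  induction l generalizing r x with
  | nil => simp [fill]
  | cons a l ih =>
    obtain ⟨ha, hl⟩ := List.nodup_cons.1 hl
    simp only [List.map_cons, List.sum_cons, fill, drain, total_cons]
    rw [ih hl, map_update_of_notMem ha, drain_of_notMem ha]
    simp; ring

/-- What is left of the second part of the list: the first part is used first. -/
theorem sum_drain_append_right {r : ℕ → ℝ} {x : ℝ} {l l' : List ℕ} (hl : (l ++ l').Nodup)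
    (hr : ∀ b, 0 ≤ r b) (hx : 0 ≤ x) :
    min (l'.map r).sum ((l.map r).sum + (l'.map r).sum - x) ≤
      (l'.map (drain r x (l ++ l'))).sum := by
  obtain ⟨h1, h2, h3⟩ := List.nodup_append.1 hl
  have e : l'.map (drain r x l) = l'.map r := List.map_congr_left fun b hb =>
    drain_of_notMem fun hb' => h3 b hb' b hb rfl
  have ht := total_fill h1 hr hx
  have hnn : 0 ≤ x - total (fill r x l) := by rw [ht]; simp
  rw [drain_append, sum_drain h2, e, total_fill h2 (drain_nonneg hr) hnn, e, ht]
  rcases le_total x (l.map r).sum with h | h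
  · rw [min_eq_left h]
    have : min (x - x) (l'.map r).sum ≤ 0 := by simp
    exact (min_le_left _ _).trans (by linarith)
  · rw [min_eq_right h]
    have : min (x - (l.map r).sum) (l'.map r).sum ≤ x - (l.map r).sum := min_le_left _ _
    exact (min_le_right _ _).trans (by linarith)

/-- All fragments but the last exhaust their label. -/
theorem charge_fill_le {s : ℝ} (hs : 0 ≤ s) (r : ℕ → ℝ) {x : ℝ} {l : List ℕ} (hl : l.Nodup)
    (hr : ∀ b, 0 ≤ r b) (hx : 0 ≤ x) (o y : ℝ) :
    charge (fun _ => s) o (fill r x l) y (o + total (fill r x l)) ≤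
      (l.map fun a => if 0 < r a ∧ drain r x l a = 0 then s else 0).sum := by
  induction l generalizing r x o with
  | nil => simp [fill, charge, ends]
  | cons a l ih =>
    obtain ⟨ha, hl⟩ := List.nodup_cons.1 hl
    have hx' : 0 ≤ x - min (r a) x := by simp
    have h1 := ih (Function.update r a (r a - min (r a) x)) hl (update_sub_min_nonneg hr) hx'
      (o + min (r a) x)
    rw [fill, charge_cons, total_cons, List.map_cons, List.sum_cons, ← add_assoc]
    refine add_le_add ?_ (h1.trans (le_of_eq ?_))
    · dsimp only
      split_ifs with h2 h3 h3
      · rfl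
      · exfalso
        refine h3 ?_
        rw [drain, drain_of_notMem ha]
        have h4 := total_fill (r := Function.update r a (r a - min (r a) x)) hl
          (update_sub_min_nonneg hr) hx'
        have h5 := min_le_left (x - min (r a) x)
          (l.map (Function.update r a (r a - min (r a) x))).sum
        -- Either the label is used up, as claimed, or it covers the whole demand; then all later
        -- fragments are empty and its end is not strictly before the end of the list.
        rcases le_total (r a) x with h | h
        · rw [min_eq_left h] at h2 ⊢
          simpa using h2.2.2
        · rw [min_eq_right h] at h2 h4 h5
          linarith [h2.2.1]
      · exact hs
      · rfl
    · congr 1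
      refine List.map_congr_left fun b hb => ?_
      refine if_congr ?_ rfl rfl
      rw [drain, Function.update_of_ne (ne_of_mem_of_not_mem hb ha)]

/-! ### The fragment list of one marginal -/

/-- The labels that may be used at class `k`, the last ones to enter first. -/
def order (n : ℕ) (ent : ℕ → ℕ) (k : ℕ) : List ℕ :=
  (List.range (k + 1)).flatMap fun r => (List.range n).filter fun a => ent a = k - r

theorem mem_order {n : ℕ} {ent : ℕ → ℕ} {k a : ℕ} : a ∈ order n ent k ↔ a < n ∧ ent a ≤ k := by
  simp only [order, List.mem_flatMap, List.mem_range, List.mem_filter, decide_eq_true_eq]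
  constructor
  · rintro ⟨r, _, h, h'⟩
    exact ⟨h, by omega⟩
  · rintro ⟨h, h'⟩
    exact ⟨k - ent a, by omega, h, by omega⟩

theorem nodup_order (n : ℕ) (ent : ℕ → ℕ) (k : ℕ) : (order n ent k).Nodup := by
  rw [order, List.nodup_flatMap]
  refine ⟨fun r _ => List.nodup_range.filter _, ?_⟩
  refine List.nodup_range.pairwise_of_forall_ne fun r hr r' hr' hne => ?_
  rw [List.mem_range] at hr hr'
  rw [Function.onFun, List.disjoint_left]
  intro a ha ha'
  simp only [List.mem_filter, decide_eq_true_eq] at ha ha'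
  omega

/-- Late entrants come first, so the labels that entered by class `e` form a suffix. They are
touched only after all later ones are exhausted. -/
theorem order_eq_append (n : ℕ) (ent : ℕ → ℕ) {e k : ℕ} (h : e ≤ k) :
    ∃ l l', order n ent k = l ++ l' ∧ (∀ a, a ∈ l' ↔ a < n ∧ ent a ≤ e) := by
  obtain ⟨d, rfl⟩ := Nat.exists_eq_add_of_le h
  refine ⟨_, _, by rw [order, show e + d + 1 = d + (e + 1) by ring, List.range_add,
    List.flatMap_append], fun a => ?_⟩
  simp only [List.mem_flatMap, List.mem_range, List.mem_filter, decide_eq_true_eq, List.mem_map]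
  constructor
  · rintro ⟨_, ⟨r, _, rfl⟩, h, h'⟩
    exact ⟨h, by omega⟩
  · rintro ⟨h, h'⟩
    exact ⟨_, ⟨e - ent a, by omega, rfl⟩, h, by omega⟩

theorem sum_map_of_nodup {M : Type*} [AddCommMonoid M] {l : List ℕ} (hl : l.Nodup)
    {s : Finset ℕ} (h : ∀ a, a ∈ l ↔ a ∈ s) (f : ℕ → M) : (l.map f).sum = ∑ a ∈ s, f a := by
  rw [← List.sum_toFinset f hl]
  congr 1
  ext a
  simp [h]

/-- The data of one marginal: the number `n` of labels, the number `Q` of classes, the size `s k`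
of the pieces of class `k`, the class `ent a` at which the label `a` enters the pool, the number
`pc a k` of pieces of class `k` that are cut from `a`, the number `nk k` of pieces of class `k` on
the line, and the amount `r a` of the label `a` that is not cut into pieces. -/
structure LineData where
  n : ℕ
  Q : ℕ
  s : ℕ → ℝ
  ent : ℕ → ℕ
  pc : ℕ → ℕ → ℕ
  nk : ℕ → ℕ
  r : ℕ → ℝ

namespace LineData
variable (d : LineData)

/-- The number of pieces of class `k`. -/
def pieces (k : ℕ) : ℕ := ∑ a ∈ Finset.range d.n, d.pc a k

/-- The mass that has to be taken from the pool at class `k`. -/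
noncomputable def need (k : ℕ) : ℝ := (d.nk k - d.pieces k : ℕ) * d.s k

/-- The pool before class `k`. -/
noncomputable def pool : ℕ → ℕ → ℝ
  | 0 => d.r
  | k + 1 => drain (pool k) (d.need k) (order d.n d.ent k)

/-- The pieces of class `k`. -/
noncomputable def cut (k : ℕ) : List (ℕ × ℝ) :=
  (List.range d.n).flatMap fun a => List.replicate (d.pc a k) (a, d.s k)

/-- The fragments of class `k`. -/
noncomputable def block (k : ℕ) : List (ℕ × ℝ) :=
  d.cut k ++ fill (d.pool k) (d.need k) (order d.n d.ent k)

/-- What remains of the pool after the last class. -/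
noncomputable def rest : List (ℕ × ℝ) :=
  (List.range d.Q).flatMap fun e =>
    ((List.range d.n).filter fun a => d.ent a = e).map fun a => (a, d.pool d.Q a)

/-- All fragments. -/
noncomputable def frags : List (ℕ × ℝ) := (List.range d.Q).flatMap d.block ++ d.rest

variable {d}

theorem need_nonneg (hs : ∀ k, 0 ≤ d.s k) (k : ℕ) : 0 ≤ d.need k :=
  mul_nonneg (Nat.cast_nonneg _) (hs k)

theorem pool_nonneg (hr : ∀ a, 0 ≤ d.r a) (k a : ℕ) : 0 ≤ d.pool k a := by
  induction k generalizing a with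
  | zero => exact hr a
  | succ k ih => exact drain_nonneg ih a

theorem cut_mem {k : ℕ} {b : ℕ × ℝ} (hb : b ∈ d.cut k) : b.1 < d.n ∧ b.2 = d.s k := by
  simp only [cut, List.mem_flatMap, List.mem_range] at hb
  obtain ⟨a, ha, hb⟩ := hb
  obtain ⟨_, rfl⟩ := List.mem_replicate.1 hb
  exact ⟨ha, rfl⟩

theorem block_mem (hs : ∀ k, 0 ≤ d.s k) (hr : ∀ a, 0 ≤ d.r a) {k : ℕ} {b : ℕ × ℝ}
    (hb : b ∈ d.block k) : b.1 < d.n ∧ 0 ≤ b.2 := by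
  rcases List.mem_append.1 hb with hb | hb
  · exact ⟨(cut_mem hb).1, (cut_mem hb).2 ▸ hs k⟩
  · exact ⟨(mem_order.1 (fill_label_mem hb)).1,
      fill_nonneg (pool_nonneg hr k) (need_nonneg hs k) b hb⟩

theorem rest_mem {b : ℕ × ℝ} (hb : b ∈ d.rest) :
    b.1 < d.n ∧ b.2 = d.pool d.Q b.1 := by
  simp only [rest, List.mem_flatMap, List.mem_map, List.mem_filter, List.mem_range] at hb
  obtain ⟨e, _, a, ⟨ha, _⟩, rfl⟩ := hb
  exact ⟨ha, rfl⟩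

theorem frags_mem (hs : ∀ k, 0 ≤ d.s k) (hr : ∀ a, 0 ≤ d.r a) {b : ℕ × ℝ}
    (hb : b ∈ d.frags) : b.1 < d.n ∧ 0 ≤ b.2 := by
  rcases List.mem_append.1 hb with hb | hb
  · obtain ⟨k, _, hb⟩ := List.mem_flatMap.1 hb
    exact block_mem hs hr hb
  · exact ⟨(rest_mem hb).1, (rest_mem hb).2 ▸ pool_nonneg hr _ _⟩

end LineData

/-! ### Accounting for the pool and for the label changes. -/

namespace LineData
variable {d : LineData}

/-- The mass in the pool, before class `k`, of the labels that enter at class `e` or earlier. -/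
noncomputable def poolMass (d : LineData) (k e : ℕ) : ℝ :=
  ∑ a ∈ (Finset.range d.n).filter (fun a => d.ent a ≤ e), d.pool k a

theorem sum_order (f : ℕ → ℝ) (k : ℕ) : ((order d.n d.ent k).map f).sum =
    ∑ a ∈ (Finset.range d.n).filter (fun a => d.ent a ≤ k), f a :=
  sum_map_of_nodup (nodup_order _ _ _) (fun a => by simp [mem_order]) f

theorem total_fill_eq_need (hs : ∀ k, 0 ≤ d.s k) (hr : ∀ a, 0 ≤ d.r a) {k : ℕ}
    (h : d.need k ≤ d.poolMass k k) :
    total (fill (d.pool k) (d.need k) (order d.n d.ent k)) = d.need k := by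
  rw [total_fill (nodup_order _ _ _) (pool_nonneg hr k) (need_nonneg hs k), sum_order]
  exact min_eq_left h

theorem poolMass_succ_self (hs : ∀ k, 0 ≤ d.s k) (hr : ∀ a, 0 ≤ d.r a) {k : ℕ}
    (h : d.need k ≤ d.poolMass k k) : d.poolMass (k + 1) k = d.poolMass k k - d.need k := by
  have h1 := sum_drain (r := d.pool k) (x := d.need k) (nodup_order d.n d.ent k)
  rwa [sum_order, sum_order, total_fill_eq_need hs hr h] at h1

/-- Class `k` draws only on labels with entry class at most `k`, all of which are counted when `k ≤
e`. -/
theorem poolMass_succ_of_le (hs : ∀ k, 0 ≤ d.s k) (hr : ∀ a, 0 ≤ d.r a) {k e : ℕ}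
    (h : d.need k ≤ d.poolMass k k) (he : k ≤ e) :
    d.poolMass (k + 1) e = d.poolMass k e - d.need k := by
  have key : ∀ j, d.poolMass j e = d.poolMass j k +
      ∑ a ∈ (Finset.range d.n).filter (fun a => d.ent a ≤ e ∧ ¬ d.ent a ≤ k), d.pool j a := by
    intro j
    rw [poolMass, ← Finset.sum_filter_add_sum_filter_not _ (fun a => d.ent a ≤ k),
      Finset.filter_filter, Finset.filter_filter, poolMass]
    congr 2
    refine Finset.filter_congr fun a _ => ?_
    constructor
    · exact fun h => h.2
    · exact fun h => ⟨h.trans he, h⟩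
  rw [key, key k, poolMass_succ_self hs hr h, add_sub_right_comm]
  congr 1
  refine Finset.sum_congr rfl fun a ha => ?_
  refine drain_of_notMem fun ha' => ?_
  exact (Finset.mem_filter.1 ha).2.2 (mem_order.1 ha').2

/-- This is where serving from the last entrants first matters: the early labels lose mass only
after the later ones are empty, and then they hold all that is left. -/
theorem min_le_poolMass_succ (hs : ∀ k, 0 ≤ d.s k) (hr : ∀ a, 0 ≤ d.r a) {k e : ℕ} (he : e ≤ k) :
    min (d.poolMass k e) (d.poolMass k k - d.need k) ≤ d.poolMass (k + 1) e := by
  obtain ⟨l, l', h1, h2⟩ := order_eq_append d.n d.ent he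
  have hn := nodup_order d.n d.ent k
  rw [h1] at hn
  have h3 := sum_drain_append_right hn (pool_nonneg hr k) (need_nonneg hs k)
  have h4 : ∀ f : ℕ → ℝ, (l'.map f).sum =
      ∑ a ∈ (Finset.range d.n).filter (fun a => d.ent a ≤ e), f a :=
    fun f => sum_map_of_nodup (List.nodup_append.1 hn).2.1 (fun a => by simp [h2]) f
  have h5 := sum_order (d := d) (d.pool k) k
  rw [h1, List.map_append, List.sum_append] at h5
  rw [h5, h4, h4, ← h1] at h3
  exact h3

/-- When class `k` is served, at least `v k` is left among the labels present. Later classes draw on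
newer labels first, and since `v` is monotone the reserve `v e` of the older ones is never attacked.
-/
theorem poolMass_bounds (hs : ∀ k, 0 ≤ d.s k) (hr : ∀ a, 0 ≤ d.r a) {v : ℕ → ℝ} (hv : Monotone v)
    (hv0 : ∀ k, 0 ≤ v k)
    (H : ∀ k < d.Q, ∑ j ∈ Finset.range (k + 1), d.need j + v k ≤ d.poolMass 0 k) {k : ℕ}
    (hk : k ≤ d.Q) :
    (∀ e, k ≤ e → d.poolMass k e = d.poolMass 0 e - ∑ j ∈ Finset.range k, d.need j) ∧
      (∀ e < k, v e ≤ d.poolMass k e) ∧ ∀ j < k, d.need j ≤ d.poolMass j j := by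
  induction k with
  | zero => simp
  | succ k ih =>
    obtain ⟨h1, h2, h3⟩ := ih (by omega)
    have h4 := H k (by omega)
    rw [Finset.sum_range_succ] at h4
    have h5 := h1 k le_rfl
    have h6 : d.need k ≤ d.poolMass k k := by linarith [hv0 k]
    refine ⟨fun e he => ?_, fun e he => ?_, fun j hj => ?_⟩
    · rw [poolMass_succ_of_le hs hr h6 (by omega), h1 e (by omega), Finset.sum_range_succ]; ring
    · rcases Nat.lt_succ_iff_lt_or_eq.1 he with he | rfl
      · refine le_trans (le_min (h2 e he) ?_) (min_le_poolMass_succ hs hr he.le)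
        linarith [hv he.le]
      · rw [poolMass_succ_self hs hr h6]
        linarith
    · rcases Nat.lt_succ_iff_lt_or_eq.1 hj with hj | rfl
      · exact h3 j hj
      · exact h6

/-- The sum of the piece sizes of the labels that are still in the pool before class `k`. -/
noncomputable def potential (d : LineData) (k : ℕ) : ℝ :=
  ∑ a ∈ Finset.range d.n, if 0 < d.pool k a then d.s (d.ent a) else 0

theorem cut_map_snd (k : ℕ) : (d.cut k).map Prod.snd = List.replicate (d.pieces k) (d.s k) := by
  rw [List.eq_replicate_iff]
  refine ⟨?_, fun b hb => ?_⟩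
  · rw [List.length_map, cut, List.length_flatMap]
    simp only [List.length_replicate]
    exact sum_map_of_nodup List.nodup_range (by simp) _
  · obtain ⟨c, hc, rfl⟩ := List.mem_map.1 hb
    exact (cut_mem hc).2

/-- The pieces that are cut explicitly coincide with fragments and cost nothing. Among the fragments
from the pool all but the last exhaust their label, and an exhausted label leaves the potential. -/
theorem crossing_block_le (hs : ∀ k, 0 ≤ d.s k) (hanti : Antitone d.s) (hr : ∀ a, 0 ≤ d.r a)
    {k : ℕ} (h : d.need k ≤ d.poolMass k k) (hnk : d.pieces k ≤ d.nk k) (o : ℝ) :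
    total (d.block k) = d.nk k * d.s k ∧
    crossing d.n (labelAt o (d.block k)) o (List.replicate (d.nk k) (d.s k)) ≤
      d.potential k - d.potential (k + 1) := by
  have ht := total_fill_eq_need hs hr h
  have hc : total (d.cut k) = d.pieces k * d.s k := by
    rw [total, cut_map_snd, List.sum_replicate, nsmul_eq_mul]
  have hn : d.need k = ((d.nk k : ℝ) - d.pieces k) * d.s k := by rw [need, Nat.cast_sub hnk]
  refine ⟨by rw [block, total_append, hc, ht, hn]; ring, ?_⟩
  have hcut : ∀ a ∈ d.cut k, 0 ≤ a.2 := fun a ha => (cut_mem ha).2 ▸ hs k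
  have hfill := fill_nonneg (l := order d.n d.ent k) (pool_nonneg hr k) (need_nonneg hs k)
  have hrep : ∀ j, ∀ w ∈ List.replicate j (d.s k), 0 ≤ w := fun j w hw =>
    (List.mem_replicate.1 hw).2 ▸ hs k
  obtain ⟨j, hj⟩ := Nat.exists_eq_add_of_le hnk
  have hneed : d.need k = j * d.s k := by rw [need, hj, Nat.add_sub_cancel_left]
  rw [hj, List.replicate_add, block,
    crossing_labelAt_append _ (hrep _) (hrep _) hcut (by rw [total, cut_map_snd])]
  have h1 := crossing_aligned d.n o hcut
  rw [cut_map_snd] at h1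
  set o' := o + (List.replicate (d.pieces k) (d.s k)).sum
  set F := fill (d.pool k) (d.need k) (order d.n d.ent k) with hF
  have hsum : (List.replicate j (d.s k)).sum = total F := by
    rw [ht, hneed, List.sum_replicate, nsmul_eq_mul]
  have h2 : crossing d.n (labelAt o' F) o' (List.replicate j (d.s k)) ≤
      charge (fun _ => d.s k) o' F o' (o' + (List.replicate j (d.s k)).sum) :=
    crossing_le_charge d.n (fun _ => hs k) (hrep j) hfill le_rfl (by rw [hsum])
      fun P₁ w P₂ L₁ a L₂ e _ _ _ _ => le_of_eq
        (List.mem_replicate.1 (e ▸ by simp : w ∈ List.replicate j (d.s k))).2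
  rw [hsum] at h2
  have h3 := charge_fill_le (hs k) (d.pool k) (nodup_order d.n d.ent k) (pool_nonneg hr k)
    (need_nonneg hs k) o' o'
  rw [sum_order] at h3
  -- A label exhausted at class `k` entered at class at most `k`, so it removes `s (ent a) ≥ s k`
  -- from the potential. Labels that have not entered are untouched, although the potential already
  -- counts them.
  have h4 : ∑ a ∈ (Finset.range d.n).filter (fun a => d.ent a ≤ k),
      (if 0 < d.pool k a ∧ drain (d.pool k) (d.need k) (order d.n d.ent k) a = 0
        then d.s k else 0) ≤ d.potential k - d.potential (k + 1) := by
    rw [potential, potential, ← Finset.sum_sub_distrib, Finset.sum_filter]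
    refine Finset.sum_le_sum fun a _ => ?_
    have h5 : d.pool (k + 1) a = drain (d.pool k) (d.need k) (order d.n d.ent k) a := rfl
    have h6 := drain_le (l := order d.n d.ent k) (pool_nonneg hr k) (need_nonneg hs k) a
    have h7 := pool_nonneg hr (k + 1) a
    rw [← h5] at h6 ⊢
    have h8 := hs (d.ent a)
    by_cases h9 : d.ent a ≤ k
    · have h10 := hanti h9
      have h11 := hs k
      rw [if_pos h9]
      rcases h7.eq_or_lt with h12 | h12
      · rw [← h12]
        by_cases h13 : 0 < d.pool k a <;> simp [h13, h10]
      · simp [h12, h12.trans_le h6, h12.ne']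
    · rw [if_neg h9]
      by_cases h12 : 0 < d.pool (k + 1) a
      · simp [h12, h12.trans_le h6]
      · rw [if_neg h12, sub_zero]
        split_ifs
        · exact h8
        · rfl
  linarith

theorem potential_nonneg (hs : ∀ k, 0 ≤ d.s k) (k : ℕ) : 0 ≤ d.potential k :=
  Finset.sum_nonneg fun a _ => by split_ifs; exacts [hs _, le_rfl]

/-- The costs of the blocks telescope in the potential; each label pays at most once in total. -/
theorem crossing_blocks_le (hs : ∀ k, 0 ≤ d.s k) (hanti : Antitone d.s) (hr : ∀ a, 0 ≤ d.r a)
    (K : ℕ) (h : ∀ k < K, d.need k ≤ d.poolMass k k) (hnk : ∀ k, d.pieces k ≤ d.nk k) :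
    total ((List.range K).flatMap d.block) =
      ((List.range K).flatMap fun k => List.replicate (d.nk k) (d.s k)).sum ∧
    crossing d.n (labelAt 0 ((List.range K).flatMap d.block)) 0
      ((List.range K).flatMap fun k => List.replicate (d.nk k) (d.s k)) ≤
      d.potential 0 - d.potential K := by
  induction K with
  | zero => simp [crossing]
  | succ K ih =>
    obtain ⟨h1, h2⟩ := ih fun k hk => h k (by omega)
    simp only [List.range_succ, List.flatMap_append, List.flatMap_singleton, total_append,
      List.sum_append]
    set o := ((List.range K).flatMap fun k => List.replicate (d.nk k) (d.s k)).sum with ho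
    obtain ⟨h3, h4⟩ := crossing_block_le hs hanti hr (h K (by omega)) (hnk K) (0 + o)
    refine ⟨by rw [h1, h3, List.sum_replicate, nsmul_eq_mul], ?_⟩
    rw [crossing_labelAt_append]
    · rw [← ho]; linarith
    · intro w hw
      obtain ⟨k, _, hw⟩ := List.mem_flatMap.1 hw
      exact (List.mem_replicate.1 hw).2 ▸ hs k
    · intro w hw
      exact (List.mem_replicate.1 hw).2 ▸ hs K
    · intro a ha
      obtain ⟨k, _, ha⟩ := List.mem_flatMap.1 ha
      exact (block_mem hs hr ha).2
    · exact h1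

/-- The mass of the pieces of class at most `e` in a list of pieces (length, class). -/
noncomputable def massUpTo (V : List (ℝ × ℕ)) (e : ℕ) : ℝ :=
  ((V.filter fun b => b.2 ≤ e).map Prod.fst).sum

theorem massUpTo_append (V V' : List (ℝ × ℕ)) (e : ℕ) :
    massUpTo (V ++ V') e = massUpTo V e + massUpTo V' e := by
  simp [massUpTo]

theorem massUpTo_nonneg {V : List (ℝ × ℕ)} (h : ∀ b ∈ V, 0 ≤ b.1) (e : ℕ) : 0 ≤ massUpTo V e :=
  List.sum_nonneg fun v hv => by
    obtain ⟨b, hb, rfl⟩ := List.mem_map.1 hv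
    exact h b (List.mem_of_mem_filter hb)

theorem massUpTo_mono {V : List (ℝ × ℕ)} (h : ∀ b ∈ V, 0 ≤ b.1) : Monotone (massUpTo V) := by
  intro e e' he
  induction V with
  | nil => exact le_rfl
  | cons b V ih =>
    have := ih fun c hc => h c (by simp [hc])
    have hb := h b (by simp)
    simp only [massUpTo, List.filter_cons] at this ⊢
    by_cases h1 : b.2 ≤ e
    · simp [h1, h1.trans he, this]
    · by_cases h2 : b.2 ≤ e'
      · simp [h1, h2]; linarith
      · simp [h1, h2, this]

theorem massUpTo_eq_sum {V : List (ℝ × ℕ)} {e : ℕ} (h : ∀ b ∈ V, b.2 ≤ e) :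
    massUpTo V e = (V.map Prod.fst).sum := by
  rw [massUpTo, List.filter_eq_self.2 (by simpa using h)]

theorem nodup_byEntry : ((List.range d.Q).flatMap fun e =>
    (List.range d.n).filter fun a => d.ent a = e).Nodup := by
  rw [List.nodup_flatMap]
  refine ⟨fun r _ => List.nodup_range.filter _, ?_⟩
  refine List.nodup_range.pairwise_of_forall_ne fun r hr r' hr' hne => ?_
  rw [Function.onFun, List.disjoint_left]
  intro a ha ha'
  simp only [List.mem_filter, decide_eq_true_eq] at ha ha'
  omega

theorem poolMass_eq_rest (hent : ∀ a < d.n, d.ent a < d.Q) (e : ℕ) :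
    d.poolMass d.Q e = total (d.rest.filter fun b => d.ent b.1 ≤ e) := by
  have h1 : (d.rest.filter fun b => d.ent b.1 ≤ e) =
      (((List.range d.Q).flatMap fun e => ((List.range d.n).filter fun a => d.ent a = e)).filter
        fun a => d.ent a ≤ e).map fun a => (a, d.pool d.Q a) := by
    rw [rest, ← List.map_flatMap, List.filter_map]
    rfl
  rw [h1, total, List.map_map, poolMass]
  refine (sum_map_of_nodup ?_ ?_ _).symm
  · exact nodup_byEntry.filter _
  · intro a
    simp only [List.mem_filter, List.mem_flatMap, List.mem_range, decide_eq_true_eq,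
      Finset.mem_filter, Finset.mem_range]
    constructor
    · rintro ⟨⟨_, _, h, _⟩, h'⟩
      exact ⟨h, h'⟩
    · rintro ⟨h, h'⟩
      exact ⟨⟨_, hent a h, h, rfl⟩, h'⟩

theorem pairwise_rest : d.rest.Pairwise fun b c => d.ent b.1 ≤ d.ent c.1 := by
  rw [rest, List.pairwise_flatMap]
  refine ⟨fun e _ => ?_, ?_⟩
  · rw [List.pairwise_map]
    refine List.Pairwise.imp_of_mem ?_ (List.pairwise_of_forall (R := fun _ _ => True)
      fun _ _ => trivial)
    intro a b ha hb _
    simp only [List.mem_filter, decide_eq_true_eq] at ha hb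
    simp [ha.2, hb.2]
  · refine List.Pairwise.imp ?_ List.pairwise_lt_range
    intro e e' he b hb c hc
    simp only [List.mem_map, List.mem_filter, decide_eq_true_eq] at hb hc
    obtain ⟨a, ⟨_, ha⟩, rfl⟩ := hb
    obtain ⟨a', ⟨_, ha'⟩, rfl⟩ := hc
    dsimp only
    omega

/-- Each label has exactly one fragment in the remainder of the pool. -/
theorem charge_rest_le {χ : ℕ → ℝ} (hχ : ∀ a, 0 ≤ χ a) (hent : ∀ a < d.n, d.ent a < d.Q)
    (o x y : ℝ) : charge χ o d.rest x y ≤ ∑ a ∈ Finset.range d.n, χ a := by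
  have h1 : ∀ (L : List (ℕ × ℝ)) (o : ℝ), charge χ o L x y ≤ (L.map fun b => χ b.1).sum := by
    intro L
    induction L with
    | nil => intro o; simp [charge, ends]
    | cons a L ih =>
      intro o
      rw [charge_cons, List.map_cons, List.sum_cons]
      refine add_le_add ?_ (ih _)
      split_ifs
      · exact le_rfl
      · exact hχ _
  refine (h1 _ o).trans (le_of_eq ?_)
  have h2 : (d.rest.map fun b => χ b.1) =
      ((List.range d.Q).flatMap fun e => ((List.range d.n).filter fun a => d.ent a = e)).map χ := by
    rw [rest, ← List.map_flatMap, List.map_map]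
    rfl
  rw [h2]
  refine sum_map_of_nodup ?_ ?_ _
  · exact nodup_byEntry
  · intro a
    simp only [List.mem_filter, List.mem_flatMap, List.mem_range, decide_eq_true_eq,
      Finset.mem_range]
    constructor
    · rintro ⟨_, _, h, _⟩
      exact h
    · intro h
      exact ⟨_, hent a h, h, rfl⟩

/-- The target line: `nk k` pieces of each class `k`, followed by the pieces `V`. -/
noncomputable def target (d : LineData) (V : List (ℝ × ℕ)) : List ℝ :=
  ((List.range d.Q).flatMap fun k => List.replicate (d.nk k) (d.s k)) ++ V.map Prod.fst

/-- The label changes inside the pieces of the target line are paid for by the labels. -/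
theorem crossing_frags_le (hs : ∀ k, 0 ≤ d.s k) (hanti : Antitone d.s) (hr : ∀ a, 0 ≤ d.r a)
    (hnk : ∀ k, d.pieces k ≤ d.nk k) (hent : ∀ a < d.n, d.ent a < d.Q)
    {V : List (ℝ × ℕ)} (hV0 : ∀ b ∈ V, 0 ≤ b.1) (hV : V.Pairwise fun b c => b.2 ≤ c.2)
    (H : ∀ k < d.Q, ∑ j ∈ Finset.range (k + 1), d.need j + massUpTo V k ≤
      ∑ a ∈ (Finset.range d.n).filter (fun a => d.ent a ≤ k), d.r a)
    (Htot : ∑ a ∈ Finset.range d.n, d.r a =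
      ∑ j ∈ Finset.range d.Q, d.need j + (V.map Prod.fst).sum)
    {χ : ℕ → ℝ} (hχ : ∀ a, 0 ≤ χ a)
    (hVχ : ∀ b ∈ V, ∀ a < d.n, d.ent a ≤ b.2 → b.1 ≤ χ a) :
    total d.frags = (d.target V).sum ∧
    crossing d.n (labelAt 0 d.frags) 0 (d.target V) ≤
      ∑ a ∈ Finset.range d.n, d.s (d.ent a) + ∑ a ∈ Finset.range d.n, χ a := by
  obtain ⟨h1, h2, h3⟩ := poolMass_bounds hs hr (massUpTo_mono hV0) (massUpTo_nonneg hV0) H le_rfl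
  obtain ⟨h4, h5⟩ := crossing_blocks_le hs hanti hr d.Q h3 hnk
  have hrest0 : ∀ b ∈ d.rest, 0 ≤ b.2 := fun b hb => (rest_mem hb).2 ▸ pool_nonneg hr _ _
  have hlt : ∀ a ∈ Finset.range d.n, d.ent a ≤ d.Q := fun a ha =>
    (hent a (Finset.mem_range.1 ha)).le
  have h6 : total d.rest = (V.map Prod.fst).sum := by
    have e1 := h1 d.Q le_rfl
    rw [poolMass_eq_rest hent, List.filter_eq_self.2, poolMass, Finset.filter_true_of_mem hlt] at e1
    · rw [e1]
      change ∑ a ∈ Finset.range d.n, d.r a - _ = _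
      rw [Htot]; ring
    · intro b hb
      simpa using (hent _ (rest_mem hb).1).le
  have hblocks : ∀ a ∈ (List.range d.Q).flatMap d.block, 0 ≤ a.2 := fun a ha => by
    obtain ⟨k, _, ha⟩ := List.mem_flatMap.1 ha
    exact (block_mem hs hr ha).2
  refine ⟨by rw [frags, total_append, h4, h6, target, List.sum_append], ?_⟩
  have hV0' : ∀ w ∈ V.map Prod.fst, 0 ≤ w := fun w hw => by
    obtain ⟨b, hb, rfl⟩ := List.mem_map.1 hw
    exact hV0 b hb
  rw [frags, target, crossing_labelAt_append]
  rotate_left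
  · intro w hw
    obtain ⟨k, _, hw⟩ := List.mem_flatMap.1 hw
    exact (List.mem_replicate.1 hw).2 ▸ hs k
  · exact hV0'
  · exact hblocks
  · exact h4
  set o := 0 + ((List.range d.Q).flatMap fun k => List.replicate (d.nk k) (d.s k)).sum
  have h7 : crossing d.n (labelAt o d.rest) o (V.map Prod.fst) ≤
      charge χ o d.rest o (o + (V.map Prod.fst).sum) := by
    refine crossing_le_charge d.n hχ hV0' hrest0 le_rfl (by rw [h6]) ?_
    intro P₁ w P₂ L₁ a L₂ e1 e2 g1 g2 g3
    obtain ⟨V₁, V₂, eV, rfl, e3⟩ := List.map_eq_append_iff.1 e1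
    obtain ⟨b, V₃, rfl, rfl, rfl⟩ := List.map_eq_cons_iff.1 e3
    have hb : b ∈ V := eV ▸ by simp
    have ha : a ∈ d.rest := e2 ▸ by simp
    refine hVχ b hb a.1 (rest_mem ha).1 ?_
    -- Suppose the fragment's label entered after the class of the piece `b`. The pieces up to and
    -- including `b` have classes at most `b.2`, their mass is at most what the labels with such
    -- entry classes have left, and in the layout by entry class all of these precede the fragment.
    -- So the fragment ends no earlier than `b`, and its end is not interior.
    by_contra hlt'
    push Not at hlt'
    rw [eV] at hV
    rw [List.pairwise_append] at hV
    have m1 : (V₁.map Prod.fst).sum + b.1 ≤ massUpTo V b.2 := by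
      rw [eV, massUpTo_append, show b :: V₃ = [b] ++ V₃ from rfl, massUpTo_append,
        massUpTo_eq_sum fun c hc => hV.2.2 c hc b (by simp), massUpTo_eq_sum (V := [b]) (by simp)]
      have := massUpTo_nonneg (V := V₃) (fun c hc => hV0 c (eV ▸ by simp [hc])) b.2
      simp; linarith
    have m2 : massUpTo V b.2 ≤ d.poolMass d.Q b.2 :=
      h2 b.2 (hlt'.trans (hent _ (rest_mem ha).1))
    have m3 : d.poolMass d.Q b.2 ≤ total L₁ := by
      have hp := pairwise_rest (d := d)
      rw [e2, List.pairwise_append, List.pairwise_cons] at hp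
      rw [poolMass_eq_rest hent, e2, List.filter_append, List.filter_cons,
        if_neg (by simpa using hlt'), (List.filter_eq_nil_iff (l := L₂)).2, List.append_nil]
      · have : ∀ L : List (ℕ × ℝ), (∀ c ∈ L, 0 ≤ c.2) →
            total (L.filter fun b_1 => decide (d.ent b_1.1 ≤ b.2)) ≤ total L := by
          intro L hL
          induction L with
          | nil => simp
          | cons c L ih =>
            have := ih fun c' hc' => hL c' (by simp [hc'])
            have := hL c (by simp)
            rw [List.filter_cons]
            split_ifs <;> simp <;> linarith
        exact this L₁ fun c hc => hrest0 c (e2 ▸ by simp [hc])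
      · intro c hc
        have := hp.2.1.1 c hc
        simp; omega
    linarith
  have h8 := charge_rest_le hχ hent o o (o + (V.map Prod.fst).sum)
  have h9 := potential_nonneg hs d.Q
  have h10 : d.potential 0 ≤ ∑ a ∈ Finset.range d.n, d.s (d.ent a) :=
    Finset.sum_le_sum fun a _ => by split_ifs; exacts [le_rfl, hs _]
  linarith

end LineData

/-! ### The total length of each label. -/

namespace LineData
variable {d : LineData}

theorem total_filter_eq_zero {L : List (ℕ × ℝ)} {b : ℕ} (h : ∀ c ∈ L, c.1 ≠ b) :
    total (L.filter fun c => c.1 = b) = 0 := by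
  rw [List.filter_eq_nil_iff.2 (by simpa using h)]
  rfl

theorem total_filter_flatMap (l : List ℕ) (f : ℕ → List (ℕ × ℝ)) (b : ℕ) :
    total ((l.flatMap f).filter fun c => c.1 = b) =
      (l.map fun e => total ((f e).filter fun c => c.1 = b)).sum := by
  induction l with
  | nil => simp
  | cons a l ih => simp [List.flatMap_cons, ih]

theorem total_filter_cut {b : ℕ} (hb : b < d.n) (k : ℕ) :
    total ((d.cut k).filter fun c => c.1 = b) = d.pc b k * d.s k := by
  rw [cut, total_filter_flatMap, sum_map_of_nodup (s := Finset.range d.n) List.nodup_range (by simp),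
    Finset.sum_eq_single_of_mem b (Finset.mem_range.2 hb)]
  · rw [List.filter_eq_self.2]
    · simp [total]
    · intro c hc
      simp [(List.mem_replicate.1 hc).2]
  · intro a _ hab
    exact total_filter_eq_zero fun c hc => by rw [(List.mem_replicate.1 hc).2]; exact hab

theorem total_filter_rest {b : ℕ} (hb : b < d.n) (hent : d.ent b < d.Q) :
    total (d.rest.filter fun c => c.1 = b) = d.pool d.Q b := by
  rw [rest, total_filter_flatMap,
    sum_map_of_nodup (s := Finset.range d.Q) List.nodup_range (by simp),
    Finset.sum_eq_single_of_mem (d.ent b) (Finset.mem_range.2 hent)]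
  · rw [List.filter_map, List.filter_filter, total, List.map_map,
      sum_map_of_nodup (s := {b}) (List.nodup_range.filter _)]
    · simp
    · intro a
      simp only [List.mem_filter, List.mem_range, Function.comp, Bool.and_eq_true,
        decide_eq_true_eq, Finset.mem_singleton]
      exact ⟨fun h => h.2.1, fun h => by subst h; exact ⟨hb, rfl, rfl⟩⟩
  · intro e _ hne
    refine total_filter_eq_zero fun c hc => ?_
    simp only [List.mem_map, List.mem_filter, decide_eq_true_eq] at hc
    obtain ⟨a, ⟨_, ha⟩, rfl⟩ := hc
    rintro rfl
    exact hne ha.symm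

/-- The fragments with label `b` have the total length that is prescribed by the data. -/
theorem total_filter_frags {b : ℕ} (hb : b < d.n) (hent : d.ent b < d.Q) :
    total (d.frags.filter fun c => c.1 = b) =
      d.r b + ∑ k ∈ Finset.range d.Q, d.pc b k * d.s k := by
  have key : ∀ k, total (((List.range k).flatMap d.block).filter fun c => c.1 = b) + d.pool k b =
      d.r b + ∑ j ∈ Finset.range k, d.pc b j * d.s j := by
    intro k
    induction k with
    | zero => simp [pool]
    | succ k ih =>
      have h1 := total_filter_fill_add_drain (d.pool k) (d.need k) (order d.n d.ent k) b
      have h2 : d.pool (k + 1) b = drain (d.pool k) (d.need k) (order d.n d.ent k) b := rfl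
      rw [Finset.sum_range_succ, List.range_succ, List.flatMap_append, List.filter_append,
        total_append, List.flatMap_singleton, block, List.filter_append, total_append,
        total_filter_cut hb, h2]
      linarith
  rw [frags, List.filter_append, total_append, total_filter_rest hb hent]
  exact key d.Q

theorem total_eq_sum_filter {n : ℕ} {L : List (ℕ × ℝ)} (h : ∀ a ∈ L, a.1 < n) :
    total L = ∑ b ∈ Finset.range n, total (L.filter fun c => c.1 = b) := by
  induction L with
  | nil => simp
  | cons a L ih =>
    have e : ∀ b, total ((a :: L).filter fun c => c.1 = b) =
        (if b = a.1 then a.2 else 0) + total (L.filter fun c => c.1 = b) := by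
      intro b
      rw [List.filter_cons]
      by_cases hb : a.1 = b
      · simp [hb]
      · simp [hb, Ne.symm hb]
    simp only [e]
    rw [Finset.sum_add_distrib, ← ih fun c hc => h c (by simp [hc]), Finset.sum_ite_eq',
      if_pos (Finset.mem_range.2 (h a (by simp))), total_cons]

end LineData

/-! ### The family of couplings -/

/-- The parameters of the family: the ratio `ρ` of consecutive piece sizes, the number `U` of
classes of pieces that are cut from a state explicitly, the number `D` of groups into which the
states of a class are divided, the bound `B` on the number of pieces, the number `m` of marginals,
the number `n` of states, and the number `K` of classes of states. -/
structure Par where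
  ρ : ℝ
  U : ℕ
  D : ℕ
  B : ℕ
  m : ℕ
  n : ℕ
  K : ℕ

namespace Par
variable (P : Par)

/-- The number of classes of pieces. -/
def Q : ℕ := P.K + P.U + 1

/-- The number of digits of the advice. -/
def len : ℕ := P.K * P.m * P.D * (P.U + 1)

/-- The place in the advice of the group `r` of the states of class `j` of the marginal `i`. -/
def idx (j i r : ℕ) : ℕ := ((j * P.m + i) * P.D + r) * (P.U + 1)

/-- The class of a mass. -/
noncomputable def cls (v : ℝ) : ℕ := Nat.count (fun k => v < P.ρ ^ k) P.K

/-- The group of a state within its class. -/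
noncomputable def group (p : ℕ → ℝ) (a : ℕ) : ℕ :=
  Nat.count (fun b => P.cls (p b) = P.cls (p a)) a % P.D

/-- The place in the advice of the state `a` of the marginal `i`. -/
noncomputable def place (i : ℕ) (p : ℕ → ℝ) (a : ℕ) : ℕ := P.idx (P.cls (p a)) i (P.group p a)

/-- The mass of the pieces that the advice at the place `b` cuts from a state of class `c`. -/
noncomputable def used (adv : ℕ → ℕ) (c b : ℕ) : ℝ :=
  ∑ u ∈ Finset.range P.U, (adv (b + u) : ℝ) * P.ρ ^ (c + u)

/-- The place in the advice that is used for the state `a`. -/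
noncomputable def blk (adv : ℕ → ℕ) (i : ℕ) (p : ℕ → ℝ) (a : ℕ) : ℕ :=
  if 0 ≤ p a - P.used adv (P.cls (p a)) (P.place i p a) then P.place i p a else P.len

/-- The mass of the state `a` that is not cut into pieces. -/
noncomputable def rem (adv : ℕ → ℕ) (i : ℕ) (p : ℕ → ℝ) (a : ℕ) : ℝ :=
  if 0 ≤ p a - P.used adv (P.cls (p a)) (P.place i p a) then
    p a - P.used adv (P.cls (p a)) (P.place i p a) else p a

/-- The class at which the state `a` enters the pool. -/
noncomputable def ent (adv : ℕ → ℕ) (i : ℕ) (p : ℕ → ℝ) (a : ℕ) : ℕ :=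
  if adv (P.blk adv i p a + P.U) ≤ 0 then P.cls (p a) + P.U else P.cls (p a)

/-- The number of pieces of class `k` that are cut from the state `a`. -/
noncomputable def pc (adv : ℕ → ℕ) (i : ℕ) (p : ℕ → ℝ) (a k : ℕ) : ℕ :=
  if P.cls (p a) ≤ k then
    if k < P.cls (p a) + P.U then adv (P.blk adv i p a + (k - P.cls (p a))) else 0
  else 0

/-- The number of pieces of class `k` of the marginal `i`. -/
noncomputable def pieces (adv : ℕ → ℕ) (i : ℕ) (p : ℕ → ℝ) (k : ℕ) : ℕ :=
  ∑ a ∈ Finset.range P.n, P.pc adv i p a k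

/-- The number of pieces of class `k` on the line. -/
noncomputable def nk (adv : ℕ → ℕ) (p : ℕ → ℕ → ℝ) (k : ℕ) : ℕ :=
  (Finset.range P.m).sup fun i => P.pieces adv i (p i) k

/-- The data of the marginal `i`. -/
noncomputable def line (adv : ℕ → ℕ) (p : ℕ → ℕ → ℝ) (i : ℕ) : LineData where
  n := P.n
  Q := P.Q
  s k := P.ρ ^ k
  ent := P.ent adv i (p i)
  pc := P.pc adv i (p i)
  nk := P.nk adv p
  r := P.rem adv i (p i)

/-- The coupling that is encoded by the advice. -/
noncomputable def coupling (adv : ℕ → ℕ) (p : ℕ → ℕ → ℝ) : (Fin P.m → Fin P.n) → ℝ :=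
  joint (fun i => labelAt 0 (P.line adv p i).frags) 0 1

variable {P}

theorem cls_le (v : ℝ) : P.cls v ≤ P.K := Nat.count_le _

/-- The largest entry class is `K + U`, which is why `Q` has one more class. -/
theorem ent_lt (adv : ℕ → ℕ) (i : ℕ) (p : ℕ → ℝ) (a : ℕ) : P.ent adv i p a < P.Q := by
  have := P.cls_le (p a)
  unfold ent Q
  split_ifs <;> omega

theorem rem_nonneg {adv : ℕ → ℕ} {i : ℕ} {p : ℕ → ℝ} (hp : ∀ a, 0 ≤ p a) (a : ℕ) :
    0 ≤ P.rem adv i p a := by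
  unfold rem
  split_ifs with h
  · exact h
  · exact hp a

theorem sum_pc (adv : ℕ → ℕ) (i : ℕ) (p : ℕ → ℝ) (a : ℕ) :
    ∑ k ∈ Finset.range P.Q, (P.pc adv i p a k : ℝ) * P.ρ ^ k =
      P.used adv (P.cls (p a)) (P.blk adv i p a) := by
  have h := P.cls_le (p a)
  have h1 : ∀ k, (P.pc adv i p a k : ℝ) * P.ρ ^ k = if k ∈ Finset.Ico (P.cls (p a))
      (P.cls (p a) + P.U) then (adv (P.blk adv i p a + (k - P.cls (p a))) : ℝ) * P.ρ ^ k else 0 := by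
    intro k
    simp only [pc, Finset.mem_Ico]
    split_ifs <;> simp_all
  simp only [h1]
  rw [← Finset.sum_filter, Finset.filter_mem_eq_inter, Finset.inter_eq_right.2,
    Finset.sum_Ico_eq_sum_range]
  · simp [used]
  · intro k hk
    simp only [Finset.mem_Ico, Finset.mem_range, Q] at hk ⊢
    omega

/-- If the prescribed pieces do not fit into the state, the digits are read from position `len` on,
where they vanish: nothing is cut and the state keeps its whole mass. Thus arbitrary advice
preserves the marginals. -/
theorem rem_add_sum_pc {adv : ℕ → ℕ} (hadv : ∀ b, P.len ≤ b → adv b = 0) (i : ℕ) (p : ℕ → ℝ)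
    (a : ℕ) : P.rem adv i p a + ∑ k ∈ Finset.range P.Q, (P.pc adv i p a k : ℝ) * P.ρ ^ k = p a := by
  rw [sum_pc, rem, blk]
  split_ifs with h
  · ring
  · have : P.used adv (P.cls (p a)) P.len = 0 := Finset.sum_eq_zero fun u _ => by
      rw [hadv _ (by omega)]; simp
    rw [this, add_zero]

theorem total_frags {adv : ℕ → ℕ} (hadv : ∀ b, P.len ≤ b → adv b = 0) (p : ℕ → ℕ → ℝ)
    (i : ℕ) {b : ℕ} (hb : b < P.n) :
    total ((P.line adv p i).frags.filter fun c => c.1 = b) = p i b := by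
  rw [LineData.total_filter_frags hb (ent_lt adv i (p i) b)]
  exact rem_add_sum_pc hadv i (p i) b

/-- No compatibility of the advice with the marginals is required, so an exhaustive search never
produces an infeasible table. -/
theorem isCoupling_coupling (hρ : 0 ≤ P.ρ) {adv : ℕ → ℕ} (hadv : ∀ b, P.len ≤ b → adv b = 0)
    {p : Fin P.m → Fin P.n → ℝ} (hp : ∀ i, p i ∈ stdSimplex ℝ (Fin P.n)) {p' : ℕ → ℕ → ℝ}
    (hp' : ∀ i a, p' (i : Fin P.m) (a : Fin P.n) = p i a) (hp0 : ∀ i a, 0 ≤ p' i a) :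
    (∀ i : Fin P.m, total (P.line adv p' i).frags = 1) ∧ IsCoupling p (P.coupling adv p') := by
  have hs : ∀ i k, 0 ≤ (P.line adv p' i).s k := fun i k => pow_nonneg hρ k
  have hr : ∀ i a, 0 ≤ (P.line adv p' i).r a := fun i a => rem_nonneg (hp0 i) a
  have ht : ∀ i : Fin P.m, total (P.line adv p' i).frags = 1 := by
    intro i
    rw [LineData.total_eq_sum_filter fun a ha => (LineData.frags_mem (hs i) (hr i) ha).1]
    rw [← (hp i).2]
    refine (Finset.sum_congr rfl fun b hb => total_frags hadv p' i (Finset.mem_range.1 hb)).trans ?_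
    rw [Finset.sum_range]
    exact Finset.sum_congr rfl fun a _ => hp' i a
  refine ⟨ht, isCoupling_joint (fun i => measurable_labelAt _ _) (fun i t h => ?_) fun i a => ?_⟩
  · exact labelAt_lt (fun a ha => (LineData.frags_mem (hs i) (hr i) ha).1)
      (by rw [ht]; simpa using h.2) h.1
  · have h1 := volume_labelAt (fun b hb => (LineData.frags_mem (hs i) (hr i) hb).2) 0 a
    rw [ht, zero_add] at h1
    rw [h1, total_frags hadv p' i a.2, hp']

end Par

/-! ### Sorting the states of a class -/

/-- Within each class, the values of `h` can be permuted such that few groups have more than one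
value. -/
theorem exists_perm_few_mixed {n N : ℕ} (c β : Fin n → ℕ) (h : Fin n → Fin N) :
    ∃ σ : Equiv.Perm (Fin n), (∀ a, c (σ a) = c a) ∧
      ∀ j, ∀ R : Finset ℕ, (∀ r ∈ R, ∃ a a', c a = j ∧ c a' = j ∧ β a = r ∧ β a' = r ∧
        h (σ a) < h (σ a')) → R.card ≤ N := by
  set f : Fin n → ℕ ×ₗ ℕ := fun a => toLex (c a, β a) with hf
  set g : Fin n → ℕ ×ₗ Fin N := fun a => toLex (c a, h a) with hg
  have mf : Monotone (f ∘ Tuple.sort f) := Tuple.monotone_sort f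
  have mg : Monotone (g ∘ Tuple.sort g) := Tuple.monotone_sort g
  have cf : Monotone (c ∘ Tuple.sort f) := fun a b hab => Prod.Lex.monotone_fst _ _ (mf hab)
  have cg : Monotone (c ∘ Tuple.sort g) := fun a b hab => Prod.Lex.monotone_fst _ _ (mg hab)
  -- Both lists are sorted by class first, and a monotone rearrangement is unique, so equal
  -- positions carry equal classes.
  have hc : c ∘ Tuple.sort f = c ∘ Tuple.sort g := Tuple.unique_monotone cf cg
  refine ⟨(Tuple.sort f).symm.trans (Tuple.sort g), fun a => ?_, fun j R hR => ?_⟩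
  · have := congrFun hc ((Tuple.sort f).symm a)
    simpa using this.symm
  · rcases R.eq_empty_or_nonempty with rfl | ⟨r₀, hr₀⟩
    · simp
    have : Nonempty (Fin n) := ⟨(hR r₀ hr₀).choose⟩
    choose! a a' h1 h2 h3 h4 h5 using hR
    -- In the first list the groups of one class follow each other, and along it the transported
    -- values do not decrease. A mixed group contains a strict increase, so the lower values of
    -- distinct mixed groups are distinct, and there are only `N` values.
    have hmono : ∀ r ∈ R, ∀ r' ∈ R, r < r' →
        h (Tuple.sort g ((Tuple.sort f).symm (a r))) <
          h (Tuple.sort g ((Tuple.sort f).symm (a r'))) := by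
      intro r hr r' hr' hlt
      refine (h5 r hr).trans_le ?_
      have hpos : (Tuple.sort f).symm (a' r) ≤ (Tuple.sort f).symm (a r') := by
        by_contra hcon
        have hle := mf (not_le.1 hcon).le
        simp only [Function.comp, Equiv.apply_symm_apply, hf] at hle
        rw [Prod.Lex.toLex_le_toLex] at hle
        simp only [h1 r' hr', h2 r hr, lt_irrefl, h3 r' hr', h4 r hr, false_or, true_and] at hle
        omega
      have hle := mg hpos
      simp only [Function.comp, hg] at hle
      rw [Prod.Lex.toLex_le_toLex] at hle
      have e1 := congrFun hc ((Tuple.sort f).symm (a' r))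
      have e2 := congrFun hc ((Tuple.sort f).symm (a r'))
      simp only [Function.comp, Equiv.apply_symm_apply, h2 r hr, h1 r' hr'] at e1 e2
      rcases hle with hle | hle
      · exact absurd (e1.symm.trans e2) hle.ne
      · exact hle.2
    have : R.card ≤ (Finset.univ : Finset (Fin N)).card := by
      refine Finset.card_le_card_of_injOn
        (fun r => h (Tuple.sort g ((Tuple.sort f).symm (a r)))) (fun _ _ => Finset.mem_univ _) ?_
      intro r hr r' hr' he
      rcases lt_trichotomy r r' with hlt | hlt | hlt
      · exact absurd he (hmono r hr r' hr' hlt).ne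
      · exact hlt
      · exact absurd he (hmono r' hr' r hr hlt).ne'
    simpa using this

/-- The states of a class that belong to groups with more than one value are few. -/
theorem card_mixed_le {N D : ℕ} (S : Finset ℕ) (rank : ℕ → ℕ)
    (hrank : ∀ a ∈ S, rank a < S.card) (hinj : Set.InjOn rank S)
    (M : Finset ℕ) (hMS : M ⊆ S)
    (hM : ∀ a ∈ M, ∃ a' ∈ S, ∃ a'' ∈ S, a' ≠ a'' ∧ rank a' % D = rank a % D ∧
      rank a'' % D = rank a % D)
    (hN : (M.image fun a => rank a % D).card ≤ N) : M.card * D ≤ 2 * N * S.card := by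
  -- In a class of at most `D` states every group is a single state, hence not mixed. In a larger
  -- class a group has at most `S.card / D + 1` states, and `D < S.card` absorbs the rounding at the
  -- price of the factor 2.
  rcases le_or_gt S.card D with h | h
  · have : M = ∅ := by
      rw [Finset.eq_empty_iff_forall_notMem]
      intro a ha
      obtain ⟨a', h', a'', h'', hne, e', e''⟩ := hM a ha
      rw [Nat.mod_eq_of_lt ((hrank a' h').trans_le h)] at e'
      rw [Nat.mod_eq_of_lt ((hrank a'' h'').trans_le h)] at e''
      exact hne (hinj h' h'' (e'.trans e''.symm))
    simp [this]
  · have h1 : M.card ≤ (S.card / D + 1) * (M.image fun a => rank a % D).card := by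
      refine Finset.card_le_mul_card_image M _ fun r _ => ?_
      rw [← Finset.card_range (S.card / D + 1)]
      refine Finset.card_le_card_of_injOn (fun a => rank a / D) ?_ ?_
      · intro a ha
        rw [Finset.mem_coe, Finset.mem_filter] at ha
        simp only [Finset.coe_range, Set.mem_Iio]
        exact Nat.lt_succ_of_le (Nat.div_le_div_right (hrank a (hMS ha.1)).le)
      · intro a ha b hb hab
        rw [Finset.mem_coe, Finset.mem_filter] at ha hb
        refine hinj (hMS ha.1) (hMS hb.1) ?_
        rw [← Nat.div_add_mod (rank a) D, ← Nat.div_add_mod (rank b) D, ha.2, hb.2]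
        simp only at hab
        rw [hab]
    have h2 : S.card / D * D ≤ S.card := Nat.div_mul_le_self _ _
    calc M.card * D ≤ ((S.card / D + 1) * N) * D := by gcongr; exact h1.trans (by gcongr)
      _ = N * (S.card / D * D + D) := by ring
      _ ≤ N * (S.card + S.card) := by gcongr
      _ = _ := by ring

namespace Par
variable {P : Par}

/-! ### Classes of masses -/

/-- For a downward closed predicate the count is the threshold. This is the form in which a machine
without logarithms can find the class of a mass. -/
theorem count_lt_iff {p : ℕ → Prop} [DecidablePred p] (hp : ∀ j k, j ≤ k → p k → p j) {K k : ℕ}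
    (hk : k < K) : p k ↔ k < Nat.count p K := by
  constructor
  · intro h
    have h1 : Nat.count p (k + 1) = k + 1 :=
      Nat.count_iff_forall.2 fun j hj => hp j k (by omega) h
    have h2 := Nat.count_monotone p (show k + 1 ≤ K by omega)
    omega
  · intro h
    by_contra hcon
    have h1 : ∀ d, Nat.count p (k + d) ≤ k := by
      intro d
      induction d with
      | zero => exact Nat.count_le p
      | succ d ih =>
        rw [← add_assoc, Nat.count_succ, if_neg fun h' => hcon (hp k (k + d) (by omega) h')]
        exact ih
    have h2 := h1 (K - k)
    rw [Nat.add_sub_cancel' hk.le] at h2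
    omega

theorem lt_cls_iff (h0 : 0 < P.ρ) (h1 : P.ρ < 1) {v : ℝ} {k : ℕ} (hk : k < P.K) :
    v < P.ρ ^ k ↔ k < P.cls v :=
  count_lt_iff (p := fun k => v < P.ρ ^ k) (fun _ _ hjk h => h.trans_le (pow_le_pow_of_le_one h0.le h1.le hjk)) hk

theorem pow_cls_le (h0 : 0 < P.ρ) (h1 : P.ρ < 1) {v : ℝ} (h : P.cls v < P.K) :
    P.ρ ^ P.cls v ≤ v := by
  by_contra hcon
  exact lt_irrefl _ ((lt_cls_iff h0 h1 h).1 (not_le.1 hcon))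

/-- Together with `pow_cls_le` this shows that masses of one class agree up to the factor `ρ`. The
bound `v ≤ 1` is needed in class `0` only. -/
theorem mul_lt_pow_cls (h0 : 0 < P.ρ) (h1 : P.ρ < 1) {v : ℝ} (hv : v ≤ 1) :
    P.ρ * v < P.ρ ^ P.cls v := by
  rcases Nat.eq_zero_or_pos (P.cls v) with h | h
  · rw [h, pow_zero]; nlinarith
  · obtain ⟨k, hk⟩ := Nat.exists_eq_succ_of_ne_zero h.ne'
    have hle := P.cls_le v
    have := (lt_cls_iff h0 h1 (v := v) (show k < P.K by omega)).2 (by omega)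
    rw [hk, pow_succ']
    gcongr

theorem cls_anti {v w : ℝ} (h : v ≤ w) : P.cls w ≤ P.cls v :=
  Nat.count_mono_left fun _ _ => h.trans_lt

/-! ### Advice with prescribed digits -/

/-- States in the last class `K` refer to positions beyond the advice, that is, to zeros: they are
not cut and are not marked as misfits. -/
theorem idx_ge {j i r : ℕ} (h : P.K ≤ j) : P.len ≤ P.idx j i r := by
  unfold len idx
  gcongr
  calc P.K * P.m * P.D ≤ j * P.m * P.D := by gcongr
    _ ≤ (j * P.m + i) * P.D + r := by nlinarith

/-- The position is a mixed radix number with the digits class, marginal, group and offset, so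
division with remainder recovers all four. -/
theorem exists_advice (hm : 0 < P.m) (hD : 0 < P.D) (g : ℕ → ℕ → ℕ → ℕ → ℕ) {B : ℕ} (hB : 0 < B)
    (hg : ∀ j i r u, g j i r u < B) :
    ∃ adv : ℕ → ℕ, (∀ b, adv b < B) ∧ (∀ b, P.len ≤ b → adv b = 0) ∧
      ∀ j < P.K, ∀ i < P.m, ∀ r < P.D, ∀ u < P.U + 1, adv (P.idx j i r + u) = g j i r u := by
  refine ⟨fun b => if b / (P.U + 1) / P.D / P.m < P.K then
    g (b / (P.U + 1) / P.D / P.m) (b / (P.U + 1) / P.D % P.m) (b / (P.U + 1) % P.D)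
      (b % (P.U + 1)) else 0, fun b => ?_, fun b hb => ?_, fun j hj i hi r hr u hu => ?_⟩
  · dsimp only
    split_ifs
    · exact hg _ _ _ _
    · exact hB
  · dsimp only
    rw [if_neg]
    rw [not_lt, Nat.le_div_iff_mul_le hm, Nat.le_div_iff_mul_le hD,
      Nat.le_div_iff_mul_le (Nat.succ_pos _)]
    exact hb
  · have e1 : (P.idx j i r + u) / (P.U + 1) = (j * P.m + i) * P.D + r := by
      rw [idx, mul_comm, Nat.mul_add_div (Nat.succ_pos _), Nat.div_eq_of_lt hu, add_zero]
    have e2 : (P.idx j i r + u) % (P.U + 1) = u := by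
      rw [idx, mul_comm, Nat.mul_add_mod, Nat.mod_eq_of_lt hu]
    have e3 : ((j * P.m + i) * P.D + r) / P.D = j * P.m + i := by
      rw [mul_comm, Nat.mul_add_div hD, Nat.div_eq_of_lt hr, add_zero]
    have e4 : ((j * P.m + i) * P.D + r) % P.D = r := by
      rw [mul_comm, Nat.mul_add_mod, Nat.mod_eq_of_lt hr]
    have e5 : (j * P.m + i) / P.m = j := by
      rw [mul_comm, Nat.mul_add_div hm, Nat.div_eq_of_lt hi, add_zero]
    have e6 : (j * P.m + i) % P.m = i := by
      rw [mul_comm, Nat.mul_add_mod, Nat.mod_eq_of_lt hi]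
    simp only [e1, e2, e3, e4, e5, e6, if_pos hj]

/-! ### The advice for a given coupling -/

/-- The number of states of mass `q x` with `x i = a` that are cut from `a` as pieces of class
`k`. -/
noncomputable def pieceCount (P : Par) (p : ℕ → ℕ → ℝ) (q : (Fin P.m → Fin P.n) → ℝ) (i : Fin P.m)
    (a : Fin P.n) (k : ℕ) : ℕ :=
  (Finset.univ.filter fun x : Fin P.m → Fin P.n => x i = a ∧ P.cls (q x) < P.K ∧
    P.cls (q x) + 1 = k ∧ k < P.cls (p i a) + P.U).card

/-- `q` is a coupling of the first rows of `p`. -/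
structure IsCouplingOf (p : ℕ → ℕ → ℝ) (q : (Fin P.m → Fin P.n) → ℝ) : Prop where
  nonneg : ∀ x, 0 ≤ q x
  sum_eq : ∑ x, q x = 1
  marginal : ∀ (i : Fin P.m) (a : Fin P.n), ∑ x with x i = a, q x = p i a

section
variable {p : ℕ → ℕ → ℝ} {q : (Fin P.m → Fin P.n) → ℝ}

theorem IsCouplingOf.le_marginal (hq : IsCouplingOf p q) (i : Fin P.m) (x : Fin P.m → Fin P.n) :
    q x ≤ p i (x i) := by
  rw [← hq.marginal i (x i)]
  exact Finset.single_le_sum (fun y _ => hq.nonneg y) (by simp)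

theorem sum_sum_filter (i : Fin P.m)
    (f : (Fin P.m → Fin P.n) → ℝ) : ∑ a, ∑ x with x i = a, f x = ∑ x, f x :=
  Finset.sum_fiberwise _ _ _

theorem IsCouplingOf.sum_p (hq : IsCouplingOf p q) (i : Fin P.m) :
    ∑ a : Fin P.n, p i a = 1 := by
  rw [← hq.sum_eq, ← sum_sum_filter i]
  exact Finset.sum_congr rfl fun a _ => (hq.marginal i a).symm

theorem IsCouplingOf.p_nonneg (hq : IsCouplingOf p q) (i : Fin P.m) (a : Fin P.n) : 0 ≤ p i a := by
  rw [← hq.marginal]; exact Finset.sum_nonneg fun x _ => hq.nonneg x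

theorem IsCouplingOf.p_le_one (hq : IsCouplingOf p q) (i : Fin P.m) (a : Fin P.n) : p i a ≤ 1 := by
  rw [← hq.sum_p i]
  exact Finset.single_le_sum (f := fun a : Fin P.n => p i a) (fun b _ => hq.p_nonneg i b)
    (Finset.mem_univ a)

theorem IsCouplingOf.le_one (hq : IsCouplingOf p q) (x : Fin P.m → Fin P.n) : q x ≤ 1 := by
  rw [← hq.sum_eq]
  exact Finset.single_le_sum (fun y _ => hq.nonneg y) (Finset.mem_univ x)

theorem IsCouplingOf.cls_le_cls (hq : IsCouplingOf p q) (i : Fin P.m) (x : Fin P.m → Fin P.n) :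
    P.cls (p i (x i)) ≤ P.cls (q x) := cls_anti (hq.le_marginal i x)

theorem pieceCount_pos (hq : IsCouplingOf p q) {i : Fin P.m} {a : Fin P.n} {k : ℕ}
    (h : 0 < P.pieceCount p q i a k) :
    P.cls (p i a) < k ∧ k < P.cls (p i a) + P.U ∧ P.cls (p i a) < P.K := by
  obtain ⟨x, hx⟩ := Finset.card_pos.1 h
  obtain ⟨rfl, h1, h2, h3⟩ := (Finset.mem_filter.1 hx).2
  have := hq.cls_le_cls i x
  exact ⟨by omega, h3, by omega⟩

theorem pieceCount_mul (i : Fin P.m) (a : Fin P.n) (k : ℕ) :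
    (P.pieceCount p q i a k : ℝ) * P.ρ ^ k = ∑ x with x i = a,
      if P.cls (q x) < P.K ∧ P.cls (q x) + 1 = k ∧ k < P.cls (p i a) + P.U then
        P.ρ ^ (P.cls (q x) + 1) else 0 := by
  rw [← Finset.sum_filter, Finset.filter_filter, pieceCount, ← nsmul_eq_mul, ← Finset.sum_const]
  exact Finset.sum_congr rfl fun x hx => by rw [(Finset.mem_filter.1 hx).2.2.2.1]

theorem sum_pieceCount (i : Fin P.m) (a : Fin P.n) {k : ℕ} :
    ∑ j ∈ Finset.range k, (P.pieceCount p q i a j : ℝ) * P.ρ ^ j = ∑ x with x i = a,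
      if P.cls (q x) < P.K ∧ P.cls (q x) + 1 < k ∧ P.cls (q x) + 1 < P.cls (p i a) + P.U then
        P.ρ ^ (P.cls (q x) + 1) else 0 := by
  simp only [pieceCount_mul]
  rw [Finset.sum_comm]
  refine Finset.sum_congr rfl fun x _ => ?_
  have : ∀ j, (if P.cls (q x) < P.K ∧ P.cls (q x) + 1 = j ∧ j < P.cls (p i a) + P.U then
      P.ρ ^ (P.cls (q x) + 1) else 0) = if P.cls (q x) + 1 = j then
      (if P.cls (q x) < P.K ∧ P.cls (q x) + 1 < P.cls (p i a) + P.U then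
        P.ρ ^ (P.cls (q x) + 1) else 0) else 0 := by
    intro j
    by_cases h : P.cls (q x) + 1 = j
    · subst h; simp
    · simp [h]
  simp only [this]
  rw [Finset.sum_ite_eq]
  by_cases h : P.cls (q x) + 1 < k <;> simp [h]

/-- A piece has class one higher than the class of its state in `q`, so it takes at most the share
`ρ` of it. This slack is what allows two states of a class to exchange their patterns. -/
theorem sum_pieceCount_le (h0 : 0 < P.ρ) (h1 : P.ρ < 1) (hq : IsCouplingOf p q) (i : Fin P.m)
    (a : Fin P.n) (k : ℕ) :
    ∑ j ∈ Finset.range k, (P.pieceCount p q i a j : ℝ) * P.ρ ^ j ≤ P.ρ * p i a := by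
  rw [sum_pieceCount, ← hq.marginal, Finset.mul_sum]
  refine Finset.sum_le_sum fun x _ => ?_
  split_ifs with h
  · rw [pow_succ']
    exact mul_le_mul_of_nonneg_left (pow_cls_le h0 h1 h.1) h0.le
  · exact mul_nonneg h0.le (hq.nonneg x)

/-- The pieces cut from a state of class `c` have size at least `ρ ^ (c + U)` and total less than `ρ
^ c`, so there are fewer than `ρ ^ (-U)` of them. -/
theorem pieceCount_lt (h0 : 0 < P.ρ) (h1 : P.ρ < 1) (hB : 1 ≤ P.B * P.ρ ^ P.U)
    (hq : IsCouplingOf p q) (i : Fin P.m) (a : Fin P.n) (k : ℕ) :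
    P.pieceCount p q i a k < P.B := by
  rcases Nat.eq_zero_or_pos (P.pieceCount p q i a k) with h | h
  · rw [h]
    rcases Nat.eq_zero_or_pos P.B with h' | h'
    · rw [h'] at hB; norm_num at hB
    · exact h'
  · obtain ⟨h2, h3, h4⟩ := pieceCount_pos hq h
    have h5 := sum_pieceCount_le h0 h1 hq i a (k + 1)
    rw [Finset.sum_range_succ] at h5
    have h6 : 0 ≤ ∑ j ∈ Finset.range k, (P.pieceCount p q i a j : ℝ) * P.ρ ^ j :=
      Finset.sum_nonneg fun j _ => by positivity
    have h7 := mul_lt_pow_cls h0 h1 (hq.p_le_one i a)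
    have h8 : (P.pieceCount p q i a k : ℝ) * P.ρ ^ k < P.ρ ^ P.cls (p i a) := by linarith
    have h9 : P.ρ ^ (P.cls (p i a) + P.U) ≤ P.ρ ^ k := pow_le_pow_of_le_one h0.le h1.le h3.le
    rw [pow_add] at h9
    have h10 : (0 : ℝ) < P.ρ ^ P.cls (p i a) := by positivity
    have h11 : (P.pieceCount p q i a k : ℝ) * P.ρ ^ P.U < 1 := by
      by_contra hcon
      push Not at hcon
      have : P.ρ ^ P.cls (p i a) * 1 ≤ P.ρ ^ P.cls (p i a) *
        ((P.pieceCount p q i a k : ℝ) * P.ρ ^ P.U) := by gcongr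
      have : (P.pieceCount p q i a k : ℝ) * (P.ρ ^ P.cls (p i a) * P.ρ ^ P.U) ≤
        (P.pieceCount p q i a k : ℝ) * P.ρ ^ k := by gcongr
      linarith
    have h12 : (0 : ℝ) < P.ρ ^ P.U := by positivity
    have h13 : (P.pieceCount p q i a k : ℝ) < P.B := by
      by_contra hcon
      push Not at hcon
      have : (P.B : ℝ) * P.ρ ^ P.U ≤ P.pieceCount p q i a k * P.ρ ^ P.U := by gcongr
      linarith
    exact_mod_cast h13

/-- The number of possible piece patterns of a state. -/
def patterns (P : Par) : ℕ := Fintype.card (Fin P.U → Fin P.B)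

/-- Advice that cuts, from all but few states, the pieces of a coupling. -/
structure GoodAdvice (p : ℕ → ℕ → ℝ) (q : (Fin P.m → Fin P.n) → ℝ) (adv : ℕ → ℕ) (i : Fin P.m)
    (σ : Equiv.Perm (Fin P.n)) (M : Finset (Fin P.n)) : Prop where
  cls_perm : ∀ a, P.cls (p i (σ a)) = P.cls (p i a)
  card_le : ∀ j < P.K, (M.filter fun a : Fin P.n => P.cls (p i a) = j).card * P.D ≤
    2 * P.patterns * (Finset.univ.filter fun a : Fin P.n => P.cls (p i a) = j).card
  cls_lt : ∀ a ∈ M, P.cls (p i a) < P.K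
  ent_mem : ∀ a ∈ M, P.ent adv i (p i) a = P.cls (p i a)
  ent_notMem : ∀ a ∉ M, P.ent adv i (p i) a = P.cls (p i a) + P.U
  pc_mem : ∀ a ∈ M, ∀ k, P.pc adv i (p i) a k = 0
  pc_notMem : ∀ a ∉ M, ∀ k, P.pc adv i (p i) a k = P.pieceCount p q i (σ a) k

/-- Within each class the piece patterns of `q` are permuted so that few groups are mixed. A group
with a constant pattern stores it with flag `0`; a mixed group stores no pieces and flag `1`, which
makes its states enter the pool at once. The flag is the digit at offset `U`, hence `2 ≤ B`. -/
theorem exists_goodAdvice (h0 : 0 < P.ρ) (h1 : P.ρ < 1) (hm : 0 < P.m) (hD : 0 < P.D)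
    (hB1 : 2 ≤ P.B) (hB : 1 ≤ P.B * P.ρ ^ P.U) (hq : IsCouplingOf p q) :
    ∃ adv : ℕ → ℕ, (∀ b, adv b < P.B) ∧ (∀ b, P.len ≤ b → adv b = 0) ∧
      ∀ i, ∃ σ M, GoodAdvice p q adv i σ M := by
  classical
  let pat : Fin P.m → Fin P.n → (Fin P.U → Fin P.B) := fun i a u =>
    ⟨P.pieceCount p q i a (P.cls (p i a) + u), pieceCount_lt h0 h1 hB hq _ _ _⟩
  let e := Fintype.equivFin (Fin P.U → Fin P.B)
  choose σ hσ hmix using fun i : Fin P.m => exists_perm_few_mixed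
    (fun a : Fin P.n => P.cls (p i a)) (fun a : Fin P.n => P.group (p i) a) fun a => e (pat i a)
  let g : ℕ → ℕ → ℕ → ℕ → ℕ := fun j i r u =>
    if hi : i < P.m then
      if h : ∃ τ : Fin P.U → Fin P.B, ∀ a : Fin P.n, P.cls (p i a) = j → P.group (p i) a = r →
          pat ⟨i, hi⟩ (σ ⟨i, hi⟩ a) = τ then
        if hu : u < P.U then h.choose ⟨u, hu⟩ else 0
      else if u < P.U then 0 else 1
    else 0
  have hg : ∀ j i r u, g j i r u < P.B := by
    intro j i r u
    simp only [g]
    split_ifs with hi h hu hu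
    · exact (h.choose ⟨u, hu⟩).2
    all_goals omega
  obtain ⟨adv, ha1, ha2, ha3⟩ := exists_advice hm hD g (by omega) hg
  refine ⟨adv, ha1, ha2, fun i => ?_⟩
  let mixed : Fin P.n → Prop := fun a => ¬ ∃ τ : Fin P.U → Fin P.B, ∀ a' : Fin P.n,
    P.cls (p i a') = P.cls (p i a) → P.group (p i) a' = P.group (p i) a → pat i (σ i a') = τ
  have hgroup : ∀ a : Fin P.n, P.group (p i) a < P.D := fun a => Nat.mod_lt _ hD
  let M := Finset.univ.filter fun a : Fin P.n => P.cls (p i a) < P.K ∧ mixed a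
  have place_ge : ∀ a : Fin P.n, ¬ P.cls (p i a) < P.K → P.len ≤ P.place i (p i) a :=
    fun a h => idx_ge (not_lt.1 h)
  have hM : ∀ a ∈ M, (∀ u < P.U, adv (P.place i (p i) a + u) = 0) ∧
      adv (P.place i (p i) a + P.U) = 1 := by
    intro a ha
    obtain ⟨h2, h3⟩ := (Finset.mem_filter.1 ha).2
    constructor
    · intro u hu
      rw [place, ha3 _ h2 _ i.2 _ (hgroup a) _ (by omega)]
      simp only [g]
      rw [dif_pos i.2, dif_neg h3, if_pos hu]
    · rw [place, ha3 _ h2 _ i.2 _ (hgroup a) _ (by omega)]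
      simp only [g]
      rw [dif_pos i.2, dif_neg h3, if_neg (lt_irrefl _)]
  have hnM : ∀ a, a ∉ M → (∀ u < P.U, adv (P.place i (p i) a + u) =
      P.pieceCount p q i (σ i a) (P.cls (p i a) + u)) ∧ adv (P.place i (p i) a + P.U) = 0 := by
    intro a ha
    by_cases h2 : P.cls (p i a) < P.K
    · have h3 : ¬ mixed a := fun h => ha (Finset.mem_filter.2 ⟨Finset.mem_univ _, h2, h⟩)
      have h4 := not_not.1 h3
      constructor
      · intro u hu
        rw [place, ha3 _ h2 _ i.2 _ (hgroup a) _ (by omega)]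
        simp only [g]
        rw [dif_pos i.2, dif_pos h4, dif_pos hu]
        have h5 := h4.choose_spec a rfl rfl
        have h6 := congrArg (fun τ => (τ ⟨u, hu⟩ : ℕ)) h5
        simp only [pat] at h6
        rw [← h6, hσ]
      · rw [place, ha3 _ h2 _ i.2 _ (hgroup a) _ (by omega)]
        simp only [g]
        rw [dif_pos i.2, dif_pos h4, dif_neg (lt_irrefl _)]
    · have h3 := place_ge a h2
      refine ⟨fun u _ => ?_, ha2 _ (by omega)⟩
      rw [ha2 _ (by omega)]
      by_contra hcon
      have := (pieceCount_pos hq (Nat.pos_of_ne_zero (Ne.symm hcon))).2.2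
      rw [hσ] at this
      exact h2 this
  have hblkM : ∀ a ∈ M, P.blk adv i (p i) a = P.place i (p i) a := by
    intro a ha
    rw [blk, if_pos]
    have : P.used adv (P.cls (p i a)) (P.place i (p i) a) = 0 := Finset.sum_eq_zero fun u hu => by
      rw [(hM a ha).1 u (Finset.mem_range.1 hu)]; simp
    rw [this, sub_zero]
    exact hq.p_nonneg i a
  have hpc0 : ∀ (a : Fin P.n) k, ¬ (P.cls (p i a) ≤ k ∧ k < P.cls (p i a) + P.U) →
      P.pieceCount p q i (σ i a) k = 0 := by
    intro a k h
    by_contra hcon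
    have := pieceCount_pos hq (Nat.pos_of_ne_zero hcon)
    rw [hσ] at this
    exact h ⟨this.1.le, this.2.1⟩
  have hblk : ∀ a, a ∉ M → P.blk adv i (p i) a = P.place i (p i) a := by
    intro a ha
    rw [blk, if_pos]
    rw [sub_nonneg]
    have h2 : P.used adv (P.cls (p i a)) (P.place i (p i) a) =
        ∑ k ∈ Finset.Ico (P.cls (p i a)) (P.cls (p i a) + P.U),
          (P.pieceCount p q i (σ i a) k : ℝ) * P.ρ ^ k := by
      rw [Finset.sum_Ico_eq_sum_range, Nat.add_sub_cancel_left]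
      exact Finset.sum_congr rfl fun u hu => by rw [(hnM a ha).1 u (Finset.mem_range.1 hu)]
    rw [h2]
    by_cases h3 : P.cls (p i a) < P.K
    · have h4 := sum_pieceCount_le h0 h1 hq i (σ i a) (P.cls (p i a) + P.U)
      have h5 := mul_lt_pow_cls h0 h1 (hq.p_le_one i (σ i a))
      have h6 := pow_cls_le h0 h1 h3
      rw [hσ] at h5
      refine le_trans (Finset.sum_le_sum_of_subset_of_nonneg ?_ fun _ _ _ => by positivity)
        (h4.trans (h5.le.trans h6))
      intro k hk
      simp only [Finset.mem_Ico, Finset.mem_range] at hk ⊢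
      exact hk.2
    · rw [Finset.sum_eq_zero]
      · exact hq.p_nonneg i a
      · intro k _
        have : P.pieceCount p q i (σ i a) k = 0 := by
          by_contra hcon
          have := (pieceCount_pos hq (Nat.pos_of_ne_zero hcon)).2.2
          rw [hσ] at this
          exact h3 this
        rw [this]; simp
  refine ⟨σ i, M, hσ i, fun j hj => ?_, fun a ha => (Finset.mem_filter.1 ha).2.1, ?_, ?_, ?_, ?_⟩
  · -- few misfits
    let S : Finset ℕ := (Finset.range P.n).filter fun a => P.cls (p i a) = j
    let rank : ℕ → ℕ := fun a => Nat.count (fun b => P.cls (p i b) = j) a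
    have hSc : S.card = Nat.count (fun b => P.cls (p i b) = j) P.n := by
      rw [Nat.count_eq_card_filter_range]
    have hval : ∀ (F : Finset (Fin P.n)),
        (F.map ⟨Fin.val, Fin.val_injective⟩).card = F.card := fun F => Finset.card_map _
    have hS : (Finset.univ.filter fun a : Fin P.n => P.cls (p i a) = j).map
        ⟨Fin.val, Fin.val_injective⟩ = S := by
      ext a
      simp only [S, Finset.mem_map, Finset.mem_filter, Finset.mem_univ, true_and,
        Function.Embedding.coeFn_mk, Finset.mem_range]
      constructor
      · rintro ⟨b, hb, rfl⟩
        exact ⟨b.2, hb⟩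
      · rintro ⟨h, h'⟩
        exact ⟨⟨a, h⟩, h', rfl⟩
    have hrankj : ∀ a : Fin P.n, P.cls (p i a) = j → P.group (p i) a = rank a % P.D := by
      intro a ha
      simp only [group, rank, ha]
    rw [← hval, ← hval (Finset.univ.filter fun a : Fin P.n => P.cls (p i a) = j), hS]
    refine card_mixed_le (N := P.patterns) S rank ?_ ?_ _ ?_ ?_ ?_
    · intro a ha
      rw [hSc]
      exact Nat.count_strict_mono (Finset.mem_filter.1 ha).2
        (Finset.mem_range.1 (Finset.mem_filter.1 ha).1)
    · intro a ha b hb hab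
      exact Nat.count_injective (Finset.mem_filter.1 ha).2 (Finset.mem_filter.1 hb).2 hab
    · rw [← hS]
      refine Finset.map_subset_map.2 fun a ha => ?_
      exact Finset.mem_filter.2 ⟨Finset.mem_univ _, (Finset.mem_filter.1 ha).2⟩
    · intro a ha
      obtain ⟨b, hb, rfl⟩ := Finset.mem_map.1 ha
      obtain ⟨hb1, hb2⟩ := Finset.mem_filter.1 hb
      have hb3 := (Finset.mem_filter.1 hb1).2.2
      have : ∃ a' : Fin P.n, P.cls (p i a') = j ∧ P.group (p i) a' = P.group (p i) b ∧
          pat i (σ i a') ≠ pat i (σ i b) := by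
        by_contra hcon
        push Not at hcon
        exact hb3 ⟨pat i (σ i b), fun a' h h' => hcon a' (h.trans hb2) h'⟩
      obtain ⟨a', h2, h3, h4⟩ := this
      refine ⟨a', ?_, b, ?_, ?_, ?_, rfl⟩
      · rw [← hS]; exact Finset.mem_map.2 ⟨a', by simp [h2], rfl⟩
      · rw [← hS]; exact Finset.mem_map.2 ⟨b, by simp [hb2], rfl⟩
      · intro h
        exact h4 (by rw [Fin.ext h])
      · rw [← hrankj a' h2, h3, hrankj b hb2]
        rfl
    · refine hmix i j _ fun r hr => ?_
      obtain ⟨a, ha, rfl⟩ := Finset.mem_image.1 hr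
      obtain ⟨b, hb, rfl⟩ := Finset.mem_map.1 ha
      obtain ⟨hb1, hb2⟩ := Finset.mem_filter.1 hb
      have hb3 := (Finset.mem_filter.1 hb1).2.2
      have : ∃ a' : Fin P.n, P.cls (p i a') = j ∧ P.group (p i) a' = P.group (p i) b ∧
          pat i (σ i a') ≠ pat i (σ i b) := by
        by_contra hcon
        push Not at hcon
        exact hb3 ⟨pat i (σ i b), fun a' h h' => hcon a' (h.trans hb2) h'⟩
      obtain ⟨a', h2, h3, h4⟩ := this
      have h5 : P.group (p i) b = rank b % P.D := hrankj b hb2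
      rcases lt_or_gt_of_ne (fun h => h4 (e.injective h) : e (pat i (σ i a')) ≠ e (pat i (σ i b)))
        with h | h
      · exact ⟨a', b, h2, hb2, h3.trans h5, h5, h⟩
      · exact ⟨b, a', hb2, h2, h5, h3.trans h5, h⟩
  · intro a ha
    rw [ent, hblkM a ha, (hM a ha).2, if_neg (by omega)]
  · intro a ha
    rw [ent, hblk a ha, (hnM a ha).2, if_pos le_rfl]
  · intro a ha k
    rw [pc, hblkM a ha]
    split_ifs with h2 h3
    · exact (hM a ha).1 _ (by omega)
    · rfl
    · rfl
  · intro a ha k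
    rw [pc, hblk a ha]
    split_ifs with h2 h3
    · rw [(hnM a ha).1 _ (by omega), Nat.add_sub_cancel' h2]
    · exact (hpc0 a k fun h => h3 h.2).symm
    · exact (hpc0 a k fun h => h2 h.1).symm

end

end Par

/-! ### The target line built from a coupling. -/

namespace Par
variable {P : Par} {p : ℕ → ℕ → ℝ} {q : (Fin P.m → Fin P.n) → ℝ}

/-- The states of `q` that are cut as a piece in at least one marginal. -/
noncomputable def bigStates (P : Par) (p : ℕ → ℕ → ℝ) (q : (Fin P.m → Fin P.n) → ℝ) :
    Finset (Fin P.m → Fin P.n) := by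
  classical
  exact Finset.univ.filter fun x => P.cls (q x) < P.K ∧
    ∃ i : Fin P.m, P.cls (q x) + 1 < P.cls (p i (x i)) + P.U

/-- The states of `q`, other than the tiny ones, that are taken from the pool in every marginal. -/
noncomputable def smallStates (P : Par) (p : ℕ → ℕ → ℝ) (q : (Fin P.m → Fin P.n) → ℝ) :
    Finset (Fin P.m → Fin P.n) := by
  classical
  exact Finset.univ.filter fun x => P.cls (q x) < P.K ∧
    ¬ ∃ i : Fin P.m, P.cls (q x) + 1 < P.cls (p i (x i)) + P.U

/-- The mass of the tiny states of `q`. -/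
noncomputable def tinyMass (P : Par) (q : (Fin P.m → Fin P.n) → ℝ) : ℝ :=
  ∑ x with ¬ P.cls (q x) < P.K, q x

/-- The number of pieces of class `k` that the big states make. -/
noncomputable def bigCount (P : Par) (p : ℕ → ℕ → ℝ) (q : (Fin P.m → Fin P.n) → ℝ) (k : ℕ) : ℕ :=
  ((P.bigStates p q).filter fun x => P.cls (q x) + 1 = k).card

theorem mem_bigStates {x : Fin P.m → Fin P.n} : x ∈ P.bigStates p q ↔ P.cls (q x) < P.K ∧
    ∃ i : Fin P.m, P.cls (q x) + 1 < P.cls (p i (x i)) + P.U := by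
  simp [bigStates]

theorem mem_smallStates {x : Fin P.m → Fin P.n} : x ∈ P.smallStates p q ↔ P.cls (q x) < P.K ∧
    ¬ ∃ i : Fin P.m, P.cls (q x) + 1 < P.cls (p i (x i)) + P.U := by
  simp [smallStates]

/-- The pieces of class `k` of the second part of the target line. -/
noncomputable def tail (P : Par) (p : ℕ → ℕ → ℝ) (q : (Fin P.m → Fin P.n) → ℝ) (adv : ℕ → ℕ)
    (k : ℕ) : List (ℝ × ℕ) :=
  ((P.smallStates p q).filter fun x => P.cls (q x) + 1 = k).toList.map (fun x => (q x, k)) ++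
  ((P.bigStates p q).filter fun x => P.cls (q x) + 1 + P.U = k).toList.map
    (fun x => (q x - P.ρ ^ (P.cls (q x) + 1), k)) ++
  List.replicate (P.bigCount p q k - P.nk adv p k) (P.ρ ^ k, k)

/-- The second part of the target line. -/
noncomputable def tails (P : Par) (p : ℕ → ℕ → ℝ) (q : (Fin P.m → Fin P.n) → ℝ) (adv : ℕ → ℕ) :
    List (ℝ × ℕ) := (List.range P.Q).flatMap (P.tail p q adv) ++ [(P.tinyMass q, P.Q)]

theorem tail_snd {adv : ℕ → ℕ} {k : ℕ} {b : ℝ × ℕ} (hb : b ∈ P.tail p q adv k) : b.2 = k := by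
  simp only [tail, List.mem_append, List.mem_map] at hb
  rcases hb with (⟨x, _, rfl⟩ | ⟨x, _, rfl⟩) | hb
  · rfl
  · rfl
  · rw [(List.mem_replicate.1 hb).2]

theorem sum_tail (f : ℝ → ℝ) (adv : ℕ → ℕ) (k : ℕ) :
    ((P.tail p q adv k).map fun b => f b.1).sum =
      ∑ x ∈ P.smallStates p q with P.cls (q x) + 1 = k, f (q x) +
      ∑ x ∈ P.bigStates p q with P.cls (q x) + 1 + P.U = k, f (q x - P.ρ ^ (P.cls (q x) + 1)) +
      (P.bigCount p q k - P.nk adv p k : ℕ) * f (P.ρ ^ k) := by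
  simp only [tail, List.map_append, List.map_map, List.sum_append, List.map_replicate,
    List.sum_replicate, nsmul_eq_mul]
  congr 2
  · exact Finset.sum_map_toList _ _
  · exact Finset.sum_map_toList _ _

theorem sum_map_range (f : ℕ → ℝ) (n : ℕ) :
    ((List.range n).map f).sum = ∑ k ∈ Finset.range n, f k :=
  sum_map_of_nodup List.nodup_range (by simp) f

theorem sum_flatMap_range {α : Type*} (V : ℕ → List α) (f : α → ℝ) (n : ℕ) :
    (((List.range n).flatMap V).map f).sum = ∑ k ∈ Finset.range n, ((V k).map f).sum := by
  rw [← sum_map_range]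
  induction List.range n with
  | nil => simp
  | cons a l ih => simp [List.flatMap_cons, ih]

/-- The piece of all tiny states has class `Q`, beyond every class `k < Q`, and is never counted. -/
theorem massUpTo_tails (adv : ℕ → ℕ) {k : ℕ} (hk : k < P.Q) :
    LineData.massUpTo (P.tails p q adv) k =
      ∑ j ∈ Finset.range (k + 1), ((P.tail p q adv j).map Prod.fst).sum := by
  have h1 : LineData.massUpTo [(P.tinyMass q, P.Q)] k = 0 := by
    simp [LineData.massUpTo, hk]
  have h2 : ∀ N, LineData.massUpTo ((List.range N).flatMap (P.tail p q adv)) k =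
      ∑ j ∈ Finset.range N, if j ≤ k then ((P.tail p q adv j).map Prod.fst).sum else 0 := by
    intro N
    induction N with
    | zero => simp [LineData.massUpTo]
    | succ N ih =>
      rw [List.range_succ, List.flatMap_append, LineData.massUpTo_append, ih,
        Finset.sum_range_succ, List.flatMap_singleton]
      congr 1
      split_ifs with h
      · exact LineData.massUpTo_eq_sum fun b hb => by rw [tail_snd hb]; exact h
      · rw [LineData.massUpTo, List.filter_eq_nil_iff.2]
        · rfl
        · intro b hb
          simpa [tail_snd hb] using h
  rw [tails, LineData.massUpTo_append, h1, add_zero, h2, ← Finset.sum_filter]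
  refine Finset.sum_congr ?_ fun _ _ => rfl
  ext j
  simp only [Finset.mem_filter, Finset.mem_range]
  omega

theorem pairwise_tails (adv : ℕ → ℕ) :
    (P.tails p q adv).Pairwise fun b c => b.2 ≤ c.2 := by
  rw [tails, List.pairwise_append]
  refine ⟨?_, by simp, ?_⟩
  · rw [List.pairwise_flatMap]
    refine ⟨fun k _ => ?_, List.Pairwise.imp ?_ List.pairwise_lt_range⟩
    · refine List.Pairwise.imp_of_mem ?_ (List.pairwise_of_forall (R := fun _ _ => True)
        fun _ _ => trivial)
      intro a b ha hb _
      rw [tail_snd ha, tail_snd hb]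
    · intro j k hjk b hb c hc
      rw [tail_snd hb, tail_snd hc]
      exact hjk.le
  · intro b hb c hc
    rw [List.mem_singleton] at hc
    obtain ⟨k, hk, hb⟩ := List.mem_flatMap.1 hb
    rw [tail_snd hb, hc]
    exact (List.mem_range.1 hk).le

section
variable {adv : ℕ → ℕ}

theorem tails_nonneg (h0 : 0 < P.ρ) (h1 : P.ρ < 1) (hq : IsCouplingOf p q) :
    ∀ b ∈ P.tails p q adv, 0 ≤ b.1 := by
  intro b hb
  rcases List.mem_append.1 hb with hb | hb
  · obtain ⟨k, _, hb⟩ := List.mem_flatMap.1 hb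
    simp only [tail, List.mem_append, List.mem_map, Finset.mem_toList, Finset.mem_filter] at hb
    rcases hb with (⟨x, _, rfl⟩ | ⟨x, ⟨hx, _⟩, rfl⟩) | hb
    · exact hq.nonneg x
    · have h2 := pow_cls_le h0 h1 (mem_bigStates.1 hx).1
      have h3 : P.ρ ^ (P.cls (q x) + 1) ≤ P.ρ ^ P.cls (q x) :=
        pow_le_pow_of_le_one h0.le h1.le (Nat.le_succ _)
      change 0 ≤ q x - P.ρ ^ (P.cls (q x) + 1)
      linarith
    · rw [(List.mem_replicate.1 hb).2]
      exact pow_nonneg h0.le k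
  · rw [List.mem_singleton] at hb
    rw [hb]
    exact Finset.sum_nonneg fun x _ => hq.nonneg x

theorem sum_range_eq_sum_fin (f : ℕ → ℕ) (n : ℕ) :
    ∑ a ∈ Finset.range n, f a = ∑ a : Fin n, f a := Finset.sum_range _

/-- Up to the permutation of the states, which does not change the total, every piece cut in a
marginal comes from its own big state of `q`. -/
theorem pieces_le_bigCount {i : Fin P.m} {σ : Equiv.Perm (Fin P.n)} {M : Finset (Fin P.n)}
    (hg : GoodAdvice p q adv i σ M) (k : ℕ) : P.pieces adv i (p i) k ≤ P.bigCount p q k := by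
  classical
  calc P.pieces adv i (p i) k = ∑ a : Fin P.n, P.pc adv i (p i) a k := sum_range_eq_sum_fin _ _
    _ ≤ ∑ a : Fin P.n, P.pieceCount p q i (σ a) k := Finset.sum_le_sum fun a _ => by
        by_cases ha : a ∈ M
        · rw [hg.pc_mem a ha]; exact Nat.zero_le _
        · exact (hg.pc_notMem a ha k).le
    _ = ∑ a : Fin P.n, P.pieceCount p q i a k :=
        Equiv.sum_comp σ fun a => P.pieceCount p q i a k
    _ ≤ ∑ a : Fin P.n, (((P.bigStates p q).filter fun x => P.cls (q x) + 1 = k).filter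
          fun x => x i = a).card := Finset.sum_le_sum fun a _ => by
        refine Finset.card_le_card fun x hx => ?_
        obtain ⟨rfl, h1, h2, h3⟩ := (Finset.mem_filter.1 hx).2
        simp only [Finset.mem_filter, mem_bigStates]
        exact ⟨⟨⟨h1, i, by omega⟩, h2⟩, trivial⟩
    _ = P.bigCount p q k := by
        rw [bigCount]
        exact (Finset.card_eq_sum_card_fiberwise fun x _ => Finset.mem_coe.2 (Finset.mem_univ _)).symm

/-- The number of pieces on the line is what the advice reveals; the pieces of big states beyond it,
which no marginal shows, can be moved to the tail. -/
theorem nk_le_bigCount (hg : ∀ i, ∃ σ M, GoodAdvice p q adv i σ M) (k : ℕ) :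
    P.nk adv p k ≤ P.bigCount p q k :=
  Finset.sup_le fun i hi => by
    obtain ⟨σ, M, h⟩ := hg ⟨i, Finset.mem_range.1 hi⟩
    exact pieces_le_bigCount h k

theorem pieces_le_nk (i : Fin P.m) (k : ℕ) : P.pieces adv i (p i) k ≤ P.nk adv p k :=
  Finset.le_sup (f := fun i => P.pieces adv i (p i) k) (Finset.mem_range.2 i.2)

theorem bigCount_mul (f : ℝ → ℝ) (k : ℕ) : (P.bigCount p q k : ℝ) * f (P.ρ ^ k) =
    ∑ x ∈ P.bigStates p q with P.cls (q x) + 1 = k, f (P.ρ ^ (P.cls (q x) + 1)) := by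
  rw [bigCount, ← nsmul_eq_mul, ← Finset.sum_const]
  exact Finset.sum_congr rfl fun x hx => by rw [(Finset.mem_filter.1 hx).2]

/-- Sums over the target line. -/
theorem sum_target (hg : ∀ i, ∃ σ M, GoodAdvice p q adv i σ M) (f : ℝ → ℝ) (i : ℕ) :
    (((P.line adv p i).target (P.tails p q adv)).map f).sum =
      ∑ x ∈ P.smallStates p q, f (q x) + ∑ x ∈ P.bigStates p q,
        (f (P.ρ ^ (P.cls (q x) + 1)) + f (q x - P.ρ ^ (P.cls (q x) + 1))) + f (P.tinyMass q) := by
  have hd : (P.line adv p i).target (P.tails p q adv) =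
      (List.range P.Q).flatMap (fun k => List.replicate (P.nk adv p k) (P.ρ ^ k)) ++
        (P.tails p q adv).map Prod.fst := rfl
  have hcl : ∀ x, x ∈ P.smallStates p q → P.cls (q x) + 1 ∈ Finset.range P.Q := by
    intro x hx
    have := (mem_smallStates.1 hx).1
    simp only [Finset.mem_range, Q]; omega
  have hcl1 : ∀ x, x ∈ P.bigStates p q → P.cls (q x) + 1 ∈ Finset.range P.Q := by
    intro x hx
    have := (mem_bigStates.1 hx).1
    simp only [Finset.mem_range, Q]; omega
  have hcl2 : ∀ x, x ∈ P.bigStates p q → P.cls (q x) + 1 + P.U ∈ Finset.range P.Q := by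
    intro x hx
    have := (mem_bigStates.1 hx).1
    simp only [Finset.mem_range, Q]; omega
  rw [hd, List.map_append, List.sum_append, sum_flatMap_range, tails, List.map_append,
    List.map_append, List.sum_append, List.map_map, sum_flatMap_range]
  have e : ∀ k, ((P.tail p q adv k).map (f ∘ Prod.fst)).sum =
    ((P.tail p q adv k).map fun b => f b.1).sum := fun k => rfl
  simp only [e, sum_tail, List.map_replicate, List.sum_replicate, nsmul_eq_mul, List.map_singleton,
    List.sum_singleton]
  rw [Finset.sum_add_distrib, Finset.sum_add_distrib, Finset.sum_fiberwise_of_maps_to hcl,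
    Finset.sum_fiberwise_of_maps_to hcl2, Finset.sum_add_distrib]
  have h1 : ∑ k ∈ Finset.range P.Q, (P.nk adv p k : ℝ) * f (P.ρ ^ k) +
      ∑ k ∈ Finset.range P.Q, ((P.bigCount p q k - P.nk adv p k : ℕ) : ℝ) * f (P.ρ ^ k) =
      ∑ x ∈ P.bigStates p q, f (P.ρ ^ (P.cls (q x) + 1)) := by
    rw [← Finset.sum_add_distrib, ← Finset.sum_fiberwise_of_maps_to hcl1]
    refine Finset.sum_congr rfl fun k _ => ?_
    rw [Nat.cast_sub (nk_le_bigCount hg k), ← bigCount_mul]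
    ring
  linarith

theorem sum_states (hq : IsCouplingOf p q) :
    ∑ x ∈ P.smallStates p q, q x + ∑ x ∈ P.bigStates p q, q x + P.tinyMass q = 1 := by
  classical
  rw [← hq.sum_eq, ← Finset.sum_filter_add_sum_filter_not Finset.univ
    (fun x => P.cls (q x) < P.K) q, tinyMass]
  congr 1
  rw [← Finset.sum_filter_add_sum_filter_not (Finset.univ.filter fun x => P.cls (q x) < P.K)
    (fun x => ∃ i : Fin P.m, P.cls (q x) + 1 < P.cls (p i (x i)) + P.U) q, Finset.filter_filter,
    Finset.filter_filter, add_comm]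
  congr 1

theorem sum_rem (hadv : ∀ b, P.len ≤ b → adv b = 0) (hq : IsCouplingOf p q) (i : Fin P.m) :
    ∑ a ∈ Finset.range P.n, P.rem adv i (p i) a +
      ∑ k ∈ Finset.range P.Q, (P.pieces adv i (p i) k : ℝ) * P.ρ ^ k = 1 := by
  have h : ∑ k ∈ Finset.range P.Q, (P.pieces adv i (p i) k : ℝ) * P.ρ ^ k =
      ∑ a ∈ Finset.range P.n, ∑ k ∈ Finset.range P.Q, (P.pc adv i (p i) a k : ℝ) * P.ρ ^ k := by
    rw [Finset.sum_comm]
    refine Finset.sum_congr rfl fun k _ => ?_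
    rw [pieces, Nat.cast_sum, Finset.sum_mul]
  rw [h, ← Finset.sum_add_distrib, Finset.sum_congr rfl fun a _ => rem_add_sum_pc hadv i (p i) a,
    Finset.sum_range, hq.sum_p]

/-- The pool is never exhausted. -/
theorem heights (h0 : 0 < P.ρ) (h1 : P.ρ < 1) (hadv : ∀ b, P.len ≤ b → adv b = 0)
    (hq : IsCouplingOf p q) {i : Fin P.m} {σ : Equiv.Perm (Fin P.n)} {M : Finset (Fin P.n)}
    (hg : GoodAdvice p q adv i σ M) {k : ℕ} (hk : k < P.Q) :
    ∑ x ∈ P.smallStates p q with P.cls (q x) + 1 < k + 1, q x +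
      ∑ x ∈ P.bigStates p q with P.cls (q x) + 1 + P.U < k + 1, (q x - P.ρ ^ (P.cls (q x) + 1)) +
      ∑ x ∈ P.bigStates p q with P.cls (q x) + 1 < k + 1, P.ρ ^ (P.cls (q x) + 1) ≤
    ∑ a ∈ (Finset.range P.n).filter (fun a => P.ent adv i (p i) a ≤ k), P.rem adv i (p i) a +
      ∑ j ∈ Finset.range (k + 1), (P.pieces adv i (p i) j : ℝ) * P.ρ ^ j := by
  classical
  set G : Fin P.n → ℝ := fun a =>
    ∑ j ∈ Finset.range (k + 1), (P.pieceCount p q i a j : ℝ) * P.ρ ^ j with hG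
  -- The demand is sorted by the label `a = x i`. If `cls (p i a) + U ≤ k`, it is at most the whole
  -- mass of `a`. Otherwise a small state of that class would be cut from `a`, and the leftover of a
  -- big state has class above `cls (p i a) + U`, so only pieces cut from `a` itself are due.
  have left : ∑ x ∈ P.smallStates p q with P.cls (q x) + 1 < k + 1, q x +
      ∑ x ∈ P.bigStates p q with P.cls (q x) + 1 + P.U < k + 1, (q x - P.ρ ^ (P.cls (q x) + 1)) +
      ∑ x ∈ P.bigStates p q with P.cls (q x) + 1 < k + 1, P.ρ ^ (P.cls (q x) + 1) ≤
      ∑ a : Fin P.n, if P.cls (p i a) + P.U ≤ k then p i a else G a := by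
    simp only [smallStates, bigStates, Finset.filter_filter, Finset.sum_filter]
    rw [← Finset.sum_add_distrib, ← Finset.sum_add_distrib, ← sum_sum_filter i]
    refine Finset.sum_le_sum fun a _ => ?_
    split_ifs with hc
    · rw [← hq.marginal i a]
      refine Finset.sum_le_sum fun x _ => ?_
      by_cases h2 : P.cls (q x) < P.K
      · have h3 := pow_cls_le h0 h1 h2
        have h4 : P.ρ ^ (P.cls (q x) + 1) ≤ P.ρ ^ P.cls (q x) :=
          pow_le_pow_of_le_one h0.le h1.le (Nat.le_succ _)
        have h5 : 0 ≤ P.ρ ^ (P.cls (q x) + 1) := pow_nonneg h0.le _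
        by_cases h6 : ∃ i : Fin P.m, P.cls (q x) + 1 < P.cls (p i (x i)) + P.U
        · simp only [h2, h6, true_and, not_true, false_and, if_false, zero_add]
          split_ifs <;> linarith
        · simp only [h2, h6, true_and, not_false_iff, false_and, if_false, add_zero]
          split_ifs <;> linarith
      · simp only [h2, false_and, if_false, add_zero]
        exact hq.nonneg x
    · simp only [hG]
      rw [sum_pieceCount]
      refine Finset.sum_le_sum fun x hx => ?_
      have hxa := (Finset.mem_filter.1 hx).2
      have hle := hq.cls_le_cls i x
      rw [hxa] at hle
      by_cases h2 : P.cls (q x) < P.K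
      · by_cases h6 : ∃ i : Fin P.m, P.cls (q x) + 1 < P.cls (p i (x i)) + P.U
        · simp only [h2, h6, true_and, not_true, false_and, if_false, zero_add]
          rw [if_neg (by omega), zero_add]
          by_cases h7 : P.cls (q x) + 1 < k + 1
          · rw [if_pos h7, if_pos ⟨h7, by omega⟩]
          · rw [if_neg h7, if_neg fun h => h7 h.1]
        · have h7 : ¬ P.cls (q x) + 1 < P.cls (p i (x i)) + P.U := fun h => h6 ⟨i, h⟩
          rw [hxa] at h7
          simp only [h2, h6, true_and, not_false_iff, false_and, if_false, add_zero]
          rw [if_neg (by omega), if_neg fun h => h7 h.2]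
      · simp [h2]
  -- The supply of `a`, compared with the pattern of `σ a`. A fit state supplies that pattern, and
  -- everything once `k` reaches its entry class. A misfit supplies its whole mass from its own
  -- class on, which dominates the pieces of `σ a` because of the slack `ρ`; before that class no
  -- such pieces are due.
  have right : ∀ a : Fin P.n, (if P.cls (p i a) + P.U ≤ k then p i a else G (σ a)) ≤
      (if P.ent adv i (p i) a ≤ k then P.rem adv i (p i) a else 0) +
        ∑ j ∈ Finset.range (k + 1), (P.pc adv i (p i) a j : ℝ) * P.ρ ^ j := by
    intro a
    have hsum := rem_add_sum_pc hadv i (p i) a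
    by_cases ha : a ∈ M
    · have hz : ∀ N, ∑ j ∈ Finset.range N, (P.pc adv i (p i) a j : ℝ) * P.ρ ^ j = 0 := fun N =>
        Finset.sum_eq_zero fun j _ => by rw [hg.pc_mem a ha]; simp
      rw [hz, add_zero] at hsum
      rw [hz, hg.ent_mem a ha, hsum, add_zero]
      split_ifs with h2 h3 h3
      · exact le_rfl
      · omega
      · have h4 := sum_pieceCount_le h0 h1 hq i (σ a) (k + 1)
        have h5 := mul_lt_pow_cls h0 h1 (hq.p_le_one i (σ a))
        rw [hg.cls_perm] at h5
        exact h4.trans (h5.le.trans (pow_cls_le h0 h1 (hg.cls_lt a ha)))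
      · refine (Finset.sum_eq_zero fun j hj => ?_).le
        have : P.pieceCount p q i (σ a) j = 0 := by
          by_contra hcon
          have := (pieceCount_pos hq (Nat.pos_of_ne_zero hcon)).1
          rw [hg.cls_perm] at this
          rw [Finset.mem_range] at hj
          omega
        rw [this]; simp
    · rw [hg.ent_notMem a ha]
      split_ifs with h2
      · have h3 : ∑ j ∈ Finset.range (k + 1), (P.pc adv i (p i) a j : ℝ) * P.ρ ^ j =
            ∑ j ∈ Finset.range P.Q, (P.pc adv i (p i) a j : ℝ) * P.ρ ^ j := by
          refine Finset.sum_subset (Finset.range_subset_range.2 hk) fun j _ hj => ?_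
          have : P.pc adv i (p i) a j = 0 := by
            rw [hg.pc_notMem a ha]
            by_contra hcon
            have := (pieceCount_pos hq (Nat.pos_of_ne_zero hcon)).2.1
            rw [hg.cls_perm] at this
            rw [Finset.mem_range] at hj
            omega
          rw [this]; simp
        rw [h3, hsum]
      · rw [zero_add]
        exact Finset.sum_le_sum fun j _ => by rw [hg.pc_notMem a ha]
  -- Whether the first case applies depends only on the class, which `σ` preserves; so the second
  -- case may be permuted.
  have perm : ∑ a : Fin P.n, (if P.cls (p i a) + P.U ≤ k then p i a else G a) =
      ∑ a : Fin P.n, if P.cls (p i a) + P.U ≤ k then p i a else G (σ a) := by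
    have e : ∀ f : Fin P.n → ℝ, ∑ a : Fin P.n, (if P.cls (p i a) + P.U ≤ k then p i a else f a) =
        ∑ a : Fin P.n, (if P.cls (p i a) + P.U ≤ k then p i a else 0) +
        ∑ a : Fin P.n, if P.cls (p i a) + P.U ≤ k then 0 else f a := by
      intro f
      rw [← Finset.sum_add_distrib]
      exact Finset.sum_congr rfl fun a _ => by split_ifs <;> simp
    rw [e, e fun a => G (σ a), ← Equiv.sum_comp σ fun a => if P.cls (p i a) + P.U ≤ k then 0 else G a]
    simp only [hg.cls_perm]
  refine left.trans (perm.le.trans ((Finset.sum_le_sum fun a _ => right a).trans (le_of_eq ?_)))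
  rw [Finset.sum_add_distrib, Finset.sum_filter, Finset.sum_range]
  congr 1
  rw [Finset.sum_comm]
  refine Finset.sum_congr rfl fun j _ => ?_
  rw [pieces, Nat.cast_sum, Finset.sum_mul, Finset.sum_range]

end

end Par

/-! ### The entropy of the coupling of a good advice. -/

namespace Par
variable {P : Par} {p : ℕ → ℕ → ℝ} {q : (Fin P.m → Fin P.n) → ℝ} {adv : ℕ → ℕ}

/-- In each class `j` the misfits are at most a share `2 * patterns / D` of the states, and every
state there has mass at least `ρ ^ j`; the masses sum to at most 1. -/
theorem sum_misfits_le (h0 : 0 < P.ρ) (h1 : P.ρ < 1) (hD : 0 < P.D)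
    (hq : IsCouplingOf p q) {i : Fin P.m} {σ : Equiv.Perm (Fin P.n)} {M : Finset (Fin P.n)}
    (hg : GoodAdvice p q adv i σ M) :
    ∑ a ∈ M, P.ρ ^ P.cls (p i a) ≤ 2 * P.patterns / P.D := by
  classical
  have hM : ∀ a ∈ M, P.cls (p i a) ∈ Finset.range P.K := fun a ha =>
    Finset.mem_range.2 (hg.cls_lt a ha)
  have hDR : (0 : ℝ) < P.D := by exact_mod_cast hD
  rw [← Finset.sum_fiberwise_of_maps_to hM]
  have h2 : ∀ j ∈ Finset.range P.K, ∑ a ∈ M.filter (fun a : Fin P.n => P.cls (p i a) = j), P.ρ ^ P.cls (p i a) ≤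
      2 * P.patterns / P.D * ∑ a ∈ Finset.univ.filter (fun a : Fin P.n => P.cls (p i a) = j), p i a := by
    intro j hj
    have hjK := Finset.mem_range.1 hj
    have h3 : ((M.filter fun a : Fin P.n => P.cls (p i a) = j).card : ℝ) * P.D ≤
      2 * P.patterns * (Finset.univ.filter fun a : Fin P.n => P.cls (p i a) = j).card := by
      exact_mod_cast hg.card_le j hjK
    have h4 : ∑ a ∈ M.filter (fun a : Fin P.n => P.cls (p i a) = j), P.ρ ^ P.cls (p i a) =
        (M.filter fun a : Fin P.n => P.cls (p i a) = j).card * P.ρ ^ j := by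
      rw [← nsmul_eq_mul, ← Finset.sum_const]
      exact Finset.sum_congr rfl fun a ha => by rw [(Finset.mem_filter.1 ha).2]
    have h5 : ((Finset.univ.filter fun a : Fin P.n => P.cls (p i a) = j).card : ℝ) * P.ρ ^ j ≤
        ∑ a ∈ Finset.univ.filter (fun a : Fin P.n => P.cls (p i a) = j), p i a := by
      rw [← nsmul_eq_mul, ← Finset.sum_const]
      refine Finset.sum_le_sum fun a ha => ?_
      have h6 := (Finset.mem_filter.1 ha).2
      rw [← h6]
      exact pow_cls_le h0 h1 (h6 ▸ hjK)
    have h7 : 0 < P.ρ ^ j := pow_pos h0 j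
    rw [h4, div_mul_eq_mul_div, le_div_iff₀ hDR]
    calc _ = ((M.filter fun a : Fin P.n => P.cls (p i a) = j).card : ℝ) * P.D * P.ρ ^ j := by ring
      _ ≤ 2 * P.patterns * (Finset.univ.filter fun a : Fin P.n => P.cls (p i a) = j).card *
          P.ρ ^ j := by gcongr
      _ = 2 * P.patterns * ((Finset.univ.filter fun a : Fin P.n => P.cls (p i a) = j).card *
          P.ρ ^ j) := by ring
      _ ≤ _ := by gcongr
  refine (Finset.sum_le_sum h2).trans ?_
  rw [← Finset.mul_sum]
  have h3 : ∑ j ∈ Finset.range P.K, ∑ a ∈ Finset.univ.filter (fun a : Fin P.n => P.cls (p i a) = j), p i a ≤ 1 := by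
    rw [← hq.sum_p i, ← Finset.sum_fiberwise_of_maps_to (s := Finset.univ)
      (t := Finset.range (P.K + 1)) (g := fun a : Fin P.n => P.cls (p i a)) fun a _ =>
      Finset.mem_range.2 (Nat.lt_succ_of_le (cls_le _))]
    refine Finset.sum_le_sum_of_subset_of_nonneg (Finset.range_subset_range.2 (Nat.le_succ _))
      fun j _ _ => Finset.sum_nonneg fun a _ => hq.p_nonneg i a
  exact mul_le_of_le_one_right (by positivity) h3

/-- A state whose class is below `K` has mass at least `ρ ^ cls`. In class `K` the mass may vanish,
which costs the term `n * ρ ^ K`. -/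
theorem sum_pow_cls_le (h0 : 0 < P.ρ) (h1 : P.ρ < 1) (hq : IsCouplingOf p q) (i : Fin P.m) :
    ∑ a : Fin P.n, P.ρ ^ P.cls (p i a) ≤ 1 + P.n * P.ρ ^ P.K := by
  have h2 : ∀ a : Fin P.n, P.ρ ^ P.cls (p i a) ≤ p i a + P.ρ ^ P.K := by
    intro a
    have h3 := pow_pos h0 P.K
    rcases (cls_le (P := P) (p i a)).lt_or_eq with h | h
    · linarith [pow_cls_le h0 h1 h]
    · rw [h]; linarith [hq.p_nonneg i a]
  refine (Finset.sum_le_sum fun a _ => h2 a).trans (le_of_eq ?_)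
  rw [Finset.sum_add_distrib, hq.sum_p]
  simp

/-- A fit state enters `U` classes late and gains the factor `ρ ^ U`; a misfit pays in full, but
misfits are rare. -/
theorem sum_pow_ent_le (h0 : 0 < P.ρ) (h1 : P.ρ < 1) (hD : 0 < P.D)
    (hq : IsCouplingOf p q) {i : Fin P.m} {σ : Equiv.Perm (Fin P.n)} {M : Finset (Fin P.n)}
    (hg : GoodAdvice p q adv i σ M) :
    ∑ a ∈ Finset.range P.n, P.ρ ^ P.ent adv i (p i) a ≤
      P.ρ ^ P.U * (1 + P.n * P.ρ ^ P.K) + 2 * P.patterns / P.D := by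
  classical
  have h2 : ∀ a : Fin P.n, P.ρ ^ P.ent adv i (p i) a ≤
      P.ρ ^ P.U * P.ρ ^ P.cls (p i a) + if a ∈ M then P.ρ ^ P.cls (p i a) else 0 := by
    intro a
    by_cases ha : a ∈ M
    · rw [hg.ent_mem a ha, if_pos ha]
      have : 0 ≤ P.ρ ^ P.U * P.ρ ^ P.cls (p i a) := by positivity
      linarith
    · rw [hg.ent_notMem a ha, if_neg ha, add_zero, pow_add, mul_comm]
  rw [Finset.sum_range]
  refine (Finset.sum_le_sum fun a _ => h2 a).trans ?_
  rw [Finset.sum_add_distrib, ← Finset.mul_sum, ← Finset.sum_filter, Finset.filter_mem_eq_inter,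
    Finset.univ_inter]
  exact add_le_add (mul_le_mul_of_nonneg_left (sum_pow_cls_le h0 h1 hq i) (by positivity))
    (sum_misfits_le h0 h1 hD hq hg)

theorem tinyMass_nonneg (hq : IsCouplingOf p q) : 0 ≤ P.tinyMass q :=
  Finset.sum_nonneg fun x _ => hq.nonneg x

/-- There are at most `n ^ m` states, and a tiny one is below `ρ ^ (K - 1)`. -/
theorem tinyMass_le (h0 : 0 < P.ρ) (h1 : P.ρ < 1) (hK : 0 < P.K) :
    P.tinyMass q ≤ (P.n : ℝ) ^ P.m * P.ρ ^ (P.K - 1) := by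
  have h2 : ∀ x ∈ Finset.univ.filter fun x => ¬ P.cls (q x) < P.K, q x ≤ P.ρ ^ (P.K - 1) := by
    intro x hx
    have h3 := (Finset.mem_filter.1 hx).2
    exact ((lt_cls_iff h0 h1 (by omega)).2 (by omega)).le
  refine (Finset.sum_le_card_nsmul _ _ _ h2).trans ?_
  rw [nsmul_eq_mul]
  gcongr
  have : (Finset.univ.filter fun x => ¬ P.cls (q x) < P.K).card ≤ P.n ^ P.m := by
    refine (Finset.card_le_univ _).trans ?_
    simp
  exact_mod_cast this

/-- Since `ρ ≥ 1 / 2`, a state is at most 4 times the size of its piece. A leftover is filed `U`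
classes after its piece, when all labels that can need it are in the pool; it is small by the factor
`1 - ρ`, which is divided by `ρ ^ U` for the shift. The tiny states form one piece that may meet any
label. -/
theorem tails_le (h0 : 1 / 2 ≤ P.ρ) (h1 : P.ρ < 1) (hq : IsCouplingOf p q) (i : Fin P.m) :
    ∀ b ∈ P.tails p q adv, ∀ a < P.n, P.ent adv i (p i) a ≤ b.2 →
      b.1 ≤ (4 + 8 * (1 - P.ρ) / P.ρ ^ P.U) * P.ρ ^ P.ent adv i (p i) a + P.tinyMass q := by
  intro b hb a _ hle
  have h00 : 0 < P.ρ := by linarith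
  have ht := tinyMass_nonneg hq
  have hU : 0 < P.ρ ^ P.U := pow_pos h00 _
  have hpos : 0 < P.ρ ^ P.ent adv i (p i) a := pow_pos h00 _
  have h8 : 0 ≤ 8 * (1 - P.ρ) / P.ρ ^ P.U := div_nonneg (by linarith) hU.le
  have hmono : ∀ {j k : ℕ}, j ≤ k → P.ρ ^ k ≤ P.ρ ^ j :=
    fun h => pow_le_pow_of_le_one h00.le h1.le h
  have hq4 : ∀ x, q x ≤ 4 * P.ρ ^ (P.cls (q x) + 1) := by
    intro x
    have := mul_lt_pow_cls h00 h1 (hq.le_one x)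
    have h9 := hq.nonneg x
    rw [pow_succ']
    have h10 : 1 / 4 ≤ P.ρ * P.ρ := by nlinarith
    have h11 := mul_le_mul_of_nonneg_right h10 h9
    have h12 := mul_le_mul_of_nonneg_left this.le h00.le
    linarith
  rcases List.mem_append.1 hb with hb | hb
  · obtain ⟨k, _, hb⟩ := List.mem_flatMap.1 hb
    rw [tail_snd hb] at hle
    have hk := hmono hle
    simp only [tail, List.mem_append, List.mem_map, Finset.mem_toList, Finset.mem_filter] at hb
    rcases hb with (⟨x, ⟨_, rfl⟩, rfl⟩ | ⟨x, ⟨hx, rfl⟩, rfl⟩) | hb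
    · have := hq4 x
      dsimp only
      nlinarith
    · have h2 := hq4 x
      have h3 := mul_lt_pow_cls h00 h1 (hq.le_one x)
      have h4 : P.ρ * (P.ρ * q x) ≤ P.ρ ^ (P.cls (q x) + 1) := by
        rw [pow_succ']; gcongr
      have h5 := hq.nonneg x
      -- The piece is at least `ρ ^ 2 * q x`, so the leftover is at most `(1 - ρ) (1 + ρ) q x`, and
      -- `q x` is at most 4 times the piece.
      have h6 : q x - P.ρ ^ (P.cls (q x) + 1) ≤ 8 * (1 - P.ρ) * P.ρ ^ (P.cls (q x) + 1) := by
        have : q x - P.ρ * (P.ρ * q x) ≤ 2 * (1 - P.ρ) * q x := by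
          linarith [mul_nonneg (sq_nonneg (1 - P.ρ)) h5]
        have : 2 * (1 - P.ρ) * q x ≤ 2 * (1 - P.ρ) * (4 * P.ρ ^ (P.cls (q x) + 1)) :=
          mul_le_mul_of_nonneg_left h2 (by linarith)
        linarith
      have h7 : 8 * (1 - P.ρ) * P.ρ ^ (P.cls (q x) + 1) =
          8 * (1 - P.ρ) / P.ρ ^ P.U * P.ρ ^ (P.cls (q x) + 1 + P.U) := by
        rw [pow_add _ _ P.U]; field_simp
      have h9 : 8 * (1 - P.ρ) / P.ρ ^ P.U * P.ρ ^ (P.cls (q x) + 1 + P.U) ≤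
          8 * (1 - P.ρ) / P.ρ ^ P.U * P.ρ ^ P.ent adv i (p i) a := by gcongr
      dsimp only
      linarith
    · rw [(List.mem_replicate.1 hb).2]
      dsimp only
      nlinarith
  · rw [List.mem_singleton] at hb
    rw [hb]
    dsimp only
    nlinarith [mul_nonneg h8 hpos.le]

/-- The coupling that is encoded by good advice has almost the entropy of `q`. -/
theorem entropy_coupling_le (h0 : 1 / 2 ≤ P.ρ) (h1 : P.ρ < 1) (hD : 0 < P.D)
    (hq : IsCouplingOf p q) (hp0 : ∀ i a, 0 ≤ p i a)
    (hadv : ∀ b, P.len ≤ b → adv b = 0)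
    (hg : ∀ i, ∃ σ M, GoodAdvice p q adv i σ M) {δ : ℝ}
    (hδ : ∀ x, P.ρ ^ 2 ≤ x → x ≤ P.ρ → eta x + eta (1 - x) ≤ δ) :
    entropy (P.coupling adv p) ≤ entropy q + δ + eta (P.tinyMass q) +
      P.m * ((5 + 8 * (1 - P.ρ) / P.ρ ^ P.U) *
        (P.ρ ^ P.U * (1 + P.n * P.ρ ^ P.K) + 2 * P.patterns / P.D) + P.n * P.tinyMass q) := by
  classical
  have h00 : 0 < P.ρ := by linarith
  have hs : ∀ i k, 0 ≤ (P.line adv p i).s k := fun i k => pow_nonneg h00.le k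
  have hanti : ∀ i, Antitone (P.line adv p i).s := fun i j k h =>
    pow_le_pow_of_le_one h00.le h1.le h
  have hr : ∀ i a, 0 ≤ (P.line adv p i).r a := fun i a => rem_nonneg (hp0 i) a
  have hV0 := tails_nonneg (adv := adv) h00 h1 hq
  have hU : 0 < P.ρ ^ P.U := pow_pos h00 _
  have hC : 0 ≤ 8 * (1 - P.ρ) / P.ρ ^ P.U := div_nonneg (by linarith) hU.le
  have ht := tinyMass_nonneg (P := P) hq
  have hneed : ∀ (i : Fin P.m) k, (P.line adv p i).need k =
      ((P.nk adv p k : ℝ) - P.pieces adv i (p i) k) * P.ρ ^ k := by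
    intro i k
    change ((P.nk adv p k - P.pieces adv i (p i) k : ℕ) : ℝ) * P.ρ ^ k = _
    rw [Nat.cast_sub (pieces_le_nk i k)]
  have hsum1 : ∀ i : ℕ, ((P.line adv p i).target (P.tails p q adv)).sum = 1 := by
    intro i
    have := sum_target hg (fun x => x) i
    simp only [List.map_id', add_sub_cancel] at this
    rw [this]
    exact sum_states hq
  have cross : ∀ i : Fin P.m, crossing P.n (labelAt 0 (P.line adv p i).frags) 0
      ((P.line adv p i).target (P.tails p q adv)) ≤ (5 + 8 * (1 - P.ρ) / P.ρ ^ P.U) *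
        (P.ρ ^ P.U * (1 + P.n * P.ρ ^ P.K) + 2 * P.patterns / P.D) + P.n * P.tinyMass q := by
    intro i
    obtain ⟨σ, M, hgi⟩ := hg i
    have h := (LineData.crossing_frags_le (d := P.line adv p i) (hs i) (hanti i) (hr i)
      (fun k => pieces_le_nk i k) (fun a _ => ent_lt adv i (p i) a) hV0 (pairwise_tails adv)
      (fun k hk => ?_) ?_
      (χ := fun a => (4 + 8 * (1 - P.ρ) / P.ρ ^ P.U) * P.ρ ^ P.ent adv i (p i) a + P.tinyMass q)
      (fun a => by positivity) (tails_le h0 h1 hq i)).2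
    · refine h.trans ?_
      change ∑ a ∈ Finset.range P.n, P.ρ ^ P.ent adv i (p i) a +
        ∑ a ∈ Finset.range P.n, _ ≤ _
      rw [Finset.sum_add_distrib, ← Finset.mul_sum, Finset.sum_const, Finset.card_range,
        nsmul_eq_mul, ← add_assoc]
      have h2 := sum_pow_ent_le h00 h1 hD hq hgi
      have h3 := mul_le_mul_of_nonneg_left h2 (show 0 ≤ 5 + 8 * (1 - P.ρ) / P.ρ ^ P.U by linarith)
      linarith
    · have hkQ : k < P.Q := hk
      have h2 := heights h00 h1 hadv hq hgi hkQ
      rw [massUpTo_tails adv hkQ]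
      simp only [hneed]
      have h3 : ∀ j, ((P.tail p q adv j).map Prod.fst).sum =
          ∑ x ∈ P.smallStates p q with P.cls (q x) + 1 = j, q x +
          ∑ x ∈ P.bigStates p q with P.cls (q x) + 1 + P.U = j, (q x - P.ρ ^ (P.cls (q x) + 1)) +
          ((P.bigCount p q j : ℝ) - P.nk adv p j) * P.ρ ^ j := by
        intro j
        have := sum_tail (p := p) (q := q) (fun x => x) adv j
        rw [Nat.cast_sub (nk_le_bigCount hg j)] at this
        exact this
      have h4 : ∀ (s : Finset (Fin P.m → Fin P.n)) (κ : (Fin P.m → Fin P.n) → ℕ)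
          (f : (Fin P.m → Fin P.n) → ℝ),
          ∑ j ∈ Finset.range (k + 1), ∑ x ∈ s with κ x = j, f x = ∑ x ∈ s with κ x < k + 1, f x := by
        intro s κ f
        rw [← Finset.sum_fiberwise_of_maps_to (s := s.filter fun x => κ x < k + 1)
          (t := Finset.range (k + 1)) (g := κ) fun x hx =>
            Finset.mem_range.2 (Finset.mem_filter.1 hx).2]
        refine Finset.sum_congr rfl fun j hj => ?_
        rw [Finset.filter_filter]
        refine Finset.sum_congr (Finset.filter_congr fun x _ => ?_) fun _ _ => rfl
        rw [Finset.mem_range] at hj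
        constructor
        · intro h; exact ⟨by omega, h⟩
        · exact fun h => h.2
      rw [Finset.sum_congr rfl fun j _ => h3 j]
      rw [Finset.sum_add_distrib, Finset.sum_add_distrib, h4, h4]
      have h5 := h4 (P.bigStates p q) (fun x => P.cls (q x) + 1) fun x => P.ρ ^ (P.cls (q x) + 1)
      have h6 : ∑ j ∈ Finset.range (k + 1), ((P.nk adv p j : ℝ) - P.pieces adv i (p i) j) * P.ρ ^ j +
          ∑ j ∈ Finset.range (k + 1), ((P.bigCount p q j : ℝ) - P.nk adv p j) * P.ρ ^ j =
          ∑ j ∈ Finset.range (k + 1), ∑ x ∈ P.bigStates p q with P.cls (q x) + 1 = j,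
            P.ρ ^ (P.cls (q x) + 1) -
          ∑ j ∈ Finset.range (k + 1), (P.pieces adv i (p i) j : ℝ) * P.ρ ^ j := by
        rw [← Finset.sum_add_distrib, ← Finset.sum_sub_distrib]
        refine Finset.sum_congr rfl fun j _ => ?_
        have : (P.bigCount p q j : ℝ) * P.ρ ^ j = ∑ x ∈ P.bigStates p q with P.cls (q x) + 1 = j,
            P.ρ ^ (P.cls (q x) + 1) := bigCount_mul (fun x => x) j
        rw [← this]; ring
      have h7 : ∑ a ∈ (Finset.range P.n).filter (fun a => P.ent adv i (p i) a ≤ k),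
          P.rem adv i (p i) a =
        ∑ a ∈ (Finset.range (P.line adv p i).n).filter (fun a => (P.line adv p i).ent a ≤ k),
          (P.line adv p i).r a := rfl
      linarith
    · have h2 := sum_rem hadv hq i
      have h3 := hsum1 i
      rw [LineData.target, List.sum_append] at h3
      have h4 : ((List.range (P.line adv p i).Q).flatMap fun k =>
          List.replicate ((P.line adv p i).nk k) ((P.line adv p i).s k)).sum =
          ∑ k ∈ Finset.range P.Q, (P.nk adv p k : ℝ) * P.ρ ^ k := by
        have := sum_flatMap_range (fun k => List.replicate ((P.line adv p i).nk k)
          ((P.line adv p i).s k)) (fun x => x) P.Q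
        simp only [List.map_id', List.sum_replicate, nsmul_eq_mul] at this
        exact this
      have h5 : ∑ j ∈ Finset.range P.Q, (P.line adv p i).need j =
          ∑ k ∈ Finset.range P.Q, (P.nk adv p k : ℝ) * P.ρ ^ k -
          ∑ k ∈ Finset.range P.Q, (P.pieces adv i (p i) k : ℝ) * P.ρ ^ k := by
        rw [← Finset.sum_sub_distrib]
        exact Finset.sum_congr rfl fun k _ => by rw [hneed]; ring
      change ∑ a ∈ Finset.range P.n, P.rem adv i (p i) a =
        ∑ j ∈ Finset.range P.Q, (P.line adv p i).need j + _
      linarith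
  have hent : ∑ x ∈ P.smallStates p q, eta (q x) + ∑ x ∈ P.bigStates p q,
      (eta (P.ρ ^ (P.cls (q x) + 1)) + eta (q x - P.ρ ^ (P.cls (q x) + 1))) ≤ entropy q + δ := by
    have hδ0 : 0 ≤ δ := by
      refine le_trans ?_ (hδ P.ρ (by nlinarith) le_rfl)
      exact add_nonneg (eta_nonneg h00.le h1.le) (eta_nonneg (by linarith) (by linarith))
    have h2 : ∀ x ∈ P.bigStates p q,
        eta (P.ρ ^ (P.cls (q x) + 1)) + eta (q x - P.ρ ^ (P.cls (q x) + 1)) ≤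
          eta (q x) + q x * δ := by
      intro x hx
      have h3 := pow_cls_le h00 h1 (mem_bigStates.1 hx).1
      have h4 := mul_lt_pow_cls h00 h1 (hq.le_one x)
      have h5 : 0 < q x := (pow_pos h00 _).trans_le h3
      -- The share of the state that becomes its piece; it lies in `[ρ ^ 2, ρ]`, where the binary
      -- entropy is at most `δ`.
      set y := P.ρ ^ (P.cls (q x) + 1) / q x with hy
      have e1 : P.ρ ^ (P.cls (q x) + 1) = y * q x := by rw [hy]; field_simp
      have hy2 : y ≤ P.ρ := by
        rw [hy, div_le_iff₀ h5, pow_succ']; gcongr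
      have hy1 : P.ρ ^ 2 ≤ y := by
        rw [hy, le_div_iff₀ h5, show P.ρ ^ 2 * q x = P.ρ * (P.ρ * q x) by ring, pow_succ']; gcongr
      have e2 : q x - P.ρ ^ (P.cls (q x) + 1) = (1 - y) * q x := by rw [e1]; ring
      rw [e2, e1, eta_split (lt_of_lt_of_le (by positivity) hy1) (by linarith) h5]
      have := hδ y hy1 hy2
      gcongr
    have h3 := (Finset.sum_le_sum h2).trans
      (le_of_eq (by rw [Finset.sum_add_distrib, Finset.sum_mul]) :
        _ ≤ ∑ x ∈ P.bigStates p q, eta (q x) + (∑ x ∈ P.bigStates p q, q x) * δ)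
    have h4 : ∑ x ∈ P.bigStates p q, q x ≤ 1 := by
      rw [← hq.sum_eq]
      exact Finset.sum_le_sum_of_subset_of_nonneg (Finset.subset_univ _) fun x _ _ => hq.nonneg x
    have h5 : ∑ x ∈ P.smallStates p q, eta (q x) + ∑ x ∈ P.bigStates p q, eta (q x) ≤
        entropy q := by
      rw [← Finset.sum_union, entropy_eq_sum_eta]
      · exact Finset.sum_le_sum_of_subset_of_nonneg (Finset.subset_univ _) fun x _ _ =>
          eta_nonneg (hq.nonneg x) (hq.le_one x)
      · rw [Finset.disjoint_left]
        exact fun x hx hx' => (mem_smallStates.1 hx).2 (mem_bigStates.1 hx').2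
    have h6 : (∑ x ∈ P.bigStates p q, q x) * δ ≤ 1 * δ := by gcongr
    linarith
  have hfin := sum_eta_joint_le (n := P.n)
    (l := fun i : Fin P.m => labelAt 0 (P.line adv p i).frags)
    (fun i => measurable_labelAt _ _) ((P.line adv p 0).target (P.tails p q adv)) (fun w hw => ?_) 0
    (fun i t htt => ?_)
  · rw [zero_add, hsum1, sum_target hg] at hfin
    have h2 := Finset.sum_le_sum fun (i : Fin P.m) (_ : i ∈ Finset.univ) => cross i
    rw [Finset.sum_const, Finset.card_univ, Fintype.card_fin, nsmul_eq_mul] at h2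
    have h3 : entropy (P.coupling adv p) = ∑ x : Fin P.m → Fin P.n,
      eta (joint (fun i : Fin P.m => labelAt 0 (P.line adv p i).frags) 0 1 x) := rfl
    -- The target line depends on the sizes and numbers of pieces only, which are shared by all
    -- marginals.
    have h4 : ∑ i : Fin P.m, crossing P.n (labelAt 0 (P.line adv p i).frags) 0
        ((P.line adv p 0).target (P.tails p q adv)) =
      ∑ i : Fin P.m, crossing P.n (labelAt 0 (P.line adv p i).frags) 0
        ((P.line adv p i).target (P.tails p q adv)) := rfl
    linarith
  · rw [LineData.target] at hw
    rcases List.mem_append.1 hw with hw | hw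
    · obtain ⟨k, _, hw⟩ := List.mem_flatMap.1 hw
      exact (List.mem_replicate.1 hw).2 ▸ hs 0 k
    · obtain ⟨b, hb, rfl⟩ := List.mem_map.1 hw
      exact hV0 b hb
  · refine labelAt_lt (fun a ha => (LineData.frags_mem (hs i) (hr i) ha).1) ?_ htt.1
    have h2 : total (P.line adv p i).frags = 1 := by
      rw [LineData.total_eq_sum_filter fun a ha => (LineData.frags_mem (hs i) (hr i) ha).1,
        ← hq.sum_p i]
      refine (Finset.sum_congr rfl fun b hb =>
        total_frags hadv p i (Finset.mem_range.1 hb)).trans ?_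
      exact Finset.sum_range _
    rw [h2]
    have := htt.2
    rwa [hsum1] at this

end Par

/-! ### The common refinement of several labelled lines -/

/-- The intersection of two labelled intervals; the labels are combined with the weight `w`. -/
noncomputable def meet (w : ℕ) (g f : ℕ × ℝ × ℝ) : ℕ × ℝ × ℝ :=
  (g.1 + f.1 * w, max g.2.1 f.2.1, min g.2.2 f.2.2)

/-- The fragments with their starting and end points. -/
noncomputable def spans : ℝ → List (ℕ × ℝ) → List (ℕ × ℝ × ℝ)
  | _, [] => []
  | o, a :: L => (a.1, o, o + a.2) :: spans (o + a.2) L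

theorem spans_append (o : ℝ) (L L' : List (ℕ × ℝ)) :
    spans o (L ++ L') = spans o L ++ spans (o + total L) L' := by
  induction L generalizing o with
  | nil => simp [spans]
  | cons a L ih => simp [spans, ih, add_assoc]

theorem length_spans (o : ℝ) (L : List (ℕ × ℝ)) : (spans o L).length = L.length := by
  induction L generalizing o with
  | nil => rfl
  | cons a L ih => simp [spans, ih]

/-- The refinement of the lines `F 0, …, F (i - 1)` of `[0, 1)`. A piece is labelled by the number
with the digits `λ₀, …, λ_{i-1}` to the base `n`. -/
noncomputable def overlay (n : ℕ) (F : ℕ → List (ℕ × ℝ)) : ℕ → List (ℕ × ℝ × ℝ)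
  | 0 => [(0, 0, 1)]
  | i + 1 => (overlay n F i).flatMap fun g => (spans 0 (F i)).map (meet (n ^ i) g)

/-- The length of the pieces with the label `c`. -/
noncomputable def weight (l : List (ℕ × ℝ × ℝ)) (c : ℕ) : ℝ :=
  (l.map fun g => if g.1 = c then max 0 (g.2.2 - g.2.1) else 0).sum

open Classical in
/-- The number of pieces that contain `t` and whose label satisfies `φ`. -/
noncomputable def cover (l : List (ℕ × ℝ × ℝ)) (φ : ℕ → Prop) (t : ℝ) : ℕ :=
  (l.map fun g => if φ g.1 ∧ g.2.1 ≤ t ∧ t < g.2.2 then 1 else 0).sum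

open Classical in
theorem cover_spans (o : ℝ) {L : List (ℕ × ℝ)} (hL : ∀ a ∈ L, 0 ≤ a.2) (φ : ℕ → Prop) (t : ℝ) :
    cover (spans o L) φ t =
      if φ (labelAt o L t) ∧ o ≤ t ∧ t < o + total L then 1 else 0 := by
  induction L generalizing o with
  | nil =>
    have : ¬ (φ (labelAt o [] t) ∧ o ≤ t ∧ t < o + total []) := by
      rintro ⟨_, h1, h2⟩; simp at h2; linarith
    rw [if_neg this]; simp [cover, spans]
  | cons a L ih =>
    have ha := hL a (by simp)
    have h0 := total_nonneg fun b hb => hL b (List.mem_cons_of_mem _ hb)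
    have ih := ih (o + a.2) fun b hb => hL b (List.mem_cons_of_mem _ hb)
    simp only [cover, spans, List.map_cons, List.sum_cons] at ih ⊢
    rw [ih]
    by_cases h : t < o + a.2
    · have h2 : ¬ o + a.2 ≤ t := by linarith
      have h3 : t < o + (a.2 + total L) := by linarith
      simp [labelAt, h, h2, h3]
    · have h2 : o + a.2 ≤ t := by linarith
      have h3 : o ≤ t := by linarith
      simp [labelAt, h, h2, h3, add_assoc]

-- A point of `[0, 1)` lies in exactly one span of each marginal. In the induction the digit of the
-- newest marginal is absorbed into the predicate `φ`.
open Classical in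
theorem cover_overlay (n : ℕ) {F : ℕ → List (ℕ × ℝ)} (m : ℕ) (hF : ∀ i < m, ∀ a ∈ F i, 0 ≤ a.2)
    (hF1 : ∀ i < m, total (F i) = 1) (φ : ℕ → Prop) (t : ℝ) :
    cover (overlay n F m) φ t =
      if φ (∑ j ∈ Finset.range m, labelAt 0 (F j) t * n ^ j) ∧ 0 ≤ t ∧ t < 1 then 1 else 0 := by
  induction m generalizing φ with
  | zero => simp only [overlay, cover, List.map_cons, List.map_nil, List.sum_cons, List.sum_nil, add_zero, Finset.range_zero, Finset.sum_empty]; exact if_congr Iff.rfl rfl rfl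
  | succ i ih =>
    have ih := ih (fun j hj => hF j (by omega)) fun j hj => hF1 j (by omega)
    have key : ∀ g : ℕ × ℝ × ℝ, cover ((spans 0 (F i)).map (meet (n ^ i) g)) φ t =
        if φ (g.1 + labelAt 0 (F i) t * n ^ i) ∧ 0 ≤ t ∧ t < 1 then
          if g.2.1 ≤ t ∧ t < g.2.2 then 1 else 0 else 0 := by
      intro g
      have h1 := cover_spans 0 (hF i (by omega)) (fun a => φ (g.1 + a * n ^ i)) t
      rw [hF1 i (by omega), zero_add] at h1
      by_cases h : g.2.1 ≤ t ∧ t < g.2.2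
      · rw [if_pos h, ← h1, cover, cover, List.map_map]
        refine congrArg List.sum (List.map_congr_left fun f _ => if_congr ?_ rfl rfl)
        simp only [meet, max_le_iff, lt_min_iff, h.1, h.2, true_and]
      · rw [if_neg h, ite_self, cover, List.map_map]
        refine List.sum_eq_zero fun x hx => ?_
        obtain ⟨f, _, rfl⟩ := List.mem_map.1 hx
        refine if_neg ?_
        simp only [meet, max_le_iff, lt_min_iff]
        tauto
    have h2 : ∀ l : List (ℕ × ℝ × ℝ),
        cover (l.flatMap fun g => (spans 0 (F i)).map (meet (n ^ i) g)) φ t =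
        if 0 ≤ t ∧ t < 1 then cover l (fun c => φ (c + labelAt 0 (F i) t * n ^ i)) t else 0 := by
      intro l
      induction l with
      | nil => simp [cover]
      | cons g l ihl =>
        have e1 : ∀ l l' : List (ℕ × ℝ × ℝ), cover (l ++ l') φ t = cover l φ t + cover l' φ t :=
          fun l l' => by simp [cover]
        have e2 : ∀ ψ, cover (g :: l) ψ t =
          (if ψ g.1 ∧ g.2.1 ≤ t ∧ t < g.2.2 then 1 else 0) + cover l ψ t := fun ψ => by simp [cover]
        rw [List.flatMap_cons, e1, ihl, key, e2]
        by_cases h : 0 ≤ t ∧ t < 1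
        · rw [if_pos h, if_pos h]
          by_cases h' : φ (g.1 + labelAt 0 (F i) t * n ^ i)
          · rw [if_pos ⟨h', h⟩]; simp [h']
          · rw [if_neg fun H => h' H.1]; simp [h']
        · rw [if_neg h, if_neg h, if_neg fun H => h H.2]
    rw [overlay, h2, ih]
    simp only [Finset.sum_range_succ]
    by_cases h : 0 ≤ t ∧ t < 1 <;> simp [h]

/-- Measuring labels by integrating the cover makes empty and reversed intersections harmless, as
they cover nothing and have weight `0`. -/
theorem integral_cover (l : List (ℕ × ℝ × ℝ)) (c : ℕ) :
    Integrable (fun t => (cover l (· = c) t : ℝ)) ∧ ∫ t, (cover l (· = c) t : ℝ) = weight l c := by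
  classical
  induction l with
  | nil => simp [cover, weight]
  | cons g l ih =>
    have e1 : (fun t => (cover (g :: l) (· = c) t : ℝ)) = fun t =>
        (Ico g.2.1 g.2.2).indicator (fun _ => if g.1 = c then (1 : ℝ) else 0) t +
          (cover l (· = c) t : ℝ) := by
      funext t
      simp only [cover, List.map_cons, List.sum_cons, Nat.cast_add, indicator, mem_Ico]
      by_cases h : g.1 = c <;> by_cases h' : g.2.1 ≤ t ∧ t < g.2.2 <;> simp [h, h']
    have e2 : Integrable (fun t => (Ico g.2.1 g.2.2).indicator
        (fun _ => if g.1 = c then (1 : ℝ) else 0) t) :=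
      (integrable_indicator_iff measurableSet_Ico).2 (integrableOn_const (by simp))
    rw [e1]
    refine ⟨e2.add ih.1, ?_⟩
    rw [integral_add e2 ih.1, ih.2, integral_indicator measurableSet_Ico, setIntegral_const]
    simp only [weight, List.map_cons, List.sum_cons]
    congr 1
    rw [Real.volume_real_Ico, max_comm]
    split_ifs <;> simp

/-- The number with the digits `x₀, …, x_{m-1}` determines the digits. -/
theorem sum_digits_inj {m n : ℕ} {x : Fin m → Fin n} {y : ℕ → ℕ} (hy : ∀ i : Fin m, y i < n)
    (h : ∑ j ∈ Finset.range m, y j * n ^ j = ∑ i : Fin m, (x i : ℕ) * n ^ (i : ℕ)) (i : Fin m) :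
    y i = x i := by
  have h2 : finFunctionFinEquiv (fun i : Fin m => (⟨y i, hy i⟩ : Fin n)) = finFunctionFinEquiv x := by
    ext
    rw [finFunctionFinEquiv_apply, finFunctionFinEquiv_apply, ← h, Finset.sum_range]
  have h3 := congrFun (finFunctionFinEquiv.injective h2) i
  exact congrArg Fin.val h3

/-- The cover of a label is the indicator of the set with the corresponding label vector, because
the label's digits determine the vector. -/
theorem weight_overlay {m n : ℕ} {F : ℕ → List (ℕ × ℝ)} (hF : ∀ i < m, ∀ a ∈ F i, a.1 < n ∧ 0 ≤ a.2)
    (hF1 : ∀ i < m, total (F i) = 1) (x : Fin m → Fin n) :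
    weight (overlay n F m) (∑ i, (x i : ℕ) * n ^ (i : ℕ)) =
      joint (fun i : Fin m => labelAt 0 (F i)) 0 1 x := by
  classical
  rw [← (integral_cover _ _).2]
  have hm : MeasurableSet (Ico (0 : ℝ) 1 ∩ {t | ∀ i : Fin m, labelAt 0 (F i) t = x i}) :=
    measurableSet_Ico.inter
      (measurableSet_labels (l := fun i : Fin m => labelAt 0 (F i)) (fun i => measurable_labelAt _ _)
        fun i => x i)
  have e : (fun t => (cover (overlay n F m) (· = ∑ i, (x i : ℕ) * n ^ (i : ℕ)) t : ℝ)) =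
      (Ico (0 : ℝ) 1 ∩ {t | ∀ i : Fin m, labelAt 0 (F i) t = x i}).indicator fun _ => 1 := by
    funext t
    rw [cover_overlay n m (fun i hi a ha => (hF i hi a ha).2) hF1, indicator_apply, Nat.cast_ite, Nat.cast_one, Nat.cast_zero]
    have hiff : ((∑ j ∈ Finset.range m, labelAt 0 (F j) t * n ^ j = ∑ i, (x i : ℕ) * n ^ (i : ℕ)) ∧
        0 ≤ t ∧ t < 1) ↔ t ∈ Ico (0 : ℝ) 1 ∩ {t | ∀ i : Fin m, labelAt 0 (F i) t = x i} := by
      rw [and_comm, mem_inter_iff, mem_Ico]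
      refine and_congr_right fun ht => ?_
      rw [mem_ofPred_eq]
      constructor
      · refine fun h i => sum_digits_inj (y := fun j => labelAt 0 (F j) t) (fun i => ?_) h i
        exact labelAt_lt (fun a ha => (hF i i.2 a ha).1) (by rw [hF1 i i.2]; linarith [ht.2]) ht.1
      · intro h
        rw [Finset.sum_range]
        exact Finset.sum_congr rfl fun i _ => by rw [h i]
    by_cases h : t ∈ Ico (0 : ℝ) 1 ∩ {t | ∀ i : Fin m, labelAt 0 (F i) t = x i}
    · rw [if_pos h, if_pos (hiff.2 h)]
    · rw [if_neg h, if_neg fun H => h (hiff.1 H)]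
  rw [e, integral_indicator hm, setIntegral_const, smul_eq_mul, mul_one]
  rfl

/-! ### Reasoning about programs -/

@[simp] theorem Store.int_writeInt (s : Store) (a j v b : ℕ) :
    (s.writeInt a j v).int b = if b = a then Function.update (s.int a) j v else s.int b := by
  by_cases h : b = a
  · subst h; simp [Store.writeInt]
  · simp [Store.writeInt, h]

@[simp] theorem Store.num_writeInt (s : Store) (a j v b : ℕ) :
    (s.writeInt a j v).num b = s.num b := rfl

@[simp] theorem Store.num_writeNum (s : Store) (a j : ℕ) (v : ℝ) (b : ℕ) :
    (s.writeNum a j v).num b = if b = a then Function.update (s.num a) j v else s.num b := by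
  by_cases h : b = a
  · subst h; simp [Store.writeNum]
  · simp [Store.writeNum, h]

@[simp] theorem Store.int_writeNum (s : Store) (a j : ℕ) (v : ℝ) (b : ℕ) :
    (s.writeNum a j v).int b = s.int b := rfl

namespace Prog

/-- Whether a program contains an assignment to the integer array `a`. -/
def ints (a : ℕ) : Prog → Bool
  | skip => false
  | setInt b _ _ => b == a
  | setNum _ _ _ => false
  | seq P Q => P.ints a || Q.ints a
  | ite _ P Q => P.ints a || Q.ints a
  | loop _ P => P.ints a

/-- Whether a program contains an assignment to the number array `a`. -/
def nums (a : ℕ) : Prog → Bool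
  | skip => false
  | setInt _ _ _ => false
  | setNum b _ _ => b == a
  | seq P Q => P.nums a || Q.nums a
  | ite _ P Q => P.nums a || Q.nums a
  | loop _ P => P.nums a

/-- A bound for the running time of a program whose loops are passed at most `B` times each. -/
def time (B : ℕ) : Prog → ℕ
  | skip => 1
  | setInt _ e f => e.cost + f.cost + 1
  | setNum _ e x => e.cost + x.cost + 1
  | seq P Q => P.time B + Q.time B
  | ite b P Q => b.cost + (P.time B + Q.time B)
  | loop b P => B * (b.cost + P.time B) + b.cost

/-- Each loop contributes one more factor of order `B`, so the degree depends only on the text of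
the program. -/
theorem exists_time_le (P : Prog) : ∃ c d : ℕ, ∀ B, P.time B ≤ c * (B + 1) ^ d := by
  have mono : ∀ (c c' d d' B x y : ℕ), x ≤ c * (B + 1) ^ d → y ≤ c' * (B + 1) ^ d' →
      x + y ≤ (c + c') * (B + 1) ^ (d + d') := by
    intro c c' d d' B x y hx hy
    have h1 : (B + 1) ^ d ≤ (B + 1) ^ (d + d') := Nat.pow_le_pow_right (by omega) (by omega)
    have h2 : (B + 1) ^ d' ≤ (B + 1) ^ (d + d') := Nat.pow_le_pow_right (by omega) (by omega)
    calc x + y ≤ c * (B + 1) ^ d + c' * (B + 1) ^ d' := by omega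
      _ ≤ c * (B + 1) ^ (d + d') + c' * (B + 1) ^ (d + d') := by gcongr
      _ = _ := by ring
  induction P with
  | skip => exact ⟨1, 0, fun B => by simp [time]⟩
  | setInt a e f => exact ⟨e.cost + f.cost + 1, 0, fun B => by simp [time]⟩
  | setNum a e f => exact ⟨e.cost + f.cost + 1, 0, fun B => by simp [time]⟩
  | seq P Q hP hQ =>
    obtain ⟨c, d, h⟩ := hP
    obtain ⟨c', d', h'⟩ := hQ
    exact ⟨_, _, fun B => mono _ _ _ _ _ _ _ (h B) (h' B)⟩
  | ite b P Q hP hQ =>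
    obtain ⟨c, d, h⟩ := hP
    obtain ⟨c', d', h'⟩ := hQ
    exact ⟨_, _, fun B => mono b.cost _ 0 _ _ _ _ (by simp) (mono _ _ _ _ _ _ _ (h B) (h' B))⟩
  | loop b P hP =>
    obtain ⟨c, d, h⟩ := hP
    refine ⟨_, _, fun B => mono (b.cost + c) b.cost (d + 1) 0 _ _ _ ?_ (by simp)⟩
    have h1 : 1 ≤ (B + 1) ^ d := Nat.one_le_pow _ _ (by omega)
    calc B * (b.cost + P.time B) ≤ (B + 1) * (b.cost * (B + 1) ^ d + c * (B + 1) ^ d) :=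
          Nat.mul_le_mul (by omega) (Nat.add_le_add (by nlinarith) (h B))
      _ = _ := by ring

end Prog

/-- `s'` agrees with `s` on the arrays to which `P` does not write. -/
structure Frame (P : Prog) (s s' : Store) : Prop where
  int : ∀ a, P.ints a = false → s'.int a = s.int a
  num : ∀ a, P.nums a = false → s'.num a = s.num a

theorem Frame.refl (P : Prog) (s : Store) : Frame P s s := ⟨fun _ _ => rfl, fun _ _ => rfl⟩

theorem Frame.trans {P : Prog} {s s' s'' : Store} (h : Frame P s s') (h' : Frame P s' s'') :
    Frame P s s'' :=
  ⟨fun a ha => (h'.int a ha).trans (h.int a ha), fun a ha => (h'.num a ha).trans (h.num a ha)⟩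

theorem Frame.mono {P P' : Prog} {s s' : Store} (h : Frame P s s')
    (hi : ∀ a, P'.ints a = false → P.ints a = false)
    (hn : ∀ a, P'.nums a = false → P.nums a = false) : Frame P' s s' :=
  ⟨fun a ha => h.int a (hi a ha), fun a ha => h.num a (hn a ha)⟩

theorem Run.frame {P : Prog} {s s' : Store} {t : ℕ} (h : Run P s t s') : Frame P s s' := by
  induction h with
  | skip s => exact Frame.refl _ s
  | setInt a e f s =>
    refine ⟨fun b hb => ?_, fun _ _ => rfl⟩
    have : b ≠ a := by rintro rfl; simp [Prog.ints] at hb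
    simp [this]
  | setNum a e x s =>
    refine ⟨fun _ _ => rfl, fun b hb => ?_⟩
    have : b ≠ a := by rintro rfl; simp [Prog.nums] at hb
    simp [this]
  | seq _ _ h1 h2 =>
    exact (h1.mono (by simp +contextual [Prog.ints]) (by simp +contextual [Prog.nums])).trans
      (h2.mono (by simp +contextual [Prog.ints]) (by simp +contextual [Prog.nums]))
  | iteTrue _ _ h1 =>
    exact h1.mono (by simp +contextual [Prog.ints]) (by simp +contextual [Prog.nums])
  | iteFalse _ _ h1 =>
    exact h1.mono (by simp +contextual [Prog.ints]) (by simp +contextual [Prog.nums])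
  | loopTrue _ _ _ h1 h2 =>
    exact (h1.mono (by simp +contextual [Prog.ints]) (by simp +contextual [Prog.nums])).trans h2
  | loopFalse _ => exact Frame.refl _ _

/-- Started on `s`, the program halts in time `P.time B` with memory contents that satisfy `Q`. -/
def wp (P : Prog) (B : ℕ) (s : Store) (Q : Store → Prop) : Prop :=
  ∃ t s', Run P s t s' ∧ t ≤ P.time B ∧ Q s'

section
variable {P R : Prog} {B : ℕ} {s : Store} {Q Q' : Store → Prop}

/-- The weakening step also hands out the frame of the run. As `Prog.ints` and `Prog.nums` compute,
the invariance of an untouched array is proved by `rfl`. -/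
theorem wp.mono (h : wp P B s Q) (hQ : ∀ s', Frame P s s' → Q s' → Q' s') : wp P B s Q' := by
  obtain ⟨t, s', hr, ht, hq⟩ := h
  exact ⟨t, s', hr, ht, hQ s' hr.frame hq⟩

theorem wp_skip (h : Q s) : wp .skip B s Q := ⟨_, _, .skip s, le_rfl, h⟩

theorem wp_setInt {a : ℕ} {e f : IntExp} (h : Q (s.writeInt a (e.eval s) (f.eval s))) :
    wp (.setInt a e f) B s Q := ⟨_, _, .setInt a e f s, le_rfl, h⟩

theorem wp_setNum {a : ℕ} {e : IntExp} {x : NumExp} (h : Q (s.writeNum a (e.eval s) (x.eval s))) :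
    wp (.setNum a e x) B s Q := ⟨_, _, .setNum a e x s, le_rfl, h⟩

theorem wp_seq (h : wp P B s fun s' => wp R B s' Q) : wp (.seq P R) B s Q := by
  obtain ⟨t, s', hr, ht, t', s'', hr', ht', hq⟩ := h
  exact ⟨_, _, .seq hr hr', Nat.add_le_add ht ht', hq⟩

theorem wp_ite {b : Test} (h1 : b.Holds s → wp P B s Q) (h2 : ¬ b.Holds s → wp R B s Q) :
    wp (.ite b P R) B s Q := by
  by_cases hb : b.Holds s
  · obtain ⟨t, s', hr, ht, hq⟩ := h1 hb
    exact ⟨_, _, .iteTrue hb hr, by simp only [Prog.time]; omega, hq⟩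
  · obtain ⟨t, s', hr, ht, hq⟩ := h2 hb
    exact ⟨_, _, .iteFalse hb hr, by simp only [Prog.time]; omega, hq⟩

end

/-- The scalar that is kept in the first cell of the integer array `a`. -/
def iv (a : ℕ) : IntExp := .get a (.const 0)

/-- The scalar that is kept in the first cell of the number array `a`. -/
def nv (a : ℕ) : NumExp := .get a (.const 0)

@[simp] theorem eval_iv (s : Store) (a : ℕ) : (iv a).eval s = s.int a 0 := rfl
@[simp] theorem eval_nv (s : Store) (a : ℕ) : (nv a).eval s = s.num a 0 := rfl

/-- Multiplication of an integer expression with a constant. -/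
def mulc : ℕ → IntExp → IntExp
  | 0, _ => .const 0
  | c + 1, e => .add (mulc c e) e

@[simp] theorem eval_mulc (s : Store) (c : ℕ) (e : IntExp) : (mulc c e).eval s = c * e.eval s := by
  induction c with
  | zero => simp [mulc, IntExp.eval]
  | succ c ih => simp [mulc, IntExp.eval, ih]; ring

/-- "For `v = 0, …, b - 1` do `P`", where `v` and `b` are integer scalars. -/
def forLoop (v b : ℕ) (P : Prog) : Prog :=
  .seq (.setInt v (.const 0) (.const 0))
    (.loop (.intLT (iv v) (iv b)) (.seq P (.setInt v (.const 0) (.add (iv v) (.const 1)))))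

/-- The counter is assigned outside the body, at the start and after each pass, so the invariant has
to survive writes to its cell. The body may change neither the counter nor the bound, whence exactly
`N` passes. -/
theorem wp_for {v b : ℕ} {P : Prog} {B : ℕ} {s : Store} {Q : Store → Prop} {N : ℕ}
    (I : ℕ → Store → Prop) (hN : s.int b 0 = N) (hB : N ≤ B)
    (hv : P.ints v = false) (hb : (forLoop v b P).ints b = false)
    (hI : ∀ k s j, I k s → I k (s.writeInt v 0 j)) (h0 : I 0 s)
    (hstep : ∀ k < N, ∀ s', Frame (forLoop v b P) s s' → s'.int v 0 = k → I k s' →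
      wp P B s' (I (k + 1)))
    (hQ : ∀ s', Frame (forLoop v b P) s s' → I N s' → Q s') : wp (forLoop v b P) B s Q := by
  have hPb : P.ints b = false ∧ v ≠ b := by
    simp only [forLoop, Prog.ints, Bool.or_eq_false_iff] at hb
    exact ⟨hb.2.1, by simpa using hb.1⟩
  have key : ∀ d k s₁, k + d = N → Frame (forLoop v b P) s s₁ → s₁.int v 0 = k → I k s₁ →
      ∃ t s', Run (.loop (.intLT (iv v) (iv b))
        (.seq P (.setInt v (.const 0) (.add (iv v) (.const 1))))) s₁ t s' ∧
        t ≤ d * ((Test.intLT (iv v) (iv b)).cost +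
          (Prog.seq P (.setInt v (.const 0) (.add (iv v) (.const 1)))).time B) +
          (Test.intLT (iv v) (iv b)).cost ∧ I N s' := by
    intro d
    induction d with
    | zero =>
      intro k s₁ hk hF hvk hIk
      obtain rfl : k = N := hk
      refine ⟨_, _, .loopFalse ?_, by simp, hIk⟩
      simp [Test.Holds, hvk, hF.int b hb, hN]
    | succ d ih =>
      intro k s₁ hk hF hvk hIk
      obtain ⟨t, s₂, hr, ht, hI2⟩ := hstep k (by omega) s₁ hF hvk hIk
      have hbody : Run (.seq P (.setInt v (.const 0) (.add (iv v) (.const 1)))) s₁ _ _ :=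
        .seq hr (.setInt v (.const 0) (.add (iv v) (.const 1)) s₂)
      have hv2 : s₂.int v 0 = k := by rw [hr.frame.int v hv, hvk]
      have hbody' := hbody.frame.mono (P' := forLoop v b P)
        (by simp +contextual [forLoop, Prog.ints]) (by simp +contextual [forLoop, Prog.nums])
      obtain ⟨t', s₃, hr', ht', hI3⟩ := ih (k + 1) _ (by omega) (hF.trans hbody')
        (by simp [IntExp.eval, hv2]) (hI _ _ _ hI2)
      refine ⟨_, _, .loopTrue (by simp [Test.Holds, hvk, hF.int b hb, hN]; omega) hbody hr', ?_, hI3⟩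
      have e1 : (Prog.seq P (.setInt v (.const 0) (.add (iv v) (.const 1)))).time B =
        P.time B + (Prog.setInt v (.const 0) (.add (iv v) (.const 1))).time B := rfl
      have e2 : (Prog.setInt v (.const 0) (.add (iv v) (.const 1))).time B =
        (IntExp.const 0).cost + (IntExp.add (iv v) (.const 1)).cost + 1 := rfl
      rw [add_mul, one_mul]
      omega
  have hF0 : Frame (forLoop v b P) s (s.writeInt v 0 0) := by
    refine ⟨fun a ha => ?_, fun _ _ => rfl⟩
    have : a ≠ v := by rintro rfl; simp [forLoop, Prog.ints] at ha
    simp [this]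
  obtain ⟨t, s', hr, ht, hIN⟩ := key N 0 (s.writeInt v 0 0) (by omega) hF0 (by simp) (hI _ _ _ h0)
  have hrun : Run (forLoop v b P) s _ s' :=
    .seq (.setInt v (.const 0) (.const 0) s) hr
  refine ⟨_, _, hrun, ?_, hQ s' hrun.frame hIN⟩
  simp only [forLoop, Prog.time] at ht ⊢
  have := Nat.mul_le_mul_right ((Test.intLT (iv v) (iv b)).cost +
    (P.time B + ((IntExp.const 0).cost + (IntExp.add (iv v) (.const 1)).cost + 1))) hB
  omega

/-! ### The tables of one marginal -/

/-- "If `e = f` then `P`." -/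
def whenEq (e f : IntExp) (P : Prog) : Prog := .ite (.intLE e f) (.ite (.intLE f e) P .skip) .skip

theorem wp_whenEq {e f : IntExp} {P : Prog} {B : ℕ} {s : Store} {Q : Store → Prop}
    (h1 : e.eval s = f.eval s → wp P B s Q) (h2 : e.eval s ≠ f.eval s → Q s) :
    wp (whenEq e f P) B s Q := by
  refine wp_ite (fun h => wp_ite (fun h' => h1 (le_antisymm h h')) fun h' => wp_skip (h2 ?_))
    fun h => wp_skip (h2 ?_)
  · exact fun e => h' e.ge
  · exact fun e => h e.le

/-- The memory holds the constants of the computation: the integer arrays `0` to `11` hold `n`, `m`,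
the multiples and the powers of `n`, two auxiliary values, `K`, the number of classes, the length of
the advice, the number `W` of advices, `n ^ m`, and `U`; the number arrays `0` and `1` hold the
marginals and the powers of `ρ`. -/
structure Ctx (P : Par) (p : ℕ → ℕ → ℝ) (W : ℕ) (s : Store) : Prop where
  n : s.int 0 0 = P.n
  m : s.int 1 0 = P.m
  mul : ∀ i < P.m, s.int 2 i = i * P.n
  pow : ∀ i < P.m, s.int 3 i = P.n ^ i
  K : s.int 6 0 = P.K
  Q : s.int 7 0 = P.Q
  len : s.int 8 0 = P.len
  W : s.int 9 0 = W
  states : s.int 10 0 = P.n ^ P.m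
  U : s.int 11 0 = P.U
  p : ∀ i < P.m, ∀ a < P.n, s.num 0 (i * P.n + a) = p i a
  s : ∀ k < P.Q, s.num 1 k = P.ρ ^ k

/-- The side conditions are closed Boolean tests on the program text, so the constants are carried
through any subprogram by `rfl`. -/
theorem Ctx.frame {P : Par} {p : ℕ → ℕ → ℝ} {W : ℕ} {s s' : Store} {R : Prog}
    (h : Ctx P p W s) (hF : Frame R s s')
    (hi : ((List.range 12).all fun a => !R.ints a) = true)
    (hn : ((List.range 2).all fun a => !R.nums a) = true) : Ctx P p W s' := by
  have hi' : ∀ a < 12, s'.int a = s.int a := fun a ha =>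
    hF.int a (by simpa using List.all_eq_true.1 hi a (List.mem_range.2 ha))
  have hn' : ∀ a < 2, s'.num a = s.num a := fun a ha =>
    hF.num a (by simpa using List.all_eq_true.1 hn a (List.mem_range.2 ha))
  constructor <;> simp only [hi' _ (by norm_num : 0 < 12), hi' _ (by norm_num : 1 < 12),
    hi' _ (by norm_num : 2 < 12), hi' _ (by norm_num : 3 < 12), hi' _ (by norm_num : 6 < 12),
    hi' _ (by norm_num : 7 < 12), hi' _ (by norm_num : 8 < 12), hi' _ (by norm_num : 9 < 12),
    hi' _ (by norm_num : 10 < 12), hi' _ (by norm_num : 11 < 12), hn' _ (by norm_num : 0 < 2),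
    hn' _ (by norm_num : 1 < 2)]
  exacts [h.n, h.m, h.mul, h.pow, h.K, h.Q, h.len, h.W, h.states, h.U, h.p, h.s]

/-- The number array `2` holds the marginal `i`. -/
def HasRow (P : Par) (p : ℕ → ℕ → ℝ) (i : ℕ) (s : Store) : Prop :=
  ∀ a < P.n, s.num 2 a = p i a

/-- The integer array `15` holds the classes. -/
def HasCls (P : Par) (p : ℕ → ℕ → ℝ) (i N : ℕ) (s : Store) : Prop :=
  ∀ a < N, s.int 15 a = P.cls (p i a)

/-- The integer arrays `16` and `17` hold the places in the advice and the entry classes, the number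
array `3` holds the remaining masses. -/
def HasRem (P : Par) (p : ℕ → ℕ → ℝ) (adv : ℕ → ℕ) (i N : ℕ) (s : Store) : Prop :=
  ∀ a < N, s.int 16 a = P.blk adv i (p i) a ∧ s.int 17 a = P.ent adv i (p i) a ∧
    s.num 3 a = P.rem adv i (p i) a

/-- Array names are fixed in the program text, while the marginal is chosen at run time; so its row
is fetched from the flattened array `0` at the offset stored in array `2`. -/
def loadProg : Prog :=
  forLoop 23 0 (.setNum 2 (iv 23) (.get 0 (.add (.get 2 (iv 22)) (iv 23))))

def clsProg : Prog :=
  forLoop 23 0 (.seq (.setInt 15 (iv 23) (.const 0)) (forLoop 24 6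
    (.ite (.numLT (.get 2 (iv 23)) (.get 1 (iv 24)))
      (.setInt 15 (iv 23) (.add (.get 15 (iv 23)) (.const 1))) .skip)))

/-- The machine has no remainder; the rank modulo `D` is a counter that is reset when it reaches
`D`. -/
def groupProg (D : ℕ) : Prog :=
  .seq (.setInt 19 (.const 0) (.const 0)) (forLoop 26 23
    (whenEq (.get 15 (iv 26)) (.get 15 (iv 23))
      (.seq (.setInt 19 (.const 0) (.add (iv 19) (.const 1)))
        (.ite (.intLE (.const D) (iv 19)) (.setInt 19 (.const 0) (.const 0)) .skip))))

/-- A product of a digit and a power of `ρ` is a repeated subtraction. Starting from the mass of the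
state, the sign of the result tells whether the pieces fit. -/
def usedProg : Prog :=
  .seq (.setNum 14 (.const 0) (.get 2 (iv 23))) (forLoop 25 11
    (.seq (.setInt 19 (.const 0) (.get 13 (.add (.get 16 (iv 23)) (iv 25))))
      (forLoop 26 19
        (.setNum 14 (.const 0) (.sub (nv 14) (.get 1 (.add (.get 15 (iv 23)) (iv 25))))))))

/-- If the pieces do not fit, the place is redirected to `len`, where all digits are `0`; the flag
is read only after this. -/
def entProg : Prog :=
  .seq (.ite (.numLE (.const 0) (nv 14)) (.setNum 3 (iv 23) (nv 14))
      (.seq (.setNum 3 (iv 23) (.get 2 (iv 23))) (.setInt 16 (iv 23) (iv 8))))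
    (.ite (.intLE (.get 13 (.add (.get 16 (iv 23)) (iv 11))) (.const 0))
      (.setInt 17 (iv 23) (.add (.get 15 (iv 23)) (iv 11))) (.setInt 17 (iv 23) (.get 15 (iv 23))))

/-- The place in the advice needs only multiplications with `m`, `D` and `U + 1`, which are
constants of the program and hence repeated additions inside one expression. -/
def remProg (m D U : ℕ) : Prog :=
  forLoop 23 0 (.seq (groupProg D) (.seq
    (.setInt 16 (iv 23) (mulc (U + 1) (.add (mulc D (.add (mulc m (.get 15 (iv 23))) (iv 22))) (iv 19))))
    (.seq usedProg entProg)))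

/-- Compute the tables of the marginal whose number is the integer scalar `22`. -/
def rowProg (m D U : ℕ) : Prog := .seq loadProg (.seq clsProg (remProg m D U))

section
variable {P : Par} {p : ℕ → ℕ → ℝ} {W B : ℕ} {s : Store} {adv : ℕ → ℕ} {i : ℕ}

theorem wp_load (hc : Ctx P p W s) (hi : s.int 22 0 = i) (him : i < P.m) (hB : P.n ≤ B) :
    wp loadProg B s (HasRow P p i) := by
  refine wp_for (fun k s' => ∀ a < k, s'.num 2 a = p i a) hc.n hB rfl rfl (fun _ _ _ h => h)
    (fun a ha => absurd ha (by omega)) (fun k hk s' hF hv hI => ?_) fun s' _ h => h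
  have hc' := hc.frame hF rfl rfl
  refine wp_setNum fun a ha => ?_
  have e : s'.int 22 0 = i := by rw [hF.int 22 rfl, hi]
  simp only [Store.num_writeNum, if_true, eval_iv, hv, NumExp.eval, IntExp.eval, e,
    hc'.mul i him, hc'.p i him k hk]
  rcases Nat.lt_succ_iff_lt_or_eq.1 ha with h | rfl
  · rw [Function.update_of_ne h.ne, hI a h]
  · simp

theorem wp_cls (hc : Ctx P p W s) (hr : HasRow P p i s) (hB : P.n ≤ B) (hB' : P.K ≤ B) :
    wp clsProg B s (HasCls P p i P.n) := by
  refine wp_for (HasCls P p i) hc.n hB rfl rfl (fun _ _ _ h => h)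
    (fun a ha => absurd ha (by omega)) (fun k hk s' hF hv hI => ?_) fun s' _ h => h
  have hc' := hc.frame hF rfl rfl
  refine wp_seq (wp_setInt (wp_for (fun j s'' => s''.int 15 =
    Function.update (s'.int 15) k (Nat.count (fun l => p i k < P.ρ ^ l) j)) (N := P.K) ?_ hB'
    rfl rfl (fun _ _ _ h => h) ?_ (fun j hj s₂ hF₂ hv₂ hI₂ => ?_) fun s₂ hF₂ h => ?_))
  · simpa using hc'.K
  · simp [hv]; rfl
  · have e1 : s₂.int 23 0 = k := by rw [hF₂.int 23 rfl]; simpa using hv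
    have e2 : s₂.num 2 k = p i k := by rw [hF₂.num 2 rfl]; simpa [hF.num 2 rfl] using hr k hk
    have e3 : s₂.num 1 j = P.ρ ^ j := by
      rw [hF₂.num 1 rfl]; simpa using hc'.s j (by simp only [Par.Q]; omega)
    refine wp_ite (fun h => wp_setInt ?_) fun h => wp_skip ?_
    · simp only [Test.Holds, NumExp.eval, eval_iv, e1, hv₂, e2, e3] at h
      simp [e1, hI₂, IntExp.eval, Nat.count_succ, h]
    · simp only [Test.Holds, NumExp.eval, eval_iv, e1, hv₂, e2, e3] at h
      simp [hI₂, Nat.count_succ, h]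
  · intro a ha
    rw [h]
    rcases Nat.lt_succ_iff_lt_or_eq.1 ha with h | rfl
    · rw [Function.update_of_ne h.ne, hI a h]
    · simp [Par.cls]

theorem wp_group {a : ℕ} (hD : 0 < P.D) (hr : HasCls P p i P.n s) (ha : s.int 23 0 = a)
    (han : a < P.n) (hB : P.n ≤ B) :
    wp (groupProg P.D) B s fun s' => s'.int 19 0 = P.group (p i) a := by
  refine wp_seq (wp_setInt (wp_for (fun j s'' => s''.int 19 0 =
    Nat.count (fun b => P.cls (p i b) = P.cls (p i a)) j % P.D) (N := a) (by simpa using ha)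
    (by omega) rfl rfl (fun _ _ _ h => h) (by simp [IntExp.eval]) (fun j hj s₂ hF₂ hv₂ hI₂ => ?_)
    fun s₂ hF₂ h => h))
  have e1 : s₂.int 23 0 = a := by rw [hF₂.int 23 rfl]; simpa using ha
  have e2 : ∀ b < P.n, s₂.int 15 b = P.cls (p i b) := by
    rw [hF₂.int 15 rfl]; exact hr
  refine wp_whenEq (fun h => wp_seq (wp_setInt (wp_ite (fun h' => wp_setInt ?_) fun h' => wp_skip ?_)))
    fun h => ?_
  all_goals simp only [IntExp.eval, eval_iv, e1, hv₂, e2 a han, e2 j (by omega)] at h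
  · simp [Test.Holds, IntExp.eval, hI₂] at h'
    have := Nat.mod_lt (Nat.count (fun b => P.cls (p i b) = P.cls (p i a)) j) hD
    simp only [Store.int_writeInt, if_true, IntExp.eval, Function.update_self, Nat.count_succ, h]
    rw [← Nat.mod_add_mod, show Nat.count (fun b => P.cls (p i b) = P.cls (p i a)) j % P.D + 1 = P.D
      by omega, Nat.mod_self]
  · simp [Test.Holds, IntExp.eval, hI₂] at h'
    simp only [Store.int_writeInt, if_true, IntExp.eval, Function.update_self, Nat.count_succ, h,
      eval_iv, hI₂]
    rw [← Nat.mod_add_mod, Nat.mod_eq_of_lt h']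
  · simp only [hI₂, Nat.count_succ, h, if_false, add_zero]

theorem wp_used {a c b : ℕ} (hc : Ctx P p W s) (hadv : ∀ b, s.int 13 b = adv b)
    (hadvB : ∀ b, adv b ≤ B) (ha : s.int 23 0 = a) (h15 : s.int 15 a = c) (h16 : s.int 16 a = b)
    (hcK : c ≤ P.K) (hB : P.U ≤ B) :
    wp usedProg B s fun s' => s'.num 14 0 = s.num 2 a - P.used adv c b := by
  refine wp_seq (wp_setNum (wp_for (fun u s'' => s''.num 14 0 = s.num 2 a -
    ∑ v ∈ Finset.range u, (adv (b + v) : ℝ) * P.ρ ^ (c + v)) (N := P.U) (by simpa using hc.U)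
    hB rfl rfl (fun _ _ _ h => h) (by simp [ha, NumExp.eval, IntExp.eval])
    (fun u hu s₂ hF₂ hv₂ hI₂ => ?_)
    fun s₂ hF₂ h => h))
  have e1 : s₂.int 23 0 = a := by rw [hF₂.int 23 rfl]; simpa using ha
  have e2 : s₂.int 16 a = b := by rw [hF₂.int 16 rfl]; simpa using h16
  have e3 : s₂.int 15 a = c := by rw [hF₂.int 15 rfl]; simpa using h15
  have e4 : s₂.int 13 (b + u) = adv (b + u) := by rw [hF₂.int 13 rfl]; simpa using hadv (b + u)
  have e5 : s₂.num 1 (c + u) = P.ρ ^ (c + u) := by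
    rw [hF₂.num 1 rfl]; simpa using hc.s (c + u) (by simp only [Par.Q]; omega)
  refine wp_seq (wp_setInt (wp_for (fun j s₃ => s₃.num 14 0 = s₂.num 14 0 - j * P.ρ ^ (c + u))
    (N := adv (b + u)) ?_ (hadvB _) rfl rfl (fun _ _ _ h => h) (by simp)
    (fun j hj s₃ hF₃ hv₃ hI₃ => ?_)
    fun s₃ hF₃ h => ?_))
  · simp [IntExp.eval, e1, e2, hv₂, e4]
  · refine wp_setNum ?_
    have f1 : s₃.int 23 0 = a := by rw [hF₃.int 23 rfl]; simpa using e1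
    have f2 : s₃.int 25 0 = u := by rw [hF₃.int 25 rfl]; simpa using hv₂
    have f3 : s₃.int 15 a = c := by rw [hF₃.int 15 rfl]; simpa using e3
    have f4 : s₃.num 1 (c + u) = P.ρ ^ (c + u) := by rw [hF₃.num 1 rfl]; simpa using e5
    simp only [Store.num_writeNum, if_true, IntExp.eval, Function.update_self, NumExp.eval, eval_nv,
      eval_iv, f1, f2, f3, f4, hI₃]
    push_cast; ring
  · rw [h, hI₂, Finset.sum_range_succ]; ring

theorem wp_ent {a : ℕ} (hc : Ctx P p W s) (hadv : ∀ b, s.int 13 b = adv b)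
    (ha : s.int 23 0 = a) (h15 : s.int 15 a = P.cls (p i a)) (h2 : s.num 2 a = p i a)
    (h16 : s.int 16 a = P.place i (p i) a)
    (h14 : s.num 14 0 = p i a - P.used adv (P.cls (p i a)) (P.place i (p i) a)) :
    wp entProg B s fun s' => s'.int 16 = Function.update (s.int 16) a (P.blk adv i (p i) a) ∧
      s'.int 17 = Function.update (s.int 17) a (P.ent adv i (p i) a) ∧
      s'.num 3 = Function.update (s.num 3) a (P.rem adv i (p i) a) := by
  refine wp_seq (wp.mono (Q := fun s' => s'.int 16 = Function.update (s.int 16) a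
    (P.blk adv i (p i) a) ∧ s'.num 3 = Function.update (s.num 3) a (P.rem adv i (p i) a)) ?_ ?_)
  · refine wp_ite (fun h => wp_setNum ?_) fun h => wp_seq (wp_setNum (wp_setInt ?_))
    all_goals simp [Test.Holds, NumExp.eval, h14] at h
    · rw [← sub_nonneg] at h
      rw [Par.blk, Par.rem, if_pos h, if_pos h]
      simp [ha, h14, ← h16]
    · rw [← sub_neg, ← not_le] at h
      rw [Par.blk, Par.rem, if_neg h, if_neg h]
      simp [ha, NumExp.eval, h2, hc.len]
  · rintro s' hF ⟨h1, h3⟩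
    have e1 : s'.int 23 0 = a := by rw [hF.int 23 rfl, ha]
    have e2 : s'.int 13 = s.int 13 := hF.int 13 rfl
    have e3 : s'.int 11 0 = P.U := by rw [hF.int 11 rfl, hc.U]
    have e4 : s'.int 15 a = P.cls (p i a) := by rw [hF.int 15 rfl, h15]
    have e5 : s'.int 17 = s.int 17 := hF.int 17 rfl
    refine wp_ite (fun h => wp_setInt ?_) fun h => wp_setInt ?_
    all_goals
      simp only [Test.Holds, IntExp.eval, eval_iv, e1, h1, Function.update_self, e2, e3, hadv] at h
      simp [h1, h3, IntExp.eval, e1, e4, e3, e5, Par.ent, h]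

theorem wp_rem (hc : Ctx P p W s) (hD : 0 < P.D) (hadv : ∀ b, s.int 13 b = adv b)
    (hadvB : ∀ b, adv b ≤ B) (hi : s.int 22 0 = i) (hr : HasRow P p i s)
    (hcl : HasCls P p i P.n s) (hB : P.n ≤ B) (hB' : P.U ≤ B) :
    wp (remProg P.m P.D P.U) B s (HasRem P p adv i P.n) := by
  refine wp_for (HasRem P p adv i) hc.n hB rfl rfl (fun _ _ _ h => h)
    (fun a ha => absurd ha (by omega)) (fun a ha s' hF hv hI => ?_) fun s' _ h => h
  have hc' := hc.frame hF rfl rfl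
  have hcl' : HasCls P p i P.n s' := fun b hb => by rw [hF.int 15 rfl]; exact hcl b hb
  refine wp_seq ((wp_group hD hcl' hv ha hB).mono fun s₁ hF₁ h19 => wp_seq (wp_setInt (wp_seq ?_)))
  have a1 : s₁.int 23 0 = a := by rw [hF₁.int 23 rfl, hv]
  have a2 : s₁.int 15 a = P.cls (p i a) := by rw [hF₁.int 15 rfl, hcl' a ha]
  have a3 : s₁.int 22 0 = i := by rw [hF₁.int 22 rfl, hF.int 22 rfl, hi]
  have a4 : (P.U + 1) * (P.D * (P.m * P.cls (p i a) + i) + P.group (p i) a) = P.place i (p i) a := by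
    rw [Par.place, Par.idx]; ring
  have hc₁ := hc'.frame hF₁ rfl rfl
  have a5 : s₁.num 2 a = p i a := by rw [hF₁.num 2 rfl, hF.num 2 rfl, hr a ha]
  have a6 : ∀ b, s₁.int 13 b = adv b := by rw [hF₁.int 13 rfl, hF.int 13 rfl]; exact hadv
  simp only [IntExp.eval, eval_mulc, eval_iv, a1, a2, a3, h19, a4]
  have hc₂ : Ctx P p W (s₁.writeInt 16 a (P.place i (p i) a)) :=
    ⟨hc₁.n, hc₁.m, hc₁.mul, hc₁.pow, hc₁.K, hc₁.Q, hc₁.len, hc₁.W, hc₁.states, hc₁.U, hc₁.p, hc₁.s⟩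
  refine (wp_used (a := a) (c := P.cls (p i a)) (b := P.place i (p i) a) hc₂ a6 hadvB a1 a2
    (by simp) (P.cls_le _) hB').mono fun s₂ hF₂ h14 => ?_
  refine (wp_ent (a := a) (i := i) (p := p) (adv := adv) (hc₂.frame hF₂ rfl rfl) (fun b => ?_) ?_ ?_ ?_ ?_ ?_).mono
    fun s₃ hF₃ h => ?_
  · rw [hF₂.int 13 rfl]; exact a6 b
  · rw [hF₂.int 23 rfl]; exact a1
  · rw [hF₂.int 15 rfl]; exact a2
  · rw [hF₂.num 2 rfl]; exact a5
  · rw [hF₂.int 16 rfl]; simp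
  · rw [h14]; exact congrArg₂ _ a5 rfl
  · intro b hb
    rw [h.1, h.2.1, h.2.2]
    rcases Nat.lt_succ_iff_lt_or_eq.1 hb with hb | rfl
    · have b1 : s₂.int 16 b = s'.int 16 b := by
        rw [hF₂.int 16 rfl, ← hF₁.int 16 rfl]; simp [hb.ne]
      have b2 : s₂.int 17 b = s'.int 17 b := by
        rw [hF₂.int 17 rfl, ← hF₁.int 17 rfl]; simp
      have b3 : s₂.num 3 b = s'.num 3 b := by
        rw [hF₂.num 3 rfl, ← hF₁.num 3 rfl]; simp
      simp only [Function.update_of_ne hb.ne, b1, b2, b3]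
      exact hI b hb
    · simp

/-- The tables of the marginal `i` have been computed. -/
structure HasTables (P : Par) (p : ℕ → ℕ → ℝ) (adv : ℕ → ℕ) (i : ℕ) (s : Store) : Prop where
  cls : HasCls P p i P.n s
  rem : HasRem P p adv i P.n s

theorem wp_row (hc : Ctx P p W s) (hD : 0 < P.D) (hadv : ∀ b, s.int 13 b = adv b)
    (hadvB : ∀ b, adv b ≤ B) (hi : s.int 22 0 = i) (him : i < P.m) (hB : P.n ≤ B) (hB' : P.Q ≤ B) :
    wp (rowProg P.m P.D P.U) B s (HasTables P p adv i) := by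
  have hQ : P.K ≤ B ∧ P.U ≤ B := by simp only [Par.Q] at hB'; omega
  refine wp_seq ((wp_load hc hi him hB).mono fun s₁ hF₁ hr => wp_seq ?_)
  have hc₁ := hc.frame hF₁ rfl rfl
  refine (wp_cls hc₁ hr hB hQ.1).mono fun s₂ hF₂ hcl => ?_
  refine (wp_rem (hc₁.frame hF₂ rfl rfl) hD (fun b => ?_) hadvB ?_ ?_ hcl hB hQ.2).mono
    fun s₃ hF₃ h => ⟨fun a ha => ?_, h⟩
  · rw [hF₂.int 13 rfl, hF₁.int 13 rfl, hadv]
  · rw [hF₂.int 22 rfl, hF₁.int 22 rfl, hi]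
  · intro a ha; rw [hF₂.num 2 rfl, hr a ha]
  · rw [hF₃.int 15 rfl, hcl a ha]

end

/-! ### The number of pieces -/

/-- Store in the integer scalar `19` how many pieces of class `k` are cut from the state `a`. -/
def pcProg : Prog :=
  .ite (.intLE (.get 15 (iv 23)) (iv 24))
    (.ite (.intLT (iv 24) (.add (.get 15 (iv 23)) (iv 11)))
      (.setInt 19 (.const 0) (.get 13 (.add (.get 16 (iv 23)) (.sub (iv 24) (.get 15 (iv 23))))))
      (.setInt 19 (.const 0) (.const 0)))
    (.setInt 19 (.const 0) (.const 0))

def piecesProg : Prog :=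
  .seq (.setInt 20 (.const 0) (.const 0))
    (forLoop 23 0 (.seq pcProg (.setInt 20 (.const 0) (.add (iv 20) (iv 19)))))

/-- Updates a running maximum over the marginals, so the tables of only one marginal have to be kept
at a time. -/
def maxProg : Prog :=
  forLoop 24 7 (.seq piecesProg
    (.ite (.intLT (.get 14 (iv 24)) (iv 20)) (.setInt 14 (iv 24) (iv 20)) .skip))

/-- Compute the number of pieces of every class on the line. -/
def nkProg (m D U : ℕ) : Prog :=
  .seq (forLoop 24 7 (.setInt 14 (iv 24) (.const 0)))
    (forLoop 22 1 (.seq (rowProg m D U) maxProg))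

/-- The memory holds the advice and the tables of the marginal `i`, except for the pool. -/
structure Tables (P : Par) (p : ℕ → ℕ → ℝ) (adv : ℕ → ℕ) (W i : ℕ) (s : Store) : Prop where
  ctx : Ctx P p W s
  digits : ∀ b, s.int 13 b = adv b
  cls : ∀ a < P.n, s.int 15 a = P.cls (p i a)
  blk : ∀ a < P.n, s.int 16 a = P.blk adv i (p i) a
  ent : ∀ a < P.n, s.int 17 a = P.ent adv i (p i) a

theorem Tables.frame {P : Par} {p : ℕ → ℕ → ℝ} {adv : ℕ → ℕ} {W i : ℕ} {s s' : Store} {R : Prog}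
    (h : Tables P p adv W i s) (hF : Frame R s s')
    (hi : ((List.range 12).all fun a => !R.ints a) = true)
    (hi' : (([13, 15, 16, 17] : List ℕ).all fun a => !R.ints a) = true)
    (hn : ((List.range 2).all fun a => !R.nums a) = true) : Tables P p adv W i s' := by
  have e : ∀ a ∈ ([13, 15, 16, 17] : List ℕ), s'.int a = s.int a := fun a ha =>
    hF.int a (by simpa using List.all_eq_true.1 hi' a ha)
  constructor
  · exact h.ctx.frame hF hi hn
  · rw [e 13 (by simp)]; exact h.digits
  · rw [e 15 (by simp)]; exact h.cls
  · rw [e 16 (by simp)]; exact h.blk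
  · rw [e 17 (by simp)]; exact h.ent

section
variable {P : Par} {p : ℕ → ℕ → ℝ} {W B : ℕ} {s : Store} {adv : ℕ → ℕ} {i : ℕ}

theorem wp_pc {a k : ℕ} (ht : Tables P p adv W i s) (ha : s.int 23 0 = a) (han : a < P.n)
    (hk : s.int 24 0 = k) :
    wp pcProg B s fun s' => s'.int 19 0 = P.pc adv i (p i) a k := by
  refine wp_ite (fun h => wp_ite (fun h' => wp_setInt ?_) fun h' => wp_setInt ?_) fun h => wp_setInt ?_
  all_goals simp only [Test.Holds, IntExp.eval, eval_iv, ha, hk, ht.cls a han] at h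
  · simp only [Test.Holds, IntExp.eval, eval_iv, ha, hk, ht.cls a han, ht.ctx.U] at h'
    simp [Par.pc, h, h', IntExp.eval, ha, hk, ht.cls a han, ht.blk a han, ht.digits]
  · simp only [Test.Holds, IntExp.eval, eval_iv, ha, hk, ht.cls a han, ht.ctx.U] at h'
    simp [Par.pc, h', IntExp.eval]
  · simp [Par.pc, h, IntExp.eval]

theorem wp_pieces {k : ℕ} (ht : Tables P p adv W i s) (hk : s.int 24 0 = k) (hB : P.n ≤ B) :
    wp piecesProg B s fun s' => s'.int 20 0 = P.pieces adv i (p i) k := by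
  refine wp_seq (wp_setInt (wp_for (fun j s'' => s''.int 20 0 =
    ∑ a ∈ Finset.range j, P.pc adv i (p i) a k) (N := P.n) ht.ctx.n
    hB rfl rfl (fun _ _ _ h => h) (by simp [IntExp.eval]) (fun j hj s₁ hF₁ hv₁ hI₁ => ?_)
    fun s₁ hF₁ h => h))
  have ht₁ : Tables P p adv W i s₁ :=
    Tables.frame (s := s.writeInt 20 0 0) ⟨⟨ht.ctx.n, ht.ctx.m, ht.ctx.mul, ht.ctx.pow, ht.ctx.K,
      ht.ctx.Q, ht.ctx.len, ht.ctx.W, ht.ctx.states, ht.ctx.U, ht.ctx.p, ht.ctx.s⟩, ht.digits, ht.cls,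
      ht.blk, ht.ent⟩ hF₁ rfl rfl rfl
  have hk₁ : s₁.int 24 0 = k := by rw [hF₁.int 24 rfl]; simpa using hk
  refine wp_seq ((wp_pc ht₁ hv₁ hj hk₁).mono fun s₂ hF₂ h => wp_setInt ?_)
  simp only [Store.int_writeInt, if_true, IntExp.eval, Function.update_self, eval_iv, h,
    hF₂.int 20 rfl, hI₁, Finset.sum_range_succ]

theorem wp_max (ht : Tables P p adv W i s) (hnk : ∀ k < P.Q, s.int 14 k =
      (Finset.range i).sup fun i => P.pieces adv i (p i) k) (hB : P.n ≤ B) (hQ : P.Q ≤ B) :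
    wp maxProg B s fun s' => ∀ k < P.Q, s'.int 14 k =
      (Finset.range (i + 1)).sup fun i => P.pieces adv i (p i) k := by
  refine wp_for (fun j s' => (∀ k < j, s'.int 14 k =
      (Finset.range (i + 1)).sup fun i => P.pieces adv i (p i) k) ∧ ∀ k < P.Q, j ≤ k →
      s'.int 14 k = (Finset.range i).sup fun i => P.pieces adv i (p i) k) ht.ctx.Q hQ rfl rfl
    (fun _ _ _ h => h) ⟨fun k hk => absurd hk (by omega), fun k hk _ => hnk k hk⟩
    (fun j hj s₁ hF₁ hv₁ hI₁ => ?_) fun s' _ h => h.1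
  have ht₁ := ht.frame hF₁ rfl rfl rfl
  refine wp_seq ((wp_pieces ht₁ hv₁ hB).mono fun s₂ hF₂ h20 => ?_)
  have hv₂ : s₂.int 24 0 = j := by rw [hF₂.int 24 rfl, hv₁]
  have e : s₂.int 14 = s₁.int 14 := hF₂.int 14 rfl
  have ej := hI₁.2 j hj le_rfl
  have e3 : (Finset.range (i + 1)).sup (fun i => P.pieces adv i (p i) j) =
      max (P.pieces adv i (p i) j) ((Finset.range i).sup fun i => P.pieces adv i (p i) j) := by
    rw [Finset.range_add_one, Finset.sup_insert]
  refine wp_ite (fun h => wp_setInt ⟨fun k hk => ?_, fun k hk hk' => ?_⟩)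
    fun h => wp_skip ⟨fun k hk => ?_, fun k hk hk' => ?_⟩
  all_goals simp only [Test.Holds, IntExp.eval, eval_iv, hv₂, e, ej, h20] at h
  · rcases Nat.lt_succ_iff_lt_or_eq.1 hk with hk | rfl
    · simp [hv₂, e, hk.ne, hI₁.1 k hk]
    · simp only [hv₂, e, Store.int_writeInt, if_true, eval_iv, h20, Function.update_self, e3]
      exact (max_eq_left h.le).symm
  · have : k ≠ j := by omega
    simp [hv₂, e, this, hI₁.2 k hk (by omega)]
  · rw [e]
    rcases Nat.lt_succ_iff_lt_or_eq.1 hk with hk | rfl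
    · exact hI₁.1 k hk
    · rw [ej, e3, max_eq_right (not_lt.1 h)]
  · rw [e]; exact hI₁.2 k hk (by omega)

theorem wp_nk (hc : Ctx P p W s) (hD : 0 < P.D) (hadv : ∀ b, s.int 13 b = adv b)
    (hadvB : ∀ b, adv b ≤ B) (hm : P.m ≤ B) (hB : P.n ≤ B) (hB' : P.Q ≤ B) :
    wp (nkProg P.m P.D P.U) B s fun s' => ∀ k < P.Q, s'.int 14 k = P.nk adv p k := by
  refine wp_seq (wp_for (fun j s' => ∀ k < j, s'.int 14 k = 0) hc.Q hB' rfl rfl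
    (fun _ _ _ h => h) (fun k hk => absurd hk (by omega)) (fun j hj s₁ hF₁ hv₁ hI₁ => wp_setInt ?_)
    fun s₁ hF₁ h14 => ?_)
  · intro k hk
    rcases Nat.lt_succ_iff_lt_or_eq.1 hk with hk | rfl
    · simp [hv₁, hk.ne, hI₁ k hk]
    · simp [hv₁, IntExp.eval]
  have hc₁ := hc.frame hF₁ rfl rfl
  refine wp_for (fun i s' => ∀ k < P.Q, s'.int 14 k =
      (Finset.range i).sup fun i => P.pieces adv i (p i) k) hc₁.m hm rfl rfl
    (fun _ _ _ h => h) (fun k hk => by simpa using h14 k hk) (fun i hi s₂ hF₂ hv₂ hI₂ => ?_)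
    fun s' _ h => h
  have hc₂ := hc₁.frame hF₂ rfl rfl
  have hadv₂ : ∀ b, s₂.int 13 b = adv b := by rw [hF₂.int 13 rfl, hF₁.int 13 rfl]; exact hadv
  refine wp_seq ((wp_row hc₂ hD hadv₂ hadvB hv₂ hi hB hB').mono fun s₃ hF₃ h => ?_)
  refine wp_max (i := i) ⟨hc₂.frame hF₃ rfl rfl, fun b => ?_, h.cls, fun a ha => (h.rem a ha).1,
    fun a ha => (h.rem a ha).2.1⟩ ?_ hB hB'
  · rw [hF₃.int 13 rfl, hadv₂]
  · rw [hF₃.int 14 rfl]; exact hI₂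

end

/-! ### The fragments of one marginal -/

/-- Three arrays hold the labels, starting points and end points of the list `l`. -/
def Holds (lab : ℕ → ℕ) (st en : ℕ → ℝ) (l : List (ℕ × ℝ × ℝ)) : Prop :=
  ∀ (j : ℕ) (g : ℕ × ℝ × ℝ), l[j]? = some g → lab j = g.1 ∧ st j = g.2.1 ∧ en j = g.2.2

theorem Holds.append {lab : ℕ → ℕ} {st en : ℕ → ℝ} {l : List (ℕ × ℝ × ℝ)} (h : Holds lab st en l)
    (g : ℕ × ℝ × ℝ) : Holds (Function.update lab l.length g.1) (Function.update st l.length g.2.1)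
      (Function.update en l.length g.2.2) (l ++ [g]) := by
  intro j g' hj
  rcases lt_trichotomy j l.length with h1 | rfl | h1
  · rw [List.getElem?_append_left h1] at hj
    simpa [h1.ne] using h j g' hj
  · simp at hj
    simp [hj]
  · rw [List.getElem?_eq_none (by simp; omega)] at hj
    simp at hj

/-- The integer scalar `27` holds the number of fragments in `L`, the number scalar `13` their total
length, the integer array `28` and the number arrays `4` and `5` hold their labels and end points. -/
structure HasFrags (L : List (ℕ × ℝ)) (s : Store) : Prop where
  length : s.int 27 0 = L.length
  total : s.num 13 0 = total L
  holds : Holds (s.int 28) (s.num 4) (s.num 5) (spans 0 L)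

theorem HasFrags.frame {L : List (ℕ × ℝ)} {s s' : Store} {R : Prog} (h : HasFrags L s)
    (hF : Frame R s s') (hi : (!R.ints 27 && !R.ints 28) = true)
    (hn : (!R.nums 13 && !R.nums 4 && !R.nums 5) = true) : HasFrags L s' := by
  simp only [Bool.and_eq_true, Bool.not_eq_eq_eq_not, Bool.not_true] at hi hn
  constructor
  · rw [hF.int 27 hi.1]; exact h.length
  · rw [hF.num 13 hn.1.1]; exact h.total
  · rw [hF.int 28 hi.2, hF.num 4 hn.1.2, hF.num 5 hn.2]; exact h.holds

/-- Append a fragment with the label `e`; its length is the number scalar `14`. -/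
def pushProg (e : IntExp) : Prog :=
  .seq (.setInt 28 (iv 27) e) (.seq (.setNum 4 (iv 27) (nv 13))
    (.seq (.setNum 13 (.const 0) (.add (nv 13) (nv 14)))
      (.seq (.setNum 5 (iv 27) (nv 13)) (.setInt 27 (.const 0) (.add (iv 27) (.const 1))))))

/-- Besides pushing the pieces, the scalar `20` counts them; the next step subtracts this count from
the common number of pieces. -/
def cutProg : Prog :=
  .seq (.setInt 20 (.const 0) (.const 0)) (forLoop 23 0 (.seq pcProg
    (.seq (.setInt 20 (.const 0) (.add (iv 20) (iv 19)))
      (forLoop 26 19 (.seq (.setNum 14 (.const 0) (.get 1 (iv 24))) (pushProg (iv 23)))))))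

def needProg : Prog :=
  .seq (.setInt 19 (.const 0) (.sub (.get 14 (iv 24)) (iv 20))) (.seq (.setNum 12 (.const 0) (.const 0))
    (forLoop 26 19 (.setNum 12 (.const 0) (.add (nv 12) (.get 1 (iv 24))))))

def serveProg : Prog :=
  .seq (.ite (.numLE (.get 3 (iv 23)) (nv 12)) (.setNum 14 (.const 0) (.get 3 (iv 23)))
      (.setNum 14 (.const 0) (nv 12)))
    (.seq (pushProg (iv 23)) (.seq (.setNum 3 (iv 23) (.sub (.get 3 (iv 23)) (nv 14)))
      (.setNum 12 (.const 0) (.sub (nv 12) (nv 14)))))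

/-- The offset `r` runs up from `0`, so entry classes run down from `k`. The test `ent a + r = k`
avoids a truncated subtraction; as `r ≤ k`, it is equivalent to the condition in `order`. -/
def fillProg : Prog :=
  .seq (.setInt 20 (.const 0) (.add (iv 24) (.const 1)))
    (forLoop 25 20 (forLoop 23 0 (whenEq (.add (.get 17 (iv 23)) (iv 25)) (iv 24) serveProg)))

def restProg : Prog :=
  forLoop 24 7 (forLoop 23 0 (whenEq (.get 17 (iv 23)) (iv 24)
    (.seq (.setNum 14 (.const 0) (.get 3 (iv 23))) (pushProg (iv 23)))))

/-- Compute the fragments of the marginal whose number is the integer scalar `22`. -/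
def fragsProg (m D U : ℕ) : Prog :=
  .seq (rowProg m D U) (.seq (.setInt 27 (.const 0) (.const 0)) (.seq (.setNum 13 (.const 0) (.const 0))
    (.seq (forLoop 24 7 (.seq cutProg (.seq needProg fillProg))) restProg)))

section
variable {P : Par} {p : ℕ → ℕ → ℝ} {W B : ℕ} {s : Store} {adv : ℕ → ℕ} {i : ℕ} {L : List (ℕ × ℝ)}

/-- A new fragment starts at the old total length and ends at the new one, so the scalar `13` is
copied before and after the addition. -/
theorem wp_push {e : IntExp} {a : ℕ} {x : ℝ} (h : HasFrags L s) (he : e.eval s = a)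
    (hx : s.num 14 0 = x) : wp (pushProg e) B s (HasFrags (L ++ [(a, x)])) := by
  refine wp_seq (wp_setInt (wp_seq (wp_setNum (wp_seq (wp_setNum (wp_seq (wp_setNum (wp_setInt
    ⟨?_, ?_, ?_⟩))))))))
  · simp [IntExp.eval, h.length]
  · simp [NumExp.eval, IntExp.eval, h.total, hx]
  · have := h.holds.append (a, total L, total L + x)
    rw [length_spans] at this
    rw [spans_append]
    simpa [NumExp.eval, IntExp.eval, h.total, hx, he, h.length, spans] using this

theorem Tables.writeInt (h : Tables P p adv W i s) {b : ℕ} (hb : 18 ≤ b ∨ b = 14) (j v : ℕ) :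
    Tables P p adv W i (s.writeInt b j v) := by
  have hi : ∀ a, a < 12 ∨ a ∈ ([13, 15, 16, 17] : List ℕ) → (s.writeInt b j v).int a = s.int a := by
    intro a ha
    have : a ≠ b := by
      simp only [List.mem_cons, List.not_mem_nil, or_false] at ha; omega
    simp [this]
  constructor
  · constructor <;> simp only [Store.num_writeInt, hi 0 (by simp), hi 1 (by simp), hi 2 (by simp),
      hi 3 (by simp), hi 6 (by simp), hi 7 (by simp), hi 8 (by simp), hi 9 (by simp),
      hi 10 (by simp), hi 11 (by simp)]
    exacts [h.ctx.n, h.ctx.m, h.ctx.mul, h.ctx.pow, h.ctx.K, h.ctx.Q, h.ctx.len, h.ctx.W,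
      h.ctx.states, h.ctx.U, h.ctx.p, h.ctx.s]
  · rw [hi 13 (by simp)]; exact h.digits
  · rw [hi 15 (by simp)]; exact h.cls
  · rw [hi 16 (by simp)]; exact h.blk
  · rw [hi 17 (by simp)]; exact h.ent

theorem wp_cut {k : ℕ} (ht : Tables P p adv W i s) (hf : HasFrags L s) (hk : s.int 24 0 = k)
    (hkQ : k < P.Q) (hadvB : ∀ b, adv b ≤ B) (hB : P.n ≤ B) :
    wp cutProg B s fun s' => HasFrags (L ++ (P.line adv p i).cut k) s' ∧
      s'.int 20 0 = P.pieces adv i (p i) k := by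
  refine wp_seq (wp_setInt (wp_for (fun j s' => HasFrags (L ++ (List.range j).flatMap fun a =>
    List.replicate (P.pc adv i (p i) a k) (a, P.ρ ^ k)) s' ∧ s'.int 20 0 =
    ∑ a ∈ Finset.range j, P.pc adv i (p i) a k) (N := P.n) ht.ctx.n
    hB rfl rfl (fun _ _ _ h => ⟨⟨h.1.1, h.1.2, h.1.3⟩, h.2⟩) ?_ (fun j hj s₁ hF₁ hv₁ hI₁ => ?_)
    fun s₁ hF₁ h => h))
  · simpa [IntExp.eval] using (⟨hf.1, hf.2, hf.3⟩ : HasFrags L (s.writeInt 20 0 0))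
  have ht₁ := (ht.writeInt (b := 20) (by simp) 0 0).frame hF₁ rfl rfl rfl
  have hk₁ : s₁.int 24 0 = k := by rw [hF₁.int 24 rfl]; simpa using hk
  refine wp_seq ((wp_pc ht₁ hv₁ hj hk₁).mono fun s₂ hF₂ h19 => wp_seq (wp_setInt ?_))
  have hf₂ := hI₁.1.frame hF₂ rfl rfl
  refine wp_for (fun r s' => HasFrags ((L ++ (List.range j).flatMap fun a =>
    List.replicate (P.pc adv i (p i) a k) (a, P.ρ ^ k)) ++ List.replicate r (j, P.ρ ^ k)) s')
    (N := P.pc adv i (p i) j k) (by simpa using h19) ?_ rfl rfl (fun _ _ _ h => ⟨h.1, h.2, h.3⟩) ?_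
    (fun r hr s₃ hF₃ hv₃ hI₃ => wp_seq (wp_setNum ?_)) fun s₃ hF₃ h => ⟨?_, ?_⟩
  · rw [Par.pc]; split_ifs <;> first | exact hadvB _ | exact Nat.zero_le _
  · simpa using (⟨hf₂.1, hf₂.2, hf₂.3⟩ : HasFrags _ (s₂.writeInt 20 (IntExp.eval s₂ (.const 0)) _))
  · rw [List.replicate_succ', ← List.append_assoc]
    have e1 : s₃.int 24 0 = k := by rw [hF₃.int 24 rfl]; simpa [hF₂.int 24 rfl] using hk₁
    have e2 : s₃.int 23 0 = j := by rw [hF₃.int 23 rfl]; simpa [hF₂.int 23 rfl] using hv₁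
    have e3 : s₃.num 1 k = P.ρ ^ k := by
      rw [hF₃.num 1 rfl]; simpa [hF₂.num 1 rfl] using ht₁.ctx.s k hkQ
    refine wp_push (L := _) (s := s₃.writeNum 14 _ _) ⟨hI₃.1, hI₃.2, hI₃.3⟩ e2 ?_
    simp [NumExp.eval, e1, e3, IntExp.eval]
  · rw [List.range_succ, List.flatMap_append]
    simpa [List.append_assoc] using h
  · rw [hF₃.int 20 rfl, Finset.sum_range_succ, ← hI₁.2, ← hF₂.int 20 rfl, ← h19]
    simp [IntExp.eval]

theorem wp_need {k : ℕ} (ht : Tables P p adv W i s) (hnk : ∀ k < P.Q, s.int 14 k = P.nk adv p k)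
    (hk : s.int 24 0 = k) (hkQ : k < P.Q) (h20 : s.int 20 0 = P.pieces adv i (p i) k)
    (hB : ∀ k, P.nk adv p k ≤ B) :
    wp needProg B s fun s' => s'.num 12 0 = (P.line adv p i).need k := by
  refine wp_seq (wp_setInt (wp_seq (wp_setNum (wp_for (fun j s' => s'.num 12 0 = (j : ℝ) * P.ρ ^ k)
    (N := P.nk adv p k - P.pieces adv i (p i) k) ?_ ((Nat.sub_le _ _).trans (hB k)) rfl rfl
    (fun _ _ _ h => h) (by simp [NumExp.eval, IntExp.eval]) (fun j hj s₁ hF₁ hv₁ hI₁ => wp_setNum ?_)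
    fun s₁ hF₁ h => h))))
  · simp [IntExp.eval, hk, h20, hnk k hkQ]
  · have e1 : s₁.int 24 0 = k := by rw [hF₁.int 24 rfl]; simpa using hk
    have e3 : s₁.num 1 k = P.ρ ^ k := by rw [hF₁.num 1 rfl]; simpa using ht.ctx.s k hkQ
    simp only [NumExp.eval, IntExp.eval, Store.num_writeNum, if_true, Function.update_self, eval_nv,
      eval_iv, hI₁, e1, e3]
    push_cast; ring

/-- The demand `x` has been served from the states in `l`. -/
structure Served (n : ℕ) (L : List (ℕ × ℝ)) (r : ℕ → ℝ) (x : ℝ) (l : List ℕ) (s : Store) : Prop where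
  frags : HasFrags (L ++ fill r x l) s
  pool : ∀ a < n, s.num 3 a = drain r x l a
  need : s.num 12 0 = x - total (fill r x l)

theorem wp_serve {n : ℕ} {r : ℕ → ℝ} {x : ℝ} {l : List ℕ} {a : ℕ} (h : Served n L r x l s)
    (ha : s.int 23 0 = a) (han : a < n) : wp serveProg B s (Served n L r x (l ++ [a])) := by
  refine wp_seq (wp.mono (Q := fun s' => s'.num 14 0 = min (drain r x l a) (x - total (fill r x l))) ?_
    fun s₁ hF₁ h14 => wp_seq ?_)
  · refine wp_ite (fun h' => wp_setNum ?_) fun h' => wp_setNum ?_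
    all_goals simp only [Test.Holds, NumExp.eval, eval_iv, eval_nv, ha, h.pool a han, h.need] at h'
    · simp [NumExp.eval, IntExp.eval, ha, h.pool a han, h']
    · simp [IntExp.eval, h.need, (not_le.1 h').le]
  · have e1 : s₁.int 23 0 = a := by rw [hF₁.int 23 rfl, ha]
    refine (wp_push (e := iv 23) (a := a) (h.frags.frame hF₁ rfl rfl) e1 h14).mono fun s₂ hF₂ hf =>
      wp_seq (wp_setNum (wp_setNum ⟨?_, fun b hb => ?_, ?_⟩))
    · rw [fill_append, ← List.append_assoc]
      exact ⟨hf.1, hf.2, hf.3⟩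
    · have e2 : s₂.int 23 0 = a := by rw [hF₂.int 23 rfl, e1]
      have e3 : s₂.num 3 = s.num 3 := by rw [hF₂.num 3 rfl, hF₁.num 3 rfl]
      have e4 : s₂.num 14 0 = _ := (congrFun (hF₂.num 14 rfl) 0).trans h14
      rw [drain_append]
      simp only [Store.num_writeNum, if_true, NumExp.eval, eval_iv, e2, e3, eval_nv, e4, drain,
        h.pool a han]
      by_cases hba : b = a
      · subst hba; simp
      · simp [hba, h.pool b hb]
    · have e3 : s₂.num 12 0 = x - total (fill r x l) := by rw [hF₂.num 12 rfl, hF₁.num 12 rfl, h.need]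
      have e4 : s₂.num 14 0 = _ := (congrFun (hF₂.num 14 rfl) 0).trans h14
      rw [fill_append, total_append]
      simp [NumExp.eval, IntExp.eval, e3, e4, fill, sub_sub]

theorem wp_fill {k : ℕ} {r : ℕ → ℝ} {x : ℝ} (ht : Tables P p adv W i s) (hf : HasFrags L s)
    (hk : s.int 24 0 = k) (hkQ : k < P.Q) (hpool : ∀ a < P.n, s.num 3 a = r a) (hx : s.num 12 0 = x)
    (hB : P.n ≤ B) (hB' : P.Q ≤ B) :
    wp fillProg B s (Served P.n L r x (order P.n (P.ent adv i (p i)) k)) := by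
  refine wp_seq (wp_setInt (wp_for (fun j => Served P.n L r x ((List.range j).flatMap fun r =>
    (List.range P.n).filter fun a => P.ent adv i (p i) a = k - r)) (N := k + 1) (by simp [IntExp.eval, hk])
    (by omega) rfl rfl (fun _ _ _ h => ⟨⟨h.1.1, h.1.2, h.1.3⟩, h.2, h.3⟩) ?_
    (fun j hj s₁ hF₁ hv₁ hI₁ => ?_) fun s₁ hF₁ h => h))
  · refine ⟨?_, hpool, ?_⟩
    · simpa [fill] using (⟨hf.1, hf.2, hf.3⟩ : HasFrags L (s.writeInt 20 (IntExp.eval s (.const 0)) _))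
    · simpa [fill] using hx
  have ht₁ := (ht.writeInt (b := 20) (by simp) 0 _).frame hF₁ rfl rfl rfl
  have hk₁ : s₁.int 24 0 = k := by rw [hF₁.int 24 rfl]; simpa using hk
  refine wp_for (fun b => Served P.n L r x (((List.range j).flatMap fun r =>
    (List.range P.n).filter fun a => P.ent adv i (p i) a = k - r) ++
      (List.range b).filter fun a => P.ent adv i (p i) a = k - j)) ht₁.ctx.n
    hB rfl rfl (fun _ _ _ h => ⟨⟨h.1.1, h.1.2, h.1.3⟩, h.2, h.3⟩) (by simpa using hI₁)
    (fun b hb s₂ hF₂ hv₂ hI₂ => ?_) fun s₂ hF₂ h => ?_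
  · have ht₂ := ht₁.frame hF₂ rfl rfl rfl
    have hk₂ : s₂.int 24 0 = k := by rw [hF₂.int 24 rfl, hk₁]
    have hj₂ : s₂.int 25 0 = j := by rw [hF₂.int 25 rfl, hv₁]
    rw [List.range_succ, List.filter_append, ← List.append_assoc]
    refine wp_whenEq (fun h => ?_) fun h => ?_
    all_goals simp only [IntExp.eval, eval_iv, hv₂, hk₂, hj₂, ht₂.ent b hb] at h
    · have : P.ent adv i (p i) b = k - j := by omega
      have := wp_serve (B := B) hI₂ hv₂ hb
      simpa [‹P.ent adv i (p i) b = k - j›] using this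
    · have : ¬ P.ent adv i (p i) b = k - j := by omega
      simpa [this] using hI₂
  · rw [List.range_succ, List.flatMap_append]
    simpa using h

theorem wp_rest {r : ℕ → ℝ} (ht : Tables P p adv W i s) (hf : HasFrags L s)
    (hpool : ∀ a < P.n, s.num 3 a = r a) (hB : P.n ≤ B) (hB' : P.Q ≤ B) :
    wp restProg B s (HasFrags (L ++ (List.range P.Q).flatMap fun e =>
      ((List.range P.n).filter fun a => P.ent adv i (p i) a = e).map fun a => (a, r a))) := by
  refine wp_for (fun j => HasFrags (L ++ (List.range j).flatMap fun e =>
      ((List.range P.n).filter fun a => P.ent adv i (p i) a = e).map fun a => (a, r a)))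
    ht.ctx.Q hB' rfl rfl (fun _ _ _ h => ⟨h.1, h.2, h.3⟩) (by simpa using hf)
    (fun j hj s₁ hF₁ hv₁ hI₁ => ?_) fun s₁ hF₁ h => h
  have ht₁ := ht.frame hF₁ rfl rfl rfl
  refine wp_for (fun b => HasFrags ((L ++ (List.range j).flatMap fun e =>
      ((List.range P.n).filter fun a => P.ent adv i (p i) a = e).map fun a => (a, r a)) ++
      ((List.range b).filter fun a => P.ent adv i (p i) a = j).map fun a => (a, r a))) ht₁.ctx.n
    hB rfl rfl (fun _ _ _ h => ⟨h.1, h.2, h.3⟩) (by simpa using hI₁)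
    (fun b hb s₂ hF₂ hv₂ hI₂ => ?_) fun s₂ hF₂ h => ?_
  · have ht₂ := ht₁.frame hF₂ rfl rfl rfl
    have hj₂ : s₂.int 24 0 = j := by rw [hF₂.int 24 rfl, hv₁]
    have hp₂ : s₂.num 3 b = r b := by rw [hF₂.num 3 rfl, hF₁.num 3 rfl, hpool b hb]
    rw [List.range_succ, List.filter_append, List.map_append, ← List.append_assoc]
    refine wp_whenEq (fun h => ?_) fun h => ?_
    all_goals simp only [IntExp.eval, eval_iv, hv₂, hj₂, ht₂.ent b hb] at h
    · have := wp_push (B := B) (s := s₂.writeNum 14 0 (r b)) (e := iv 23) (a := b) (x := r b)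
        ⟨hI₂.1, hI₂.2, hI₂.3⟩ hv₂ (by simp)
      refine wp_seq (wp_setNum ?_)
      simpa [h, NumExp.eval, IntExp.eval, hv₂, hp₂] using this
    · simpa [h] using hI₂
  · rw [List.range_succ, List.flatMap_append]
    simpa using h

theorem wp_frags (hc : Ctx P p W s) (hD : 0 < P.D) (hadv : ∀ b, s.int 13 b = adv b)
    (hnk : ∀ k < P.Q, s.int 14 k = P.nk adv p k) (hadvB : ∀ b, adv b ≤ B)
    (hnkB : ∀ k, P.nk adv p k ≤ B) (hi : s.int 22 0 = i) (him : i < P.m) (hB : P.n ≤ B)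
    (hB' : P.Q ≤ B) : wp (fragsProg P.m P.D P.U) B s (HasFrags (P.line adv p i).frags) := by
  refine wp_seq ((wp_row hc hD hadv hadvB hi him hB hB').mono fun s₁ hF₁ h₁ =>
    wp_seq (wp_setInt (wp_seq (wp_setNum (wp_seq ?_)))))
  have ht₁ : Tables P p adv W i s₁ := ⟨hc.frame hF₁ rfl rfl, by rw [hF₁.int 13 rfl]; exact hadv,
    h₁.cls, fun a ha => (h₁.rem a ha).1, fun a ha => (h₁.rem a ha).2.1⟩
  have ht₂ : Tables P p adv W i ((s₁.writeInt 27 0 0).writeNum 13 0 ((0 : ℕ) : ℝ)) := by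
    have h := ht₁.writeInt (b := 27) (by simp) 0 0
    exact ⟨⟨h.ctx.n, h.ctx.m, h.ctx.mul, h.ctx.pow, h.ctx.K, h.ctx.Q, h.ctx.len, h.ctx.W,
      h.ctx.states, h.ctx.U, h.ctx.p, h.ctx.s⟩, h.digits, h.cls, h.blk, h.ent⟩
  simp only [IntExp.eval, NumExp.eval]
  refine wp_for (fun k s' => HasFrags ((List.range k).flatMap (P.line adv p i).block) s' ∧
    ∀ a < P.n, s'.num 3 a = (P.line adv p i).pool k a) ht₂.ctx.Q hB' rfl rfl
    (fun _ _ _ h => ⟨⟨h.1.1, h.1.2, h.1.3⟩, h.2⟩) ⟨⟨by simp, by simp, ?_⟩, fun a ha => ?_⟩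
    (fun k hk s₃ hF₃ hv₃ hI₃ => wp_seq ?_) fun s₃ hF₃ h => ?_
  · intro j g hg; simp [spans] at hg
  · exact (h₁.rem a ha).2.2
  · have ht₃ := ht₂.frame hF₃ rfl rfl rfl
    refine (wp_cut ht₃ hI₃.1 hv₃ hk hadvB hB).mono fun s₄ hF₄ h₄ => wp_seq ?_
    have ht₄ := ht₃.frame hF₄ rfl rfl rfl
    refine (wp_need ht₄ (fun j hj => ?_) (k := k) ?_ hk h₄.2 hnkB).mono fun s₅ hF₅ h12 => ?_
    · rw [hF₄.int 14 rfl, hF₃.int 14 rfl]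
      simpa [hF₁.int 14 rfl] using hnk j hj
    · rw [hF₄.int 24 rfl, hv₃]
    have ht₅ := ht₄.frame hF₅ rfl rfl rfl
    refine (wp_fill ht₅ (h₄.1.frame hF₅ rfl rfl) (k := k) (r := (P.line adv p i).pool k) ?_ hk
      (fun a ha => ?_) h12 hB hB').mono fun s₆ hF₆ h => ⟨?_, fun a ha => h.pool a ha⟩
    · rw [hF₅.int 24 rfl, hF₄.int 24 rfl, hv₃]
    · rw [hF₅.num 3 rfl, hF₄.num 3 rfl, hI₃.2 a ha]
    · rw [List.range_succ, List.flatMap_append]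
      rw [List.flatMap_singleton, LineData.block, ← List.append_assoc]
      exact h.frags
  · exact wp_rest (ht₂.frame hF₃ rfl rfl rfl) h.1 h.2 hB hB'

end

/-! ### The joint table of an advice -/

/-- The list of the pieces of the refinement is held by the integer scalar `29`, the integer array
`30` and the number arrays `6` and `7`. -/
structure HasPieces (l : List (ℕ × ℝ × ℝ)) (s : Store) : Prop where
  length : s.int 29 0 = l.length
  holds : Holds (s.int 30) (s.num 6) (s.num 7) l

/-- The next refinement is held by the integer scalar `31`, the integer array `32` and the number
arrays `8` and `9`. -/
structure HasNext (l : List (ℕ × ℝ × ℝ)) (s : Store) : Prop where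
  length : s.int 31 0 = l.length
  holds : Holds (s.int 32) (s.num 8) (s.num 9) l

/-- The multiples of `n ^ i` up to `n` are tabulated by addition, as a label cannot be multiplied
with a power of `n` at run time. -/
def offProg : Prog :=
  .seq (.setInt 33 (.const 0) (.const 0))
    (forLoop 23 0 (.setInt 33 (.add (iv 23) (.const 1)) (.add (.get 33 (iv 23)) (.get 3 (iv 22)))))

/-- Disjoint intervals give a reversed interval, which is stored all the same; it is discarded by
the sign test of `tableProg`. -/
def meetProg : Prog :=
  .seq (.setInt 32 (iv 31) (.add (.get 30 (iv 24)) (.get 33 (.get 28 (iv 25)))))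
    (.seq (.ite (.numLE (.get 6 (iv 24)) (.get 4 (iv 25))) (.setNum 8 (iv 31) (.get 4 (iv 25)))
        (.setNum 8 (iv 31) (.get 6 (iv 24))))
      (.seq (.ite (.numLE (.get 7 (iv 24)) (.get 5 (iv 25))) (.setNum 9 (iv 31) (.get 7 (iv 24)))
          (.setNum 9 (iv 31) (.get 5 (iv 25))))
        (.setInt 31 (.const 0) (.add (iv 31) (.const 1)))))

def refineProg : Prog :=
  .seq (.setInt 31 (.const 0) (.const 0)) (forLoop 24 29 (forLoop 25 27 meetProg))

/-- The refinement is built in a second buffer because every old piece is read once per fragment. -/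
def copyProg : Prog :=
  .seq (forLoop 24 31 (.seq (.setInt 30 (iv 24) (.get 32 (iv 24)))
      (.seq (.setNum 6 (iv 24) (.get 8 (iv 24))) (.setNum 7 (iv 24) (.get 9 (iv 24))))))
    (.setInt 29 (.const 0) (iv 31))

/-- Compute the common refinement of all marginals. -/
def overlayProg (m D U : ℕ) : Prog :=
  .seq (.setInt 29 (.const 0) (.const 1)) (.seq (.setInt 30 (.const 0) (.const 0))
    (.seq (.setNum 6 (.const 0) (.const 0)) (.seq (.setNum 7 (.const 0) (.const 1))
      (forLoop 22 1 (.seq (fragsProg m D U) (.seq offProg (.seq refineProg copyProg)))))))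

/-- Compute the joint table in the number array `10`. -/
def tableProg : Prog :=
  .seq (forLoop 24 10 (.setNum 10 (iv 24) (.const 0))) (forLoop 24 29
    (.seq (.setNum 14 (.const 0) (.sub (.get 7 (iv 24)) (.get 6 (iv 24))))
      (.ite (.numLT (.const 0) (nv 14))
        (.setNum 10 (.get 30 (iv 24)) (.add (.get 10 (.get 30 (iv 24))) (nv 14))) .skip)))

/-- Compute the cost of the joint table in the number scalar `15`. -/
def costProg : Prog :=
  .seq (.setNum 15 (.const 0) (.const 0)) (forLoop 24 10 (forLoop 25 6
    (.ite (.numLT (.get 10 (iv 24)) (.get 1 (iv 25)))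
      (.setNum 15 (.const 0) (.add (nv 15) (.get 10 (iv 24)))) .skip)))

section
variable {P : Par} {p : ℕ → ℕ → ℝ} {W B : ℕ} {s : Store} {adv : ℕ → ℕ} {i : ℕ}
  {l F : List (ℕ × ℝ × ℝ)}

theorem wp_off (hc : Ctx P p W s) (hi : s.int 22 0 = i) (him : i < P.m) (hB : P.n ≤ B) :
    wp offProg B s fun s' => ∀ a ≤ P.n, s'.int 33 a = a * P.n ^ i := by
  refine wp_seq (wp_setInt (wp_for (fun k s' => ∀ a ≤ k, s'.int 33 a = a * P.n ^ i) (N := P.n)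
    hc.n hB rfl rfl (fun _ _ _ h => h) (fun a ha => ?_) (fun k hk s₁ hF₁ hv₁ hI₁ => wp_setInt
    fun a ha => ?_) fun s' _ h => h))
  · obtain rfl : a = 0 := by omega
    simp [IntExp.eval]
  · have e1 : s₁.int 22 0 = i := by rw [hF₁.int 22 rfl]; simpa using hi
    have e2 : s₁.int 3 i = P.n ^ i := by rw [hF₁.int 3 rfl]; simpa using hc.pow i him
    simp only [Store.int_writeInt, if_true, IntExp.eval, eval_iv, hv₁, hI₁ k le_rfl, e1, e2]
    rcases Nat.le_succ_iff_eq_or_le.1 ha with rfl | h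
    · simp; ring
    · rw [Function.update_of_ne (by omega), hI₁ a h]

theorem wp_meet {w g f : ℕ} {x y : ℕ × ℝ × ℝ} (hn : HasNext l s) (hg : s.int 24 0 = g)
    (hf : s.int 25 0 = f) (h1 : s.int 30 g = x.1 ∧ s.num 6 g = x.2.1 ∧ s.num 7 g = x.2.2)
    (h2 : s.int 28 f = y.1 ∧ s.num 4 f = y.2.1 ∧ s.num 5 f = y.2.2) (h3 : s.int 33 y.1 = y.1 * w) :
    wp meetProg B s (HasNext (l ++ [meet w x y])) := by
  have hh := hn.holds.append (meet w x y)
  refine wp_seq (wp_setInt (wp_seq (wp.mono (Q := fun s' => s'.num 8 =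
    Function.update (s.num 8) l.length (max x.2.1 y.2.1)) (wp_ite (fun h => wp_setNum ?_)
    fun h => wp_setNum ?_) fun s₁ hF₁ h₁ => wp_seq (wp.mono (Q := fun s' => s'.num 9 =
    Function.update (s.num 9) l.length (min x.2.2 y.2.2)) (wp_ite (fun h => wp_setNum ?_)
    fun h => wp_setNum ?_) fun s₂ hF₂ h₂ => wp_setInt ⟨?_, ?_⟩))))
  · simp only [Test.Holds, NumExp.eval, eval_iv, Store.int_writeInt, Store.num_writeInt, hg, hf, h1, h2,
      reduceIte, Nat.reduceEqDiff] at h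
    simp [NumExp.eval, hn.length, hf, h2, max_eq_right h]
  · simp only [Test.Holds, NumExp.eval, eval_iv, Store.int_writeInt, Store.num_writeInt, hg, hf, h1, h2,
      reduceIte, Nat.reduceEqDiff] at h
    simp [NumExp.eval, hn.length, hg, h1, max_eq_left (not_le.1 h).le]
  all_goals
    have e24 : s₁.int 24 0 = g := by rw [hF₁.int 24 rfl]; simpa using hg
    have e25 : s₁.int 25 0 = f := by rw [hF₁.int 25 rfl]; simpa using hf
    have e7 : s₁.num 7 g = x.2.2 := by rw [hF₁.num 7 rfl]; simpa using h1.2.2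
    have e5 : s₁.num 5 f = y.2.2 := by rw [hF₁.num 5 rfl]; simpa using h2.2.2
    have e31 : s₁.int 31 0 = l.length := by rw [hF₁.int 31 rfl]; simpa using hn.length
    have e9 : s₁.num 9 = s.num 9 := by rw [hF₁.num 9 rfl]; simp
  · simp only [Test.Holds, NumExp.eval, eval_iv, e24, e25, e7, e5] at h
    simp [NumExp.eval, e31, e24, e7, e9, min_eq_left h]
  · simp only [Test.Holds, NumExp.eval, eval_iv, e24, e25, e7, e5] at h
    simp [NumExp.eval, e31, e25, e5, e9, min_eq_right (not_le.1 h).le]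
  · have : s₂.int 31 0 = l.length := by rw [hF₂.int 31 rfl, e31]
    simp [IntExp.eval, this]
  · have e32 : s₂.int 32 = Function.update (s.int 32) l.length (meet w x y).1 := by
      rw [hF₂.int 32 rfl, hF₁.int 32 rfl]
      simp [IntExp.eval, hn.length, hg, hf, h1, h2, h3, meet]
    have e8 : s₂.num 8 = _ := (hF₂.num 8 rfl).trans h₁
    simpa [e32, e8, h₂, meet] using hh

theorem wp_refine {w : ℕ} (hl : HasPieces l s) (hF : s.int 27 0 = F.length)
    (hF' : Holds (s.int 28) (s.num 4) (s.num 5) F) (hoff : ∀ f ∈ F, s.int 33 f.1 = f.1 * w)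
    (hB : l.length ≤ B) (hB' : F.length ≤ B) :
    wp refineProg B s (HasNext (l.flatMap fun g => F.map (meet w g))) := by
  refine wp_seq (wp_setInt (wp_for (fun j => HasNext ((l.take j).flatMap fun g => F.map (meet w g)))
    hl.length hB rfl rfl (fun _ _ _ h => ⟨h.1, h.2⟩) ⟨by simp [IntExp.eval], ?_⟩
    (fun j hj s₁ hF₁ hv₁ hI₁ => ?_) fun s' _ h => ?_))
  · intro j g hg; simp at hg
  · obtain ⟨x, hx⟩ : ∃ x, l[j]? = some x := ⟨_, List.getElem?_eq_getElem hj⟩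
    have hx' : s₁.int 30 j = x.1 ∧ s₁.num 6 j = x.2.1 ∧ s₁.num 7 j = x.2.2 := by
      rw [hF₁.int 30 rfl, hF₁.num 6 rfl, hF₁.num 7 rfl]; exact hl.holds j x hx
    refine wp_for (fun k => HasNext (((l.take j).flatMap fun g => F.map (meet w g)) ++
      (F.take k).map (meet w x))) (N := F.length) ?_ hB' rfl rfl (fun _ _ _ h => ⟨h.1, h.2⟩)
      (by simpa using hI₁) (fun k hk s₂ hF₂ hv₂ hI₂ => ?_) fun s' _ h => ?_
    · rw [hF₁.int 27 rfl]; exact hF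
    · obtain ⟨y, hy⟩ : ∃ y, F[k]? = some y := ⟨_, List.getElem?_eq_getElem hk⟩
      have hmem : y ∈ F := List.mem_of_getElem? hy
      rw [List.take_add_one, hy, List.map_append, ← List.append_assoc]
      refine wp_meet (y := y) (w := w) hI₂ (g := j) ?_ hv₂ ?_ ?_ ?_
      · rw [hF₂.int 24 rfl, hv₁]
      · rw [hF₂.int 30 rfl, hF₂.num 6 rfl, hF₂.num 7 rfl]; exact hx'
      · rw [hF₂.int 28 rfl, hF₂.num 4 rfl, hF₂.num 5 rfl, hF₁.int 28 rfl, hF₁.num 4 rfl,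
          hF₁.num 5 rfl]
        exact hF' k y hy
      · rw [hF₂.int 33 rfl, hF₁.int 33 rfl]; exact hoff y hmem
    · rw [List.take_add_one, hx, List.flatMap_append]
      simpa using h
  · simpa using h

theorem wp_copy (h : HasNext l s) (hB : l.length ≤ B) : wp copyProg B s (HasPieces l) := by
  refine wp_seq (wp_for (fun j s' => ∀ k < j, s'.int 30 k = s.int 32 k ∧ s'.num 6 k = s.num 8 k ∧
    s'.num 7 k = s.num 9 k) h.length hB rfl rfl (fun _ _ _ h => h) (fun k hk => absurd hk (by omega))
    (fun j hj s₁ hF₁ hv₁ hI₁ => wp_seq (wp_setInt (wp_seq (wp_setNum (wp_setNum fun k hk => ?_)))))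
    fun s₁ hF₁ h₁ => wp_setInt ⟨?_, ?_⟩)
  · have e1 : s₁.int 32 = s.int 32 := hF₁.int 32 rfl
    have e2 : s₁.num 8 = s.num 8 := hF₁.num 8 rfl
    have e3 : s₁.num 9 = s.num 9 := hF₁.num 9 rfl
    rcases Nat.lt_succ_iff_lt_or_eq.1 hk with hk | rfl
    · simpa [hv₁, hk.ne] using hI₁ k hk
    · simp [hv₁, IntExp.eval, NumExp.eval, e1, e2, e3]
  · simp [IntExp.eval, hF₁.int 31 rfl, h.length]
  · intro j g hj
    have hjl : j < l.length := by
      by_contra hcon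
      rw [List.getElem?_eq_none (by omega)] at hj
      simp at hj
    have h2 := h₁ j hjl
    have h3 := h.holds j g hj
    simp only [Store.int_writeInt, Store.num_writeInt]
    rw [← h3.1, ← h3.2.1, ← h3.2.2]
    exact h2

theorem mem_spans {o : ℝ} {L : List (ℕ × ℝ)} {g : ℕ × ℝ × ℝ} (h : g ∈ spans o L) :
    ∃ a ∈ L, a.1 = g.1 := by
  induction L generalizing o with
  | nil => simp [spans] at h
  | cons a L ih =>
    rcases List.mem_cons.1 h with rfl | h
    · exact ⟨a, by simp, rfl⟩
    · obtain ⟨b, hb, e⟩ := ih h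
      exact ⟨b, List.mem_cons_of_mem _ hb, e⟩

theorem wp_overlay (hc : Ctx P p W s) (hD : 0 < P.D) (hρ : 0 ≤ P.ρ) (hp0 : ∀ i a, 0 ≤ p i a)
    (hadv : ∀ b, s.int 13 b = adv b)
    (hnk : ∀ k < P.Q, s.int 14 k = P.nk adv p k) (hadvB : ∀ b, adv b ≤ B)
    (hnkB : ∀ k, P.nk adv p k ≤ B) (hm : P.m ≤ B) (hB : P.n ≤ B) (hB' : P.Q ≤ B)
    (hF : ∀ i, (P.line adv p i).frags.length ≤ B)
    (hO : ∀ i ≤ P.m, (overlay P.n (fun i => (P.line adv p i).frags) i).length ≤ B) :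
    wp (overlayProg P.m P.D P.U) B s
      (HasPieces (overlay P.n (fun i => (P.line adv p i).frags) P.m)) := by
  refine wp_seq (wp_setInt (wp_seq (wp_setInt (wp_seq (wp_setNum (wp_seq (wp_setNum ?_)))))))
  simp only [IntExp.eval, NumExp.eval, Nat.cast_zero, Nat.cast_one]
  set s₀ := (((s.writeInt 29 0 1).writeInt 30 0 0).writeNum 6 0 0).writeNum 7 0 1 with hs₀
  have hc₀ : Ctx P p W s₀ :=
    ⟨hc.n, hc.m, hc.mul, hc.pow, hc.K, hc.Q, hc.len, hc.W, hc.states, hc.U, hc.p, hc.s⟩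
  refine wp_for (fun i => HasPieces (overlay P.n (fun i => (P.line adv p i).frags) i))
    hc₀.m hm rfl rfl (fun _ _ _ h => ⟨h.1, h.2⟩) ⟨by simp [s₀, overlay], ?_⟩
    (fun i hi s₁ hF₁ hv₁ hI₁ => ?_) fun s' _ h => h
  · intro j g hj
    rcases j with _ | j
    · simp only [overlay, List.getElem?_cons_zero, Option.some.injEq] at hj
      simp [s₀, ← hj]
    · simp [overlay] at hj
  have hc₁ := hc₀.frame hF₁ rfl rfl
  have hadv₁ : ∀ b, s₁.int 13 b = adv b := by rw [hF₁.int 13 rfl]; exact hadv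
  have hnk₁ : ∀ k < P.Q, s₁.int 14 k = P.nk adv p k := by rw [hF₁.int 14 rfl]; exact hnk
  refine wp_seq ((wp_frags hc₁ hD hadv₁ hnk₁ hadvB hnkB hv₁ hi hB hB').mono fun s₂ hF₂ h₂ =>
    wp_seq ?_)
  have hv₂ : s₂.int 22 0 = i := by rw [hF₂.int 22 rfl, hv₁]
  refine (wp_off (hc₁.frame hF₂ rfl rfl) hv₂ hi hB).mono fun s₃ hF₃ hoff => wp_seq ?_
  have hI₃ : HasPieces (overlay P.n (fun i => (P.line adv p i).frags) i) s₃ := by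
    constructor
    · rw [hF₃.int 29 rfl, hF₂.int 29 rfl]; exact hI₁.length
    · rw [hF₃.int 30 rfl, hF₂.int 30 rfl, hF₃.num 6 rfl, hF₂.num 6 rfl, hF₃.num 7 rfl, hF₂.num 7 rfl]
      exact hI₁.holds
  have h₃ := h₂.frame hF₃ rfl rfl
  refine (wp_refine (w := P.n ^ i) hI₃ (h₃.length.trans (length_spans 0 _).symm) h₃.holds
    (fun f hf => ?_) (hO i hi.le) (by rw [length_spans]; exact hF i)).mono fun s₄ hF₄ h₄ => ?_
  · obtain ⟨a, ha, e⟩ := mem_spans hf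
    refine hoff _ (e ▸ (LineData.frags_mem (d := P.line adv p i) (fun k => pow_nonneg hρ k)
      (fun b => Par.rem_nonneg (hp0 i) b) ha).1.le)
  · exact wp_copy h₄ (hO (i + 1) hi)

theorem weight_append (l l' : List (ℕ × ℝ × ℝ)) (c : ℕ) :
    weight (l ++ l') c = weight l c + weight l' c := by simp [weight]

theorem wp_table (hc : Ctx P p W s) (h : HasPieces l s) (hB : P.n ^ P.m ≤ B) (hB' : l.length ≤ B) :
    wp tableProg B s fun s' => ∀ c < P.n ^ P.m, s'.num 10 c = weight l c := by
  refine wp_seq (wp_for (fun k s' => ∀ c < k, s'.num 10 c = 0) hc.states hB rfl rfl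
    (fun _ _ _ h => h) (fun k hk => absurd hk (by omega)) (fun k hk s₁ hF₁ hv₁ hI₁ => wp_setNum
    fun c hc => ?_) fun s₁ hF₁ h₁ => ?_)
  · rcases Nat.lt_succ_iff_lt_or_eq.1 hc with hc | rfl
    · simp [hv₁, hc.ne, hI₁ c hc]
    · simp [hv₁, NumExp.eval]
  · refine wp_for (fun k s' => ∀ c < P.n ^ P.m, s'.num 10 c = weight (l.take k) c) (N := l.length)
      ?_ hB' rfl rfl (fun _ _ _ h => h) (fun c hc => by simpa [weight] using h₁ c hc)
      (fun k hk s₂ hF₂ hv₂ hI₂ => wp_seq (wp_setNum ?_)) fun s' _ h => by simpa using h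
    · rw [hF₁.int 29 rfl, h.length]
    · obtain ⟨x, hx⟩ : ∃ x, l[k]? = some x := ⟨_, List.getElem?_eq_getElem hk⟩
      obtain ⟨e1, e2, e3⟩ := h.holds k x hx
      rw [← hF₁.int 30 rfl, ← hF₂.int 30 rfl] at e1
      rw [← hF₁.num 6 rfl, ← hF₂.num 6 rfl] at e2
      rw [← hF₁.num 7 rfl, ← hF₂.num 7 rfl] at e3
      have e4 : ∀ c, weight (l.take (k + 1)) c = weight (l.take k) c +
          if x.1 = c then max 0 (x.2.2 - x.2.1) else 0 := by
        intro c
        rw [List.take_add_one, hx, weight_append]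
        simp [weight]
      refine wp_ite (fun h => wp_setNum fun c hc => ?_) fun h => wp_skip fun c hc => ?_
      all_goals
        rw [e4]
        simp only [Test.Holds, NumExp.eval, eval_nv, eval_iv, hv₂, e2, e3, Store.num_writeNum, if_true,
          IntExp.eval, Function.update_self, Nat.cast_zero] at h
      · by_cases hcx : c = x.1
        · subst hcx
          simp [NumExp.eval, IntExp.eval, hv₂, e1, e2, e3, hI₂ _ hc, max_eq_right h.le]
        · simp [NumExp.eval, IntExp.eval, hv₂, e1, hcx, Ne.symm hcx, hI₂ _ hc]
      · rw [max_eq_left (not_lt.1 h), ite_self, add_zero]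
        simpa using hI₂ c hc

/-- The number of tests `T c < ρ ^ j` that succeed is the class, so adding `T c` at each success
gives the product without multiplying. -/
theorem wp_cost (hc : Ctx P p W s) {T : ℕ → ℝ} (h : ∀ c < P.n ^ P.m, s.num 10 c = T c)
    (hB : P.n ^ P.m ≤ B) (hB' : P.Q ≤ B) :
    wp costProg B s fun s' => s'.num 15 0 = ∑ c ∈ Finset.range (P.n ^ P.m), P.cls (T c) * T c := by
  refine wp_seq (wp_setNum (wp_for (fun k s' => s'.num 15 0 = ∑ c ∈ Finset.range k, P.cls (T c) * T c)
    (N := P.n ^ P.m) hc.states hB rfl rfl (fun _ _ _ h => h) (by simp [NumExp.eval, IntExp.eval])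
    (fun k hk s₁ hF₁ hv₁ hI₁ => ?_) fun s' _ h => h))
  have e1 : s₁.int 6 0 = P.K := by rw [hF₁.int 6 rfl]; exact hc.K
  refine wp_for (fun j s' => s'.num 15 0 = ∑ c ∈ Finset.range k, P.cls (T c) * T c +
    Nat.count (fun l => T k < P.ρ ^ l) j * T k) e1 (by simp only [Par.Q] at hB'; omega) rfl rfl
    (fun _ _ _ h => h) (by simp [hI₁]) (fun j hj s₂ hF₂ hv₂ hI₂ => ?_) fun s' _ h => ?_
  · have e2 : s₂.int 24 0 = k := by rw [hF₂.int 24 rfl, hv₁]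
    have e3 : s₂.num 10 k = T k := by rw [hF₂.num 10 rfl, hF₁.num 10 rfl]; exact h k hk
    have e4 : s₂.num 1 j = P.ρ ^ j := by
      rw [hF₂.num 1 rfl, hF₁.num 1 rfl]
      exact hc.s j (by simp only [Par.Q]; omega)
    refine wp_ite (fun h' => wp_setNum ?_) fun h' => wp_skip ?_
    all_goals simp only [Test.Holds, NumExp.eval, eval_iv, e2, hv₂, e3, e4] at h'
    · simp only [NumExp.eval, eval_nv, eval_iv, e2, e3, hI₂, Store.num_writeNum, if_true, IntExp.eval,
        Function.update_self, Nat.count_succ, h']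
      push_cast; ring
    · simp only [hI₂, Nat.count_succ, h', if_false, add_zero]
  · rw [h, Finset.sum_range_succ]; rfl

end

/-! ### The search over all advices -/

namespace Par
variable (P : Par)

/-- A bound for the number of fragments of a marginal. -/
def fragBound : ℕ := P.Q * (P.n * P.B + P.Q * P.n) + P.Q * P.n

/-- A bound for the number of passes of every loop. -/
def bound : ℕ :=
  P.B ^ P.len + P.n ^ P.m + P.len + P.B + P.n + P.m + P.Q + P.n * P.B + (P.fragBound + 1) ^ P.m +
    P.fragBound

/-- The joint table of the advice `adv`, indexed by numbers. -/
noncomputable def table (adv : ℕ → ℕ) (p : ℕ → ℕ → ℝ) (c : ℕ) : ℝ :=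
  weight (overlay P.n (fun i => (P.line adv p i).frags) P.m) c

/-- An approximation of the entropy of a table. -/
noncomputable def cost (T : ℕ → ℝ) : ℝ := ∑ c ∈ Finset.range (P.n ^ P.m), P.cls (T c) * T c

/-- The advice with the number `w`. -/
def digits (w b : ℕ) : ℕ := w / P.B ^ b % P.B

variable {P} {adv : ℕ → ℕ} {p : ℕ → ℕ → ℝ}

theorem pc_le (hB : ∀ b, adv b ≤ P.B) (i : ℕ) (r : ℕ → ℝ) (a k : ℕ) : P.pc adv i r a k ≤ P.B := by
  rw [pc]; split_ifs <;> first | exact hB _ | exact Nat.zero_le _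

theorem nk_le (hB : ∀ b, adv b ≤ P.B) (k : ℕ) : P.nk adv p k ≤ P.n * P.B := by
  refine Finset.sup_le fun i _ => ?_
  refine (Finset.sum_le_card_nsmul _ _ P.B fun a _ => pc_le hB i _ a k).trans ?_
  simp

theorem length_fill (r : ℕ → ℝ) (x : ℝ) (l : List ℕ) : (fill r x l).length = l.length := by
  induction l generalizing r x with
  | nil => rfl
  | cons a l ih => simp [fill, ih]

theorem length_flatMap_range_le {α : Type*} (f : ℕ → List α) (N c : ℕ)
    (h : ∀ j < N, (f j).length ≤ c) : ((List.range N).flatMap f).length ≤ N * c := by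
  rw [List.length_flatMap]
  refine (List.sum_le_card_nsmul _ c fun x hx => ?_).trans (by simp)
  obtain ⟨j, hj, rfl⟩ := List.mem_map.1 hx
  exact h j (List.mem_range.1 hj)

theorem length_frags_le (hB : ∀ b, adv b ≤ P.B) (i : ℕ) :
    (P.line adv p i).frags.length ≤ P.fragBound := by
  rw [LineData.frags, List.length_append, fragBound]
  refine Nat.add_le_add (length_flatMap_range_le _ _ _ fun k hk => ?_)
    (length_flatMap_range_le _ _ _ fun k hk => ?_)
  · rw [LineData.block, List.length_append, length_fill]
    refine Nat.add_le_add (length_flatMap_range_le _ _ _ fun a ha => ?_) ?_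
    · rw [List.length_replicate]; exact pc_le hB i _ a k
    · refine (length_flatMap_range_le _ _ P.n fun r _ => ?_).trans (Nat.mul_le_mul_right _ hk)
      exact (List.length_filter_le _ _).trans (by simp [line])
  · rw [List.length_map]
    exact (List.length_filter_le _ _).trans (by simp [line])

theorem length_overlay_le (hB : ∀ b, adv b ≤ P.B) (i : ℕ) :
    (overlay P.n (fun i => (P.line adv p i).frags) i).length ≤ (P.fragBound + 1) ^ i := by
  induction i with
  | zero => simp [overlay]
  | succ i ih =>
    rw [overlay, List.length_flatMap]
    refine (List.sum_le_card_nsmul _ (P.fragBound + 1) fun x hx => ?_).trans ?_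
    · obtain ⟨g, _, rfl⟩ := List.mem_map.1 hx
      rw [List.length_map, length_spans]
      exact (length_frags_le hB i).trans (Nat.le_succ _)
    · rw [List.length_map, smul_eq_mul, pow_succ]
      exact Nat.mul_le_mul_right _ ih

end Par

/-- Store the digits of the integer scalar `21` in the integer array `13`. -/
def decodeProg (b : ℕ) : Prog :=
  .seq (.setInt 35 (.const 0) (iv 21)) (forLoop 25 8 (.seq (.setInt 19 (.const 0) (.const 0)) (.seq
    (forLoop 26 35 (.ite (.intLE (mulc b (.add (iv 19) (.const 1))) (iv 35))
      (.setInt 19 (.const 0) (.add (iv 19) (.const 1))) .skip))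
    (.seq (.setInt 13 (iv 25) (.sub (iv 35) (mulc b (iv 19)))) (.setInt 35 (.const 0) (iv 19))))))

def keepProg : Prog :=
  .seq (forLoop 24 10 (.setNum 11 (iv 24) (.get 10 (iv 24)))) (.setNum 16 (.const 0) (nv 15))

/-- The first advice is kept unconditionally, because the scalar `16` holds no meaningful cost
before that. -/
def searchProg (m D U b : ℕ) : Prog :=
  forLoop 21 9 (.seq (decodeProg b) (.seq (nkProg m D U) (.seq (overlayProg m D U) (.seq tableProg
    (.seq costProg (.ite (.intLE (iv 21) (.const 0)) keepProg
      (.ite (.numLT (nv 15) (nv 16)) keepProg .skip)))))))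

section
variable {P : Par} {p : ℕ → ℕ → ℝ} {W B : ℕ} {s : Store}

theorem wp_decode {w : ℕ} (hc : Ctx P p W s) (hb : 0 < P.B) (hw : s.int 21 0 = w)
    (h13 : ∀ b, P.len ≤ b → s.int 13 b = 0) (hwB : w ≤ B) (hB : P.len ≤ B) (hwl : w < P.B ^ P.len) :
    wp (decodeProg P.B) B s fun s' => ∀ b, s'.int 13 b = P.digits w b := by
  refine wp_seq (wp_setInt (wp_for (fun j s' => s'.int 35 0 = w / P.B ^ j ∧
    (∀ b < j, s'.int 13 b = P.digits w b) ∧ ∀ b, P.len ≤ b → s'.int 13 b = 0) (N := P.len)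
    hc.len hB rfl rfl (fun _ _ _ h => h) ⟨by simp [IntExp.eval, hw], fun k hk => absurd hk (by omega),
      h13⟩ (fun j hj s₁ hF₁ hv₁ hI₁ => wp_seq (wp_setInt (wp_seq ?_))) fun s₁ hF₁ h => ?_))
  -- Division by the constant `B` through counting: the quotient is raised while `B` times its
  -- successor still fits. It never exceeds the dividend, so as many passes as the dividend suffice.
  · refine wp_for (fun k s' => s'.int 19 0 = min k (w / P.B ^ j / P.B)) (N := w / P.B ^ j)
      (by simpa using hI₁.1) ((Nat.div_le_self _ _).trans hwB) rfl rfl (fun _ _ _ h => h)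
      (by simp [IntExp.eval]) (fun k hk s₂ hF₂ hv₂ hI₂ => ?_) fun s₂ hF₂ h => wp_seq (wp_setInt
        (wp_setInt ?_))
    · have e35 : s₂.int 35 0 = w / P.B ^ j := by rw [hF₂.int 35 rfl]; simpa using hI₁.1
      have e : ∀ x, P.B * (x + 1) ≤ w / P.B ^ j ↔ x + 1 ≤ w / P.B ^ j / P.B := fun x => by
        rw [Nat.le_div_iff_mul_le hb, mul_comm]
      refine wp_ite (fun h' => wp_setInt ?_) fun h' => wp_skip ?_
      all_goals simp only [Test.Holds, IntExp.eval, eval_mulc, eval_iv, hI₂, e35, e] at h'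
      · simp only [Store.int_writeInt, if_true, IntExp.eval, Function.update_self, eval_iv, hI₂]
        omega
      · rw [hI₂]; omega
    · have e19 : s₂.int 19 0 = w / P.B ^ j / P.B := by
        rw [h, min_eq_right (Nat.div_le_self _ _)]
      have e35 : s₂.int 35 0 = w / P.B ^ j := by rw [hF₂.int 35 rfl]; simpa using hI₁.1
      have e25 : s₂.int 25 0 = j := by rw [hF₂.int 25 rfl]; simpa using hv₁
      have e13 : s₂.int 13 = s₁.int 13 := by rw [hF₂.int 13 rfl]; simp
      refine ⟨?_, fun b hb => ?_, fun b hb => ?_⟩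
      · simp [IntExp.eval, e19, Nat.div_div_eq_div_mul, pow_succ]
      · rcases Nat.lt_succ_iff_lt_or_eq.1 hb with hb | rfl
        · simp [e25, hb.ne, e13, hI₁.2.1 b hb]
        · simp only [Store.int_writeInt, eval_iv, e25, IntExp.eval, e35, eval_mulc, e19,
            Nat.reduceEqDiff, reduceIte, Function.update_self]
          rw [Par.digits, ← Nat.mod_eq_sub_mul_div]
      · have : b ≠ j := by omega
        simp [e25, this, e13, hI₁.2.2 b hb]
  · intro b
    rcases lt_or_ge b P.len with hbl | hbl
    · exact h.2.1 b hbl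
    · rw [h.2.2 b hbl, Par.digits, Nat.div_eq_of_lt, Nat.zero_mod]
      exact hwl.trans_le (Nat.pow_le_pow_right hb hbl)

theorem wp_keep (hc : Ctx P p W s) (hB : P.n ^ P.m ≤ B) :
    wp keepProg B s fun s' => (∀ c < P.n ^ P.m, s'.num 11 c = s.num 10 c) ∧
      s'.num 16 0 = s.num 15 0 := by
  refine wp_seq (wp_for (fun j s' => ∀ c < j, s'.num 11 c = s.num 10 c) hc.states hB rfl rfl
    (fun _ _ _ h => h) (fun k hk => absurd hk (by omega)) (fun j hj s₁ hF₁ hv₁ hI₁ => wp_setNum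
    fun c hc => ?_) fun s₁ hF₁ h => wp_setNum ⟨by simpa using h, ?_⟩)
  · have e10 : s₁.num 10 = s.num 10 := hF₁.num 10 rfl
    rcases Nat.lt_succ_iff_lt_or_eq.1 hc with hc | rfl
    · simp [hv₁, hc.ne, hI₁ c hc]
    · simp [hv₁, NumExp.eval, e10]
  · simp [IntExp.eval, hF₁.num 15 rfl]

theorem Par.digits_lt (hb : 0 < P.B) (w b : ℕ) : P.digits w b < P.B := Nat.mod_lt _ hb

theorem wp_search (hc : Ctx P p (P.B ^ P.len) s) (hb : 0 < P.B) (hD : 0 < P.D) (hρ : 0 ≤ P.ρ)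
    (hp0 : ∀ i a, 0 ≤ p i a) (h13 : ∀ b, P.len ≤ b → s.int 13 b = 0) :
    wp (searchProg P.m P.D P.U P.B) P.bound s fun s' => ∃ w < P.B ^ P.len,
      (∀ c < P.n ^ P.m, s'.num 11 c = P.table (P.digits w) p c) ∧
      ∀ w' < P.B ^ P.len, P.cost (P.table (P.digits w) p) ≤ P.cost (P.table (P.digits w') p) := by
  refine wp_for (fun k s' => (∀ b, P.len ≤ b → s'.int 13 b = 0) ∧ (0 < k → ∃ w < k,
      (∀ c < P.n ^ P.m, s'.num 11 c = P.table (P.digits w) p c) ∧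
      s'.num 16 0 = P.cost (P.table (P.digits w) p) ∧
      ∀ w' < k, P.cost (P.table (P.digits w) p) ≤ P.cost (P.table (P.digits w') p)))
    hc.W (by rw [Par.bound]; omega) rfl rfl (fun _ _ _ h => h) ⟨h13, fun h => absurd h (by omega)⟩
    (fun w hw s₁ hF₁ hv₁ hI₁ => wp_seq ?_) fun s' _ h => ?_
  · have hc₁ := hc.frame hF₁ rfl rfl
    have hadvB : ∀ b, P.digits w b ≤ P.B := fun b => (Par.digits_lt hb w b).le
    have hb1 : P.B ≤ P.bound ∧ P.n ≤ P.bound ∧ P.m ≤ P.bound ∧ P.Q ≤ P.bound ∧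
        P.n * P.B ≤ P.bound ∧ P.fragBound ≤ P.bound ∧ (P.fragBound + 1) ^ P.m ≤ P.bound ∧
        P.len ≤ P.bound ∧ P.n ^ P.m ≤ P.bound ∧ P.B ^ P.len ≤ P.bound := by
      rw [Par.bound]; omega
    obtain ⟨bB, bn, bm, bQ, bnB, bF, bO, bl, bN, bW⟩ := hb1
    have hO : ∀ i ≤ P.m, (overlay P.n (fun i => (P.line (P.digits w) p i).frags) i).length ≤ P.bound :=
      fun i hi => (Par.length_overlay_le hadvB i).trans
        ((Nat.pow_le_pow_right (by omega) hi).trans bO)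
    refine (wp_decode hc₁ hb hv₁ hI₁.1 (by omega) bl hw).mono fun s₂ hF₂ h₂ => wp_seq ?_
    have hc₂ := hc₁.frame hF₂ rfl rfl
    refine (wp_nk hc₂ hD h₂ (fun b => (hadvB b).trans bB) bm bn bQ).mono fun s₃ hF₃ h₃ => wp_seq ?_
    have hc₃ := hc₂.frame hF₃ rfl rfl
    refine (wp_overlay hc₃ hD hρ hp0 (by rw [hF₃.int 13 rfl]; exact h₂) h₃
      (fun b => (hadvB b).trans bB) (fun k => (Par.nk_le hadvB k).trans bnB) bm bn bQ
      (fun i => (Par.length_frags_le hadvB i).trans bF) hO).mono fun s₄ hF₄ h₄ => wp_seq ?_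
    have hc₄ := hc₃.frame hF₄ rfl rfl
    refine (wp_table hc₄ h₄ bN (hO _ le_rfl)).mono fun s₅ hF₅ h₅ => wp_seq ?_
    have hc₅ := hc₄.frame hF₅ rfl rfl
    refine (wp_cost hc₅ h₅ bN bQ).mono fun s₆ hF₆ h₆ => ?_
    have hc₆ := hc₅.frame hF₆ rfl rfl
    have e10 : ∀ c < P.n ^ P.m, s₆.num 10 c = P.table (P.digits w) p c := by
      rw [hF₆.num 10 rfl]; exact h₅
    have e15 : s₆.num 15 0 = P.cost (P.table (P.digits w) p) := h₆
    have e13 : ∀ b, P.len ≤ b → s₆.int 13 b = 0 := by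
      intro b hbl
      rw [hF₆.int 13 rfl, hF₅.int 13 rfl, hF₄.int 13 rfl, hF₃.int 13 rfl, h₂, Par.digits,
        Nat.div_eq_of_lt, Nat.zero_mod]
      exact hw.trans_le (Nat.pow_le_pow_right hb hbl)
    have e11 : s₆.num 11 = s₁.num 11 := by
      rw [hF₆.num 11 rfl, hF₅.num 11 rfl, hF₄.num 11 rfl, hF₃.num 11 rfl, hF₂.num 11 rfl]
    have e16 : s₆.num 16 = s₁.num 16 := by
      rw [hF₆.num 16 rfl, hF₅.num 16 rfl, hF₄.num 16 rfl, hF₃.num 16 rfl, hF₂.num 16 rfl]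
    have e21 : s₆.int 21 0 = w := by
      rw [hF₆.int 21 rfl, hF₅.int 21 rfl, hF₄.int 21 rfl, hF₃.int 21 rfl, hF₂.int 21 rfl, hv₁]
    have keep : (∀ w' < w, P.cost (P.table (P.digits w) p) ≤ P.cost (P.table (P.digits w') p)) →
        wp keepProg P.bound s₆ fun s' => (∀ b, P.len ≤ b → s'.int 13 b = 0) ∧ (0 < w + 1 →
          ∃ w₁ < w + 1, (∀ c < P.n ^ P.m, s'.num 11 c = P.table (P.digits w₁) p c) ∧
          s'.num 16 0 = P.cost (P.table (P.digits w₁) p) ∧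
          ∀ w' < w + 1, P.cost (P.table (P.digits w₁) p) ≤ P.cost (P.table (P.digits w') p)) := by
      intro hmin
      refine (wp_keep hc₆ bN).mono fun s₇ hF₇ h₇ => ⟨fun b hbl => ?_, fun _ => ⟨w, by omega,
        fun c hcN => ?_, ?_, fun w' hw' => ?_⟩⟩
      · rw [hF₇.int 13 rfl]; exact e13 b hbl
      · rw [h₇.1 c hcN, e10 c hcN]
      · rw [h₇.2, e15]
      · rcases Nat.lt_succ_iff_lt_or_eq.1 hw' with h | rfl
        · exact hmin w' h
        · exact le_rfl
    refine wp_ite (fun h => keep fun w' hw' => ?_) fun h => ?_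
    · simp only [Test.Holds, eval_iv, e21, IntExp.eval] at h; omega
    · simp only [Test.Holds, eval_iv, e21, IntExp.eval] at h
      obtain ⟨w₀, hw₀, h11, h16, hmin⟩ := hI₁.2 (by omega)
      refine wp_ite (fun h' => keep fun w' hw' => ?_) fun h' => wp_skip ⟨e13, fun _ => ⟨w₀, by omega,
        by rw [e11]; exact h11, by rw [e16]; exact h16, fun w' hw' => ?_⟩⟩
      all_goals simp only [Test.Holds, eval_nv, e15, e16, h16] at h'
      · exact h'.le.trans (hmin w' hw')
      · rcases Nat.lt_succ_iff_lt_or_eq.1 hw' with h | rfl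
        · exact hmin w' h
        · exact not_lt.1 h'
  · obtain ⟨w, hw, h1, _, h2⟩ := h.2 (Nat.pow_pos hb)
    exact ⟨w, hw, h1, h2⟩

end

/-! ### The whole program -/

/-- Repeated halving. -/
def halves : ℕ → NumExp → NumExp
  | 0, x => x
  | c + 1, x => .half (halves c x)

@[simp] theorem eval_halves (s : Store) (c : ℕ) (x : NumExp) :
    (halves c x).eval s = x.eval s / 2 ^ c := by
  induction c with
  | zero => simp [halves]
  | succ c ih => rw [halves, NumExp.eval, ih, pow_succ, div_div]

/-- Copy the first `i` marginals to the number array `0`. -/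
def flattenProg : ℕ → Prog
  | 0 => .setInt 19 (.const 0) (.const 0)
  | i + 1 => .seq (flattenProg i) (.seq
      (forLoop 23 0 (.setNum 0 (.add (iv 19) (iv 23)) (.get i (iv 23))))
      (.setInt 19 (.const 0) (.add (iv 19) (iv 0))))

def mulProg : Prog :=
  .seq (.setInt 2 (.const 0) (.const 0))
    (forLoop 23 1 (.setInt 2 (.add (iv 23) (.const 1)) (.add (.get 2 (iv 23)) (iv 0))))

def powProg : Prog :=
  .seq (.setInt 3 (.const 0) (.const 1)) (.seq (forLoop 22 1
    (.seq (.setInt 3 (.add (iv 22) (.const 1)) (.const 0)) (forLoop 23 0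
      (.setInt 3 (.add (iv 22) (.const 1)) (.add (.get 3 (.add (iv 22) (.const 1))) (.get 3 (iv 22)))))))
    (.setInt 10 (.const 0) (.get 3 (iv 1))))

/-- Doubling stops at the first power of 2 that is at least `n`; `n` passes are more than enough. -/
def logProg : Prog :=
  .seq (.setInt 4 (.const 0) (.const 1)) (.seq (.setInt 5 (.const 0) (.const 0)) (forLoop 23 0
    (.ite (.intLT (iv 4) (iv 0)) (.seq (.setInt 4 (.const 0) (.add (iv 4) (iv 4)))
      (.setInt 5 (.const 0) (.add (iv 5) (.const 1)))) .skip)))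

def sizeProg (m D U g : ℕ) : Prog :=
  .seq (.setInt 6 (.const 0) (.add (mulc (2 * g) (.add (iv 5) (.const 1))) (.const 1)))
    (.seq (.setInt 7 (.const 0) (.add (.add (iv 6) (iv 11)) (.const 1)))
      (.setInt 8 (.const 0) (mulc (m * D * (U + 1)) (iv 6))))

/-- The number of advices is exponential in `len`, but `len` is logarithmic in `n`. -/
def countProg (b : ℕ) : Prog :=
  .seq (.setInt 9 (.const 0) (.const 1)) (forLoop 23 8 (.setInt 9 (.const 0) (mulc b (iv 9))))

/-- The ratio is `1 - 2 ^ (-μ)`, so that the next power is obtained by halving and one subtraction,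
without multiplication. -/
def scaleProg (μ : ℕ) : Prog :=
  .seq (.setNum 1 (.const 0) (.const 1)) (forLoop 23 7
    (.setNum 1 (.add (iv 23) (.const 1)) (.sub (.get 1 (iv 23)) (halves μ (.get 1 (iv 23))))))

def initProg (m D U b g μ : ℕ) : Prog :=
  .seq (flattenProg m) (.seq (.setInt 1 (.const 0) (.const m)) (.seq (.setInt 11 (.const 0) (.const U))
    (.seq mulProg (.seq powProg (.seq logProg (.seq (sizeProg m D U g) (.seq (countProg b)
      (scaleProg μ))))))))

def outProg (m : ℕ) : Prog := forLoop 24 10 (.setNum m (iv 24) (.get 11 (iv 24)))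

def mainProg (m D U b g μ : ℕ) : Prog :=
  .seq (initProg m D U b g μ) (.seq (searchProg m D U b) (outProg m))

section
variable {m n B : ℕ} {s : Store} {p : ℕ → ℕ → ℝ}

theorem nums_flatten (i a : ℕ) (ha : a ≠ 0) : (flattenProg i).nums a = false := by
  induction i with
  | zero => rfl
  | succ i ih => simp [flattenProg, Prog.nums, forLoop, ih, ha.symm]

theorem ints_flatten (i a : ℕ) (ha : a ≠ 19) (ha' : a ≠ 23) : (flattenProg i).ints a = false := by
  induction i with
  | zero => simp [flattenProg, Prog.ints, ha.symm]
  | succ i ih => simp [flattenProg, Prog.ints, forLoop, ih, ha.symm, ha'.symm]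

theorem wp_flatten (hn : s.int 0 0 = n) (hp : ∀ i < m, ∀ a < n, s.num i a = p i a) (hB : n ≤ B) :
    ∀ i ≤ m, wp (flattenProg i) B s fun s' => s'.int 19 0 = i * n ∧
      (∀ j < i, ∀ a < n, s'.num 0 (j * n + a) = p j a) ∧ (0 < m → ∀ a < n, s'.num 0 a = p 0 a) := by
  intro i
  induction i with
  | zero =>
    intro _
    exact wp_setInt ⟨by simp [IntExp.eval], fun j hj => absurd hj (by omega), fun h => hp 0 h⟩
  | succ i ih =>
    intro hi
    refine wp_seq ((ih (by omega)).mono fun s₁ hF₁ h₁ => wp_seq ?_)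
    have hm : 0 < m := by omega
    have hn₁ : s₁.int 0 0 = n := by rw [hF₁.int 0 (ints_flatten i 0 (by simp) (by simp)), hn]
    refine wp_for (fun k s' => (∀ j < i, ∀ a < n, s'.num 0 (j * n + a) = p j a) ∧
      (∀ a < k, s'.num 0 (i * n + a) = p i a) ∧ ∀ a < n, s'.num 0 a = p 0 a) hn₁ hB rfl rfl
      (fun _ _ _ h => h) ⟨h₁.2.1, fun a ha => absurd ha (by omega), h₁.2.2 hm⟩
      (fun k hk s₂ hF₂ hv₂ hI₂ => wp_setNum ?_) fun s₂ hF₂ h => wp_setInt ⟨?_, ?_, ?_⟩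
    · have e19 : s₂.int 19 0 = i * n := by rw [hF₂.int 19 rfl]; exact h₁.1
      -- Array `0` is both the target and the home of the marginal `0`. Copying that marginal
      -- changes nothing, and the other rows are written behind it, so all sources are still intact
      -- when they are read.
      have e : s₂.num i k = p i k := by
        by_cases h0 : i = 0
        · subst h0; exact hI₂.2.2 k hk
        · rw [hF₂.num i (by simp [forLoop, Prog.nums, Ne.symm h0]), hF₁.num i (nums_flatten i i h0)]
          exact hp i (by omega) k hk
      simp only [Store.num_writeNum, if_true, IntExp.eval, NumExp.eval, eval_iv, e19, hv₂, e]
      refine ⟨fun j hj a ha => ?_, fun a ha => ?_, fun a ha => ?_⟩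
      · have : (j + 1) * n ≤ i * n := Nat.mul_le_mul_right _ hj
        have h2 : j * n + a ≠ i * n + k := by rw [add_mul] at this; omega
        rw [Function.update_of_ne h2]; exact hI₂.1 j hj a ha
      · rcases Nat.lt_succ_iff_lt_or_eq.1 ha with ha | rfl
        · rw [Function.update_of_ne (by omega)]; exact hI₂.2.1 a ha
        · simp
      · by_cases h2 : a = i * n + k
        · have h0 : i = 0 := by
            by_contra h0
            have : 1 * n ≤ i * n := Nat.mul_le_mul_right _ (by omega)
            omega
          subst h0
          obtain rfl : a = k := by omega
          simp
        · rw [Function.update_of_ne h2]; exact hI₂.2.2 a ha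
    · have e19 : s₂.int 19 0 = i * n := by rw [hF₂.int 19 rfl]; exact h₁.1
      have e0 : s₂.int 0 0 = n := by rw [hF₂.int 0 rfl]; exact hn₁
      simp only [Store.int_writeInt, if_true, IntExp.eval, eval_iv, e19, e0, Function.update_self]
      ring
    · intro j hj
      rcases Nat.lt_succ_iff_lt_or_eq.1 hj with hj | rfl
      · exact h.1 j hj
      · exact h.2.1
    · exact fun _ => h.2.2

theorem wp_mul (hn : s.int 0 0 = n) (hm : s.int 1 0 = m) (hB : m ≤ B) :
    wp mulProg B s fun s' => ∀ i < m, s'.int 2 i = i * n := by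
  refine wp_seq (wp_setInt (wp_for (fun k s' => ∀ i ≤ k, s'.int 2 i = i * n) (N := m)
    hm hB rfl rfl (fun _ _ _ h => h) (fun a ha => ?_) (fun k hk s₁ hF₁ hv₁ hI₁ => wp_setInt
    fun a ha => ?_) fun s' _ h => fun i hi => h i hi.le))
  · obtain rfl : a = 0 := by omega
    simp [IntExp.eval]
  · have e1 : s₁.int 0 0 = n := by rw [hF₁.int 0 rfl]; simpa using hn
    simp only [Store.int_writeInt, if_true, IntExp.eval, eval_iv, hv₁, hI₁ k le_rfl, e1]
    rcases Nat.le_succ_iff_eq_or_le.1 ha with rfl | h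
    · simp; ring
    · rw [Function.update_of_ne (by omega), hI₁ a h]

theorem wp_pow (hn : s.int 0 0 = n) (hm : s.int 1 0 = m) (hB : m ≤ B) (hB' : n ≤ B) :
    wp powProg B s fun s' => (∀ i < m, s'.int 3 i = n ^ i) ∧ s'.int 10 0 = n ^ m := by
  refine wp_seq (wp_setInt (wp_seq (wp_for (fun k s' => ∀ i ≤ k, s'.int 3 i = n ^ i) (N := m)
    hm hB rfl rfl (fun _ _ _ h => h) (fun a ha => ?_) (fun k hk s₁ hF₁ hv₁ hI₁ => wp_seq (wp_setInt ?_))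
    fun s₁ hF₁ h => wp_setInt ⟨fun i hi => h i hi.le, ?_⟩)))
  · obtain rfl : a = 0 := by omega
    simp [IntExp.eval]
  · have e1 : s₁.int 0 0 = n := by rw [hF₁.int 0 rfl]; simpa using hn
    refine wp_for (fun j s' => (∀ i ≤ k, s'.int 3 i = n ^ i) ∧ s'.int 3 (k + 1) = j * n ^ k) (N := n)
      e1 hB' rfl rfl (fun _ _ _ h => h) ⟨fun a ha => ?_, ?_⟩ (fun j hj s₂ hF₂ hv₂ hI₂ => wp_setInt ?_)
      fun s₂ hF₂ h a ha => ?_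
    · have : a ≠ k + 1 := by omega
      simp [IntExp.eval, hv₁, this, hI₁ a ha]
    · simp [IntExp.eval, hv₁]
    · have e22 : s₂.int 22 0 = k := by rw [hF₂.int 22 rfl]; simpa using hv₁
      simp only [Store.int_writeInt, if_true, IntExp.eval, eval_iv, e22, hI₂.2, hI₂.1 k le_rfl]
      refine ⟨fun a ha => ?_, ?_⟩
      · rw [Function.update_of_ne (by omega), hI₂.1 a ha]
      · simp; ring
    · rcases Nat.le_succ_iff_eq_or_le.1 ha with rfl | ha
      · rw [h.2, pow_succ']
      · exact h.1 a ha
  · have e1 : s₁.int 1 0 = m := by rw [hF₁.int 1 rfl]; simpa using hm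
    simp [IntExp.eval, e1, h m le_rfl]

theorem wp_log (hn : s.int 0 0 = n) (hB : n ≤ B) :
    wp logProg B s fun s' => s'.int 5 0 = Nat.clog 2 n := by
  refine wp_seq (wp_setInt (wp_seq (wp_setInt (wp_for (fun k s' =>
    s'.int 4 0 = 2 ^ min k (Nat.clog 2 n) ∧ s'.int 5 0 = min k (Nat.clog 2 n)) (N := n)
    hn hB rfl rfl (fun _ _ _ h => h) (by simp [IntExp.eval]) (fun k hk s₁ hF₁ hv₁ hI₁ => ?_)
    fun s' _ h => ?_))))
  · have e1 : s₁.int 0 0 = n := by rw [hF₁.int 0 rfl]; simpa using hn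
    have hlt : ∀ x, 2 ^ x < n ↔ x < Nat.clog 2 n := fun x => (Nat.lt_clog_iff_pow_lt (by norm_num)).symm
    refine wp_ite (fun h' => wp_seq (wp_setInt (wp_setInt ⟨?_, ?_⟩))) fun h' => wp_skip ?_
    all_goals simp only [Test.Holds, eval_iv, hI₁.1, e1, hlt] at h'
    · have e2 : min (k + 1) (Nat.clog 2 n) = min k (Nat.clog 2 n) + 1 := by omega
      simp [IntExp.eval, hI₁.1, e2, pow_succ]; ring
    · have e2 : min (k + 1) (Nat.clog 2 n) = min k (Nat.clog 2 n) + 1 := by omega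
      simp [IntExp.eval, hI₁.2, e2]
    · have e2 : min (k + 1) (Nat.clog 2 n) = min k (Nat.clog 2 n) := by omega
      rw [e2]; exact hI₁
  · rw [h.2, min_eq_right]
    exact Nat.clog_le_of_le_pow Nat.lt_two_pow_self.le

end

/-- The parameters of the computation on `n` states. -/
noncomputable def params (m D U b g μ n : ℕ) : Par where
  ρ := 1 - 1 / 2 ^ μ
  U := U
  D := D
  B := b
  m := m
  n := n
  K := 2 * g * (Nat.clog 2 n + 1) + 1

section
variable {m D U b g μ n B : ℕ} {s : Store} {p : ℕ → ℕ → ℝ}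

theorem wp_count {l : ℕ} (hl : s.int 8 0 = l) (hB : l ≤ B) :
    wp (countProg b) B s fun s' => s'.int 9 0 = b ^ l := by
  refine wp_seq (wp_setInt (wp_for (fun k s' => s'.int 9 0 = b ^ k) (N := l) hl hB rfl rfl
    (fun _ _ _ h => h) (by simp [IntExp.eval]) (fun k hk s₁ hF₁ hv₁ hI₁ => wp_setInt ?_)
    fun s' _ h => h))
  simp [IntExp.eval, hI₁, pow_succ']

theorem wp_scale {q : ℕ} (hq : s.int 7 0 = q) (hB : q ≤ B) :
    wp (scaleProg μ) B s fun s' => ∀ k ≤ q, s'.num 1 k = (1 - 1 / 2 ^ μ : ℝ) ^ k := by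
  refine wp_seq (wp_setNum (wp_for (fun k s' => ∀ j ≤ k, s'.num 1 j = (1 - 1 / 2 ^ μ : ℝ) ^ j) (N := q)
    hq hB rfl rfl (fun _ _ _ h => h) (fun a ha => ?_) (fun k hk s₁ hF₁ hv₁ hI₁ => wp_setNum
    fun a ha => ?_) fun s' _ h => h))
  · obtain rfl : a = 0 := by omega
    simp [NumExp.eval, IntExp.eval]
  · simp only [Store.num_writeNum, if_true, NumExp.eval, IntExp.eval, eval_iv, hv₁, hI₁ k le_rfl,
      eval_halves]
    rcases Nat.le_succ_iff_eq_or_le.1 ha with rfl | h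
    · simp only [Function.update_self, Nat.succ_eq_add_one, pow_succ]; ring
    · rw [Function.update_of_ne (by omega), hI₁ a h]

theorem wp_init (hm : 0 < m) (hn : s.int 0 0 = n) (hp : ∀ i < m, ∀ a < n, s.num i a = p i a)
    (hB : (params m D U b g μ n).bound ≤ B) :
    wp (initProg m D U b g μ) B s fun s' =>
      Ctx (params m D U b g μ n) p (b ^ (params m D U b g μ n).len) s' := by
  have hb : n ≤ B ∧ m ≤ B ∧ (params m D U b g μ n).Q ≤ B ∧ (params m D U b g μ n).len ≤ B := by
    have h1 : (params m D U b g μ n).n = n := rfl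
    have h2 : (params m D U b g μ n).m = m := rfl
    rw [Par.bound] at hB; omega
  obtain ⟨bn, bm, bQ, bl⟩ := hb
  refine wp_seq ((wp_flatten hn hp bn m le_rfl).mono fun s₁ hF₁ h₁ => wp_seq (wp_setInt (wp_seq
    (wp_setInt (wp_seq ?_)))))
  have n₁ : s₁.int 0 0 = n := by rw [hF₁.int 0 (ints_flatten m 0 (by simp) (by simp)), hn]
  simp only [IntExp.eval]
  refine (wp_mul (n := n) (m := m) (by simpa using n₁) (by simp) bm).mono fun s₂ hF₂ h₂ => wp_seq ?_
  have n₂ : s₂.int 0 0 = n := by rw [hF₂.int 0 rfl]; simpa using n₁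
  have m₂ : s₂.int 1 0 = m := by rw [hF₂.int 1 rfl]; simp
  refine (wp_pow n₂ m₂ bm bn).mono fun s₃ hF₃ h₃ => wp_seq ?_
  have n₃ : s₃.int 0 0 = n := by rw [hF₃.int 0 rfl, n₂]
  refine (wp_log n₃ bn).mono fun s₄ hF₄ h₄ => wp_seq ?_
  have U₄ : s₄.int 11 0 = U := by
    rw [hF₄.int 11 rfl, hF₃.int 11 rfl, hF₂.int 11 rfl]; simp
  refine wp.mono (Q := fun s' => s'.int 6 0 = (params m D U b g μ n).K ∧
    s'.int 7 0 = (params m D U b g μ n).Q ∧ s'.int 8 0 = (params m D U b g μ n).len)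
    (wp_seq (wp_setInt (wp_seq (wp_setInt (wp_setInt ?_))))) fun s₅ hF₅ h₅ => wp_seq ?_
  · refine ⟨?_, ?_, ?_⟩
    · simp [IntExp.eval, h₄, params]
    · simp [IntExp.eval, h₄, U₄, Par.Q, params]
    · simp [IntExp.eval, h₄, Par.len, params]; ring
  refine (wp_count (b := b) h₅.2.2 bl).mono fun s₆ hF₆ h₆ => ?_
  refine (wp_scale (μ := μ) (q := (params m D U b g μ n).Q) ?_ bQ).mono fun s₇ hF₇ h₇ => ?_
  · rw [hF₆.int 7 rfl, h₅.2.1]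
  constructor
  · rw [hF₇.int 0 rfl, hF₆.int 0 rfl, hF₅.int 0 rfl, hF₄.int 0 rfl, n₃]; rfl
  · rw [hF₇.int 1 rfl, hF₆.int 1 rfl, hF₅.int 1 rfl, hF₄.int 1 rfl, hF₃.int 1 rfl, m₂]; rfl
  · rw [hF₇.int 2 rfl, hF₆.int 2 rfl, hF₅.int 2 rfl, hF₄.int 2 rfl, hF₃.int 2 rfl]; exact h₂
  · rw [hF₇.int 3 rfl, hF₆.int 3 rfl, hF₅.int 3 rfl, hF₄.int 3 rfl]; exact h₃.1
  · rw [hF₇.int 6 rfl, hF₆.int 6 rfl]; exact h₅.1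
  · rw [hF₇.int 7 rfl, hF₆.int 7 rfl]; exact h₅.2.1
  · rw [hF₇.int 8 rfl, hF₆.int 8 rfl]; exact h₅.2.2
  · rw [hF₇.int 9 rfl]; exact h₆
  · rw [hF₇.int 10 rfl, hF₆.int 10 rfl, hF₅.int 10 rfl, hF₄.int 10 rfl]; exact h₃.2
  · rw [hF₇.int 11 rfl, hF₆.int 11 rfl, hF₅.int 11 rfl]; exact U₄
  · rw [hF₇.num 0 rfl, hF₆.num 0 rfl, hF₅.num 0 rfl, hF₄.num 0 rfl, hF₃.num 0 rfl, hF₂.num 0 rfl]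
    exact h₁.2.1
  · exact fun k hk => h₇ k hk.le

theorem wp_out {N : ℕ} (hN : s.int 10 0 = N) (hB : N ≤ B) {T : ℕ → ℝ}
    (hT : ∀ c < N, s.num 11 c = T c) :
    wp (outProg m) B s fun s' => ∀ c < N, s'.num m c = T c := by
  refine wp_for (fun k s' => (∀ c < k, s'.num m c = T c) ∧ ∀ c < N, s'.num 11 c = T c) hN hB rfl rfl
    (fun _ _ _ h => h) ⟨fun c hc => absurd hc (by omega), hT⟩ (fun k hk s₁ hF₁ hv₁ hI₁ => wp_setNum ?_)
    fun s' _ h => h.1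
  simp only [Store.num_writeNum, if_true, NumExp.eval, eval_iv, hv₁, hI₁.2 k hk]
  refine ⟨fun c hc => ?_, fun c hc => ?_⟩
  · rcases Nat.lt_succ_iff_lt_or_eq.1 hc with hc | rfl
    · rw [Function.update_of_ne hc.ne, hI₁.1 c hc]
    · simp
  -- The output array `m` may be the array `11` that is being copied; each cell is then overwritten
  -- with its own value.
  · split_ifs with h
    · by_cases hck : c = k
      · subst hck; simp
      · rw [Function.update_of_ne hck, ← h]; exact hI₁.2 c hc
    · exact hI₁.2 c hc

theorem wp_main (hm : 0 < m) (hb : 0 < b) (hD : 0 < D) (hn : s.int 0 0 = n)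
    (hp : ∀ i < m, ∀ a < n, s.num i a = p i a) (hp0 : ∀ i a, 0 ≤ p i a) (h13 : ∀ b, s.int 13 b = 0) :
    wp (mainProg m D U b g μ) (params m D U b g μ n).bound s fun s' =>
      ∃ w, w < b ^ (params m D U b g μ n).len ∧
      (∀ c < n ^ m, s'.num m c =
        (params m D U b g μ n).table ((params m D U b g μ n).digits w) p c) ∧
      ∀ w' < b ^ (params m D U b g μ n).len,
        (params m D U b g μ n).cost
          ((params m D U b g μ n).table ((params m D U b g μ n).digits w) p) ≤
        (params m D U b g μ n).cost
          ((params m D U b g μ n).table ((params m D U b g μ n).digits w') p) := by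
  have hρ : 0 ≤ (params m D U b g μ n).ρ := by
    have : (1 : ℝ) / 2 ^ μ ≤ 1 := by
      rw [div_le_one (by positivity)]; exact one_le_pow₀ (by norm_num)
    simp only [params]; linarith
  have hN : n ^ m ≤ (params m D U b g μ n).bound := by
    have h1 : (params m D U b g μ n).n = n := rfl
    have h2 : (params m D U b g μ n).m = m := rfl
    rw [Par.bound, h1, h2]; omega
  refine wp_seq ((wp_init hm hn hp le_rfl).mono fun s₁ hF₁ hc => wp_seq ?_)
  have h13' : ∀ b, s₁.int 13 b = 0 := by
    rw [hF₁.int 13 ?_]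
    · exact h13
    · have := ints_flatten m 13 (by simp) (by simp)
      simp only [initProg, Prog.ints, this, Bool.false_or]; rfl
  refine (wp_search hc hb hD hρ hp0 fun b _ => h13' b).mono fun s₂ hF₂ h₂ => ?_
  obtain ⟨w, hw, hT, hmin⟩ := h₂
  exact (wp_out (hc.frame hF₂ rfl rfl).states hN hT).mono fun s₃ _ h => ⟨w, hw, h, hmin⟩

end

open Filter Topology

/-! ### Cost and entropy -/

/-- The couplings form a compact set, a closed part of the simplex, and the entropy is continuous,
also at zero probabilities. -/
theorem exists_isMinEntropyCoupling {m n : ℕ} {p : Fin m → Fin n → ℝ}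
    (h : ∃ q, IsCoupling p q) : ∃ q, IsMinEntropyCoupling p q := by
  have hc : IsCompact {q | IsCoupling p q} := by
    have e : {q | IsCoupling p q} = stdSimplex ℝ (Fin m → Fin n) ∩
        ⋂ i, ⋂ a, {q | ∑ x with x i = a, q x = p i a} := by
      ext q; simp [IsCoupling]
    rw [e]
    refine (isCompact_stdSimplex ℝ (Fin m → Fin n)).inter_right ?_
    exact isClosed_iInter fun i => isClosed_iInter fun a =>
      isClosed_eq (continuous_finsetSum _ fun x _ => continuous_apply x) continuous_const
  have hcont : Continuous fun q : (Fin m → Fin n) → ℝ => entropy q := by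
    simp only [entropy_eq_sum_eta]
    exact continuous_finsetSum _ fun x _ => continuous_eta.comp (continuous_apply x)
  obtain ⟨q, hq, hmin⟩ := hc.exists_isMinOn h hcont.continuousOn
  exact ⟨q, hq, fun r hr => hmin hr⟩

namespace Par
variable {P : Par} {p : ℕ → ℕ → ℝ}

/-- Advices vanish beyond `len`, so they are exactly the digit expansions that the search
enumerates. -/
theorem exists_digits_eq {adv : ℕ → ℕ} (hb : 0 < P.B) (hadv : ∀ b, adv b < P.B)
    (hlen : ∀ b, P.len ≤ b → adv b = 0) : ∃ w < P.B ^ P.len, P.digits w = adv := by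
  set w := finFunctionFinEquiv fun b : Fin P.len => (⟨adv b, hadv b⟩ : Fin P.B) with hw
  refine ⟨w, w.2, funext fun b => ?_⟩
  rcases lt_or_ge b P.len with h | h
  · have := finFunctionFinEquiv_symm_apply_val w ⟨b, h⟩
    rw [hw, Equiv.symm_apply_apply] at this
    exact this.symm
  · rw [hlen b h, digits, Nat.div_eq_of_lt, Nat.zero_mod]
    exact w.2.trans_le (Nat.pow_le_pow_right hb h)

theorem cost_eq_sum (T : ℕ → ℝ) : P.cost T = ∑ x : Fin P.m → Fin P.n,
    P.cls (T (∑ i, (x i : ℕ) * P.n ^ (i : ℕ))) * T (∑ i, (x i : ℕ) * P.n ^ (i : ℕ)) := by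
  rw [cost, Finset.sum_range]
  refine (Fintype.sum_equiv finFunctionFinEquiv _ _ fun x => ?_).symm
  rw [finFunctionFinEquiv_apply]

/-- A mass of positive class lies below `ρ ^ (cls - 1)`, so the class overestimates the logarithm by
at most one step. -/
theorem mul_cls_mul_le (h0 : 0 < P.ρ) (h1 : P.ρ < 1) {x : ℝ} (hx0 : 0 ≤ x) (hx1 : x ≤ 1) :
    Real.logb 2 (1 / P.ρ) * (P.cls x * x) ≤ eta x + Real.logb 2 (1 / P.ρ) * x := by
  have hl : 0 ≤ Real.logb 2 (1 / P.ρ) :=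
    Real.logb_nonneg (by norm_num) (by rw [le_div_iff₀ h0]; linarith)
  rcases hx0.eq_or_lt with rfl | hx
  · simp
  rcases Nat.eq_zero_or_pos (P.cls x) with h | h
  · have := eta_nonneg hx0 hx1
    rw [h]; simp only [Nat.cast_zero, zero_mul, mul_zero]; positivity
  · have h2 : x < P.ρ ^ (P.cls x - 1) :=
      (lt_cls_iff h0 h1 (by have := P.cls_le x; omega)).2 (by omega)
    have h3 : Real.logb 2 ((1 / P.ρ) ^ (P.cls x - 1)) ≤ Real.logb 2 (1 / x) := by
      refine Real.logb_le_logb_of_le (by norm_num) (by positivity) ?_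
      rw [one_div_pow]
      exact one_div_le_one_div_of_le hx h2.le
    rw [Real.logb_pow, Nat.cast_sub h] at h3
    have := mul_le_mul_of_nonneg_left h3 hx0
    rw [eta]
    push_cast at this
    linarith

/-- Below class `K` the mass is at least `ρ ^ cls`. In class `K` it is below `ρ ^ (2 * G)`, and the
square root bound for `eta` leaves `ρ ^ G`; this explains the form `2 * G + 1` of `K`. -/
theorem eta_le_mul_cls (h0 : 0 < P.ρ) (h1 : P.ρ < 1) {G : ℕ} (hK : P.K = 2 * G + 1) {x : ℝ}
    (hx0 : 0 ≤ x) : eta x ≤ Real.logb 2 (1 / P.ρ) * (P.cls x * x) + 3 * P.ρ ^ G := by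
  have hl : 0 ≤ Real.logb 2 (1 / P.ρ) :=
    Real.logb_nonneg (by norm_num) (by rw [le_div_iff₀ h0]; linarith)
  rcases (P.cls_le x).lt_or_eq with h | h
  · have h2 := pow_cls_le h0 h1 h
    have h4 := pow_pos h0 (P.cls x)
    have h3 : Real.logb 2 (1 / x) ≤ Real.logb 2 ((1 / P.ρ) ^ P.cls x) := by
      refine Real.logb_le_logb_of_le (by norm_num) (one_div_pos.2 (h4.trans_le h2)) ?_
      rw [one_div_pow]
      exact one_div_le_one_div_of_le h4 h2
    rw [Real.logb_pow] at h3
    have := mul_le_mul_of_nonneg_left h3 hx0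
    have := pow_pos h0 G
    rw [eta]
    linarith
  · have h2 : x < P.ρ ^ (2 * G) := (lt_cls_iff h0 h1 (by omega)).2 (by omega)
    have h3 : √x ≤ P.ρ ^ G := by
      rw [Real.sqrt_le_left (by positivity), ← pow_mul, mul_comm]; exact h2.le
    have := eta_le_sqrt hx0
    have : 0 ≤ Real.logb 2 (1 / P.ρ) * (P.cls x * x) := by positivity
    linarith

/-- A table of almost least cost has almost least entropy. -/
theorem entropy_le_of_cost_le (h0 : 0 < P.ρ) (h1 : P.ρ < 1) {G : ℕ} (hK : P.K = 2 * G + 1)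
    {q r : (Fin P.m → Fin P.n) → ℝ} (hq : ∀ x, 0 ≤ q x) (hr : r ∈ stdSimplex ℝ (Fin P.m → Fin P.n))
    (h : ∑ x, P.cls (q x) * q x ≤ ∑ x, P.cls (r x) * r x) :
    entropy q ≤ entropy r + Real.logb 2 (1 / P.ρ) + 3 * ((P.n : ℝ) ^ P.m * P.ρ ^ G) := by
  have hl : 0 ≤ Real.logb 2 (1 / P.ρ) :=
    Real.logb_nonneg (by norm_num) (by rw [le_div_iff₀ h0]; linarith)
  have hr1 : ∀ x, r x ≤ 1 := fun x => by
    rw [← hr.2]; exact Finset.single_le_sum (fun y _ => hr.1 y) (Finset.mem_univ x)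
  have h2 : entropy q ≤ Real.logb 2 (1 / P.ρ) * ∑ x, P.cls (q x) * q x +
      3 * ((P.n : ℝ) ^ P.m * P.ρ ^ G) := by
    rw [entropy_eq_sum_eta]
    refine (Finset.sum_le_sum fun x _ => eta_le_mul_cls h0 h1 hK (hq x)).trans (le_of_eq ?_)
    rw [Finset.sum_add_distrib, Finset.mul_sum, Finset.sum_const, Finset.card_univ]
    simp; ring
  have h3 : Real.logb 2 (1 / P.ρ) * ∑ x, P.cls (r x) * r x ≤ entropy r + Real.logb 2 (1 / P.ρ) := by
    rw [Finset.mul_sum]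
    refine (Finset.sum_le_sum fun x _ => mul_cls_mul_le h0 h1 (hr.1 x) (hr1 x)).trans (le_of_eq ?_)
    rw [Finset.sum_add_distrib, ← Finset.mul_sum, hr.2, mul_one, entropy_eq_sum_eta]
  have := mul_le_mul_of_nonneg_left h hl
  linarith

/-- The large part has a small logarithm, and the small part is bounded through its square root;
both bounds tend to `0` as `ρ` tends to `1`. -/
theorem eta_add_eta_le (h0 : 0 < P.ρ) (h1 : P.ρ < 1) {x : ℝ} (hx : P.ρ ^ 2 ≤ x) (hx' : x ≤ P.ρ) :
    eta x + eta (1 - x) ≤ 2 * Real.logb 2 (1 / P.ρ) + 3 * √(1 - P.ρ ^ 2) := by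
  have hp : 0 < P.ρ ^ 2 := by positivity
  have hl : 0 ≤ Real.logb 2 (1 / P.ρ) :=
    Real.logb_nonneg (by norm_num) (by rw [le_div_iff₀ h0]; linarith)
  have h2 : Real.logb 2 (1 / x) ≤ 2 * Real.logb 2 (1 / P.ρ) := by
    have : Real.logb 2 (1 / x) ≤ Real.logb 2 ((1 / P.ρ) ^ 2) := by
      refine Real.logb_le_logb_of_le (by norm_num) (one_div_pos.2 (hp.trans_le hx)) ?_
      rw [one_div_pow]
      exact one_div_le_one_div_of_le hp hx
    rwa [Real.logb_pow, Nat.cast_ofNat] at this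
  have h3 : eta x ≤ 2 * Real.logb 2 (1 / P.ρ) := by
    rw [eta]
    calc x * Real.logb 2 (1 / x) ≤ x * (2 * Real.logb 2 (1 / P.ρ)) :=
          mul_le_mul_of_nonneg_left h2 (hp.le.trans hx)
      _ ≤ 1 * (2 * Real.logb 2 (1 / P.ρ)) := by gcongr; linarith
      _ = _ := one_mul _
  have h4 : eta (1 - x) ≤ 3 * √(1 - x) := eta_le_sqrt (by linarith)
  have h5 : √(1 - x) ≤ √(1 - P.ρ ^ 2) := Real.sqrt_le_sqrt (by linarith)
  linarith

/-- The entropy of the coupling of a good advice, in terms of `κ ≥ n ^ (m + 1) ρ ^ G`. -/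
theorem entropy_le_of_goodAdvice (h0 : 1 / 2 ≤ P.ρ) (h1 : P.ρ < 1) (hD : 0 < P.D) (hn : 0 < P.n)
    {G : ℕ} (hK : P.K = 2 * G + 1) {q r : (Fin P.m → Fin P.n) → ℝ} {adv : ℕ → ℕ}
    (hq : IsCouplingOf p q) (hp0 : ∀ i a, 0 ≤ p i a) (hadv : ∀ b, P.len ≤ b → adv b = 0)
    (hg : ∀ i, ∃ σ M, GoodAdvice p q adv i σ M) (hr : ∀ x, 0 ≤ r x)
    (hq' : P.coupling adv p ∈ stdSimplex ℝ (Fin P.m → Fin P.n))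
    (hcost : ∑ x, P.cls (r x) * r x ≤ ∑ x, P.cls (P.coupling adv p x) * P.coupling adv p x)
    {κ : ℝ} (hκ : (P.n : ℝ) ^ (P.m + 1) * P.ρ ^ G ≤ κ) (hκ1 : (P.n : ℝ) * P.ρ ^ G ≤ 1) :
    entropy r ≤ entropy q + (3 * Real.logb 2 (1 / P.ρ) + 3 * √(1 - P.ρ ^ 2) + 16 * P.m * (1 - P.ρ)) +
      10 * P.m * P.ρ ^ P.U + P.m * ((5 + 8 * (1 - P.ρ) / P.ρ ^ P.U) * (2 * P.patterns / P.D)) +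
      (6 + P.m) * κ := by
  have h00 : 0 < P.ρ := by linarith
  have hn1 : (1 : ℝ) ≤ P.n := by exact_mod_cast hn
  have hθ := pow_pos h00 G
  have hθ1 : P.ρ ^ G ≤ 1 := pow_le_one₀ h00.le h1.le
  have hnm : (1 : ℝ) ≤ (P.n : ℝ) ^ P.m := one_le_pow₀ hn1
  have hU := pow_pos h00 P.U
  have e1 : (P.n : ℝ) ^ P.m * P.ρ ^ G ≤ κ := by
    refine le_trans ?_ hκ
    rw [pow_succ]
    gcongr
    exact le_mul_of_one_le_right (by positivity) hn1
  have ht0 := tinyMass_nonneg (P := P) hq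
  -- With `K = 2 * G + 1` the tiny mass carries `ρ ^ G` twice: one factor survives the square root
  -- in the bound for `eta`.
  have ht : P.tinyMass q ≤ (P.n : ℝ) ^ P.m * (P.ρ ^ G) ^ 2 := by
    have := tinyMass_le (q := q) h00 h1 (by omega)
    rwa [hK, Nat.add_sub_cancel, mul_comm 2 G, pow_mul] at this
  have ht2 : P.n * P.tinyMass q ≤ κ := by
    refine le_trans ?_ hκ
    calc P.n * P.tinyMass q ≤ P.n * ((P.n : ℝ) ^ P.m * (P.ρ ^ G) ^ 2) := by gcongr
      _ = (P.n : ℝ) ^ (P.m + 1) * (P.ρ ^ G * P.ρ ^ G) := by ring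
      _ ≤ (P.n : ℝ) ^ (P.m + 1) * (P.ρ ^ G * 1) := by gcongr
      _ = _ := by ring
  have ht3 : eta (P.tinyMass q) ≤ 3 * κ := by
    refine (eta_le_sqrt ht0).trans ?_
    have : √(P.tinyMass q) ≤ (P.n : ℝ) ^ P.m * P.ρ ^ G := by
      rw [Real.sqrt_le_left (by positivity)]
      refine ht.trans ?_
      rw [mul_pow]
      gcongr
      nlinarith
    linarith
  have hnK : P.n * P.ρ ^ P.K ≤ 1 := by
    refine le_trans ?_ hκ1
    have : P.ρ ^ P.K ≤ P.ρ ^ G := pow_le_pow_of_le_one h00.le h1.le (by omega)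
    gcongr
  have h2 := entropy_le_of_cost_le h00 h1 hK hr hq' hcost
  have h3 := entropy_coupling_le h0 h1 hD hq hp0 hadv hg fun x hx hx' => eta_add_eta_le h00 h1 hx hx'
  have hA : 0 ≤ 5 + 8 * (1 - P.ρ) / P.ρ ^ P.U := by
    have := div_nonneg (by linarith : 0 ≤ 8 * (1 - P.ρ)) hU.le
    linarith
  have h4 : (5 + 8 * (1 - P.ρ) / P.ρ ^ P.U) * (P.ρ ^ P.U * (1 + P.n * P.ρ ^ P.K) + 2 * P.patterns / P.D) +
      P.n * P.tinyMass q ≤ 10 * P.ρ ^ P.U + 16 * (1 - P.ρ) +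
        (5 + 8 * (1 - P.ρ) / P.ρ ^ P.U) * (2 * P.patterns / P.D) + κ := by
    have h5 : (5 + 8 * (1 - P.ρ) / P.ρ ^ P.U) * (P.ρ ^ P.U * (1 + P.n * P.ρ ^ P.K)) ≤
        (5 + 8 * (1 - P.ρ) / P.ρ ^ P.U) * (P.ρ ^ P.U * 2) := by gcongr; linarith
    -- The factor `ρ ^ U` gained by late entry cancels the division by `ρ ^ U` in the leftover term.
    -- What remains is of order `1 - ρ`, independently of `U`, so `U` can be chosen after `ρ`.
    have h6 : (5 + 8 * (1 - P.ρ) / P.ρ ^ P.U) * (P.ρ ^ P.U * 2) =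
        10 * P.ρ ^ P.U + 16 * (1 - P.ρ) := by field_simp; ring
    rw [mul_add]
    linarith
  have h7 := mul_le_mul_of_nonneg_left h4 (Nat.cast_nonneg P.m : (0 : ℝ) ≤ P.m)
  linarith

end Par

/-! ### The choice of the constants -/

/-- The order of choice matters. First `ρ` is taken close to 1, which settles the binary entropy,
the rounding of the cost and the leftovers. Then `U` makes `ρ ^ U` small, `g` makes `ρ ^ g` small,
and `b` bounds the number of pieces. The number of groups `D` comes last, since it must beat the
number of patterns, which depends on `U` and `b`. -/
theorem exists_constants (m : ℕ) {ε : ℝ} (hε : 0 < ε) :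
    ∃ μ U D b g : ℕ, 1 ≤ μ ∧ 0 < D ∧ 2 ≤ b ∧ 1 ≤ b * (1 - 1 / 2 ^ μ : ℝ) ^ U ∧
      3 * Real.logb 2 (1 / (1 - 1 / 2 ^ μ)) + 3 * √(1 - (1 - 1 / 2 ^ μ) ^ 2) +
        16 * m * (1 - (1 - 1 / 2 ^ μ)) ≤ ε / 4 ∧
      10 * m * (1 - 1 / 2 ^ μ : ℝ) ^ U ≤ ε / 4 ∧
      m * ((5 + 8 * (1 - (1 - 1 / 2 ^ μ)) / (1 - 1 / 2 ^ μ) ^ U) *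
        (2 * (Fintype.card (Fin U → Fin b) : ℝ) / D)) ≤ ε / 4 ∧
      (1 - 1 / 2 ^ μ : ℝ) ^ g ≤ (1 / 2) ^ (m + 1) ∧ (6 + m) * (1 - 1 / 2 ^ μ : ℝ) ^ g ≤ ε / 4 := by
  have hlim : Tendsto (fun μ : ℕ => (1 - 1 / 2 ^ μ : ℝ)) atTop (𝓝 1) := by
    have := (tendsto_pow_atTop_nhds_zero_of_lt_one (r := (1 / 2 : ℝ)) (by norm_num)
      (by norm_num)).const_sub 1
    simpa using this
  have hcont : ContinuousAt (fun ρ : ℝ => 3 * Real.logb 2 (1 / ρ) + 3 * √(1 - ρ ^ 2) +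
      16 * m * (1 - ρ)) 1 := by
    have : ContinuousAt (fun ρ : ℝ => Real.logb 2 (1 / ρ)) 1 := by
      unfold Real.logb
      exact ((continuousAt_const.div continuousAt_id one_ne_zero).log (by norm_num)).div_const _
    fun_prop
  have hlim2 := hcont.tendsto.comp hlim
  simp only [div_one, Real.logb_one, mul_zero, one_pow, sub_self, Real.sqrt_zero, add_zero] at hlim2
  have hε4 : 0 < ε / 4 := by positivity
  obtain ⟨μ, hμ, hμ1⟩ := ((hlim2.eventually (ge_mem_nhds hε4)).and (eventually_ge_atTop 1)).exists
  have hpow : (1 : ℝ) / 2 ^ μ ≤ 1 / 2 := by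
    refine one_div_le_one_div_of_le (by norm_num) ?_
    calc (2 : ℝ) = 2 ^ 1 := by norm_num
      _ ≤ 2 ^ μ := pow_le_pow_right₀ (by norm_num) hμ1
  set ρ : ℝ := 1 - 1 / 2 ^ μ with hρ
  have h0 : 0 < ρ := by linarith
  have h1 : ρ < 1 := by
    have : (0 : ℝ) < 1 / 2 ^ μ := by positivity
    linarith
  have hp := tendsto_pow_atTop_nhds_zero_of_lt_one h0.le h1
  have hp' : ∀ c : ℝ, Tendsto (fun k : ℕ => c * ρ ^ k) atTop (𝓝 0) := fun c => by
    simpa using hp.const_mul c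
  obtain ⟨U, hU⟩ := ((hp' (10 * m)).eventually (ge_mem_nhds hε4)).exists
  obtain ⟨g, hg, hg'⟩ := ((hp.eventually (ge_mem_nhds (by positivity : (0 : ℝ) < (1 / 2) ^ (m + 1)))).and
    ((hp' (6 + m)).eventually (ge_mem_nhds hε4))).exists
  obtain ⟨b, hb⟩ := exists_nat_ge (1 / ρ ^ U)
  have hD : Tendsto (fun D : ℕ => m * ((5 + 8 * (1 - ρ) / ρ ^ U) *
        (2 * (Fintype.card (Fin U → Fin (b + 2)) : ℝ) / D))) atTop (𝓝 0) := by
    have := ((tendsto_const_div_atTop_nhds_zero_nat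
      (2 * (Fintype.card (Fin U → Fin (b + 2)) : ℝ))).const_mul
        (5 + 8 * (1 - ρ) / ρ ^ U)).const_mul (m : ℝ)
    simpa using this
  obtain ⟨D, hD, hD1⟩ := ((hD.eventually (ge_mem_nhds hε4)).and (eventually_gt_atTop 0)).exists
  refine ⟨μ, U, D, b + 2, g, hμ1, hD1, by omega, ?_, hμ, hU, hD, hg, hg'⟩
  rw [div_le_iff₀ (by positivity)] at hb
  push_cast
  have := pow_pos h0 U
  linarith

/-! ### Polynomial bounds -/

/-- The function is bounded by a polynomial on the positive integers. -/
def PolyBounded (f : ℕ → ℕ) : Prop := ∃ C : ℕ, ∀ n, 0 < n → f n ≤ C * n ^ C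

namespace PolyBounded

theorem of_le {f : ℕ → ℕ} (c d : ℕ) (h : ∀ n, 0 < n → f n ≤ c * n ^ d) : PolyBounded f :=
  ⟨c + d, fun n hn => (h n hn).trans
    (Nat.mul_le_mul (Nat.le_add_right _ _) (Nat.pow_le_pow_right hn (Nat.le_add_left _ _)))⟩

theorem const (c : ℕ) : PolyBounded fun _ => c := of_le c 0 fun n _ => by simp

theorem id : PolyBounded fun n => n := of_le 1 1 fun n _ => by simp

theorem add {f g : ℕ → ℕ} (hf : PolyBounded f) (hg : PolyBounded g) :
    PolyBounded fun n => f n + g n := by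
  obtain ⟨C, hC⟩ := hf
  obtain ⟨C', hC'⟩ := hg
  refine of_le (C + C') (C + C') fun n hn => (Nat.add_le_add (hC n hn) (hC' n hn)).trans ?_
  rw [add_mul]
  gcongr <;> omega

theorem mul {f g : ℕ → ℕ} (hf : PolyBounded f) (hg : PolyBounded g) :
    PolyBounded fun n => f n * g n := by
  obtain ⟨C, hC⟩ := hf
  obtain ⟨C', hC'⟩ := hg
  refine of_le (C * C') (C + C') fun n hn => (Nat.mul_le_mul (hC n hn) (hC' n hn)).trans
    (le_of_eq (by ring))

theorem pow {f : ℕ → ℕ} (hf : PolyBounded f) (d : ℕ) : PolyBounded fun n => f n ^ d := by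
  induction d with
  | zero => simpa using const 1
  | succ d ih => simpa [pow_succ] using ih.mul hf

theorem mono {f g : ℕ → ℕ} (hg : PolyBounded g) (h : ∀ n, 0 < n → f n ≤ g n) : PolyBounded f := by
  obtain ⟨C, hC⟩ := hg
  exact ⟨C, fun n hn => (h n hn).trans (hC n hn)⟩

end PolyBounded

theorem two_pow_clog_le {n : ℕ} (hn : 0 < n) : 2 ^ Nat.clog 2 n ≤ 2 * n := by
  rcases Nat.lt_or_ge 1 n with h | h
  · have h1 := Nat.pow_pred_clog_lt_self (b := 2) (by norm_num) h
    have h2 : 0 < Nat.clog 2 n := Nat.clog_pos (by norm_num) h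
    rw [← Nat.succ_pred_eq_of_pos h2, pow_succ]
    omega
  · obtain rfl : n = 1 := by omega
    simp

theorem polyBounded_bound (m D U b g μ : ℕ) (hb : 0 < b) :
    PolyBounded fun n => (params m D U b g μ n).bound := by
  have hn := PolyBounded.id
  have hL : PolyBounded fun n => Nat.clog 2 n :=
    hn.mono fun n _ => Nat.clog_le_of_le_pow Nat.lt_two_pow_self.le
  have hK : PolyBounded fun n => (params m D U b g μ n).K :=
    ((PolyBounded.const (2 * g)).mul (hL.add (.const 1))).add (.const 1)
  have hQ : PolyBounded fun n => (params m D U b g μ n).Q := (hK.add (.const U)).add (.const 1)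
  have hl : PolyBounded fun n => (params m D U b g μ n).len :=
    ((hK.mul (.const m)).mul (.const D)).mul (.const (U + 1))
  have hF : PolyBounded fun n => (params m D U b g μ n).fragBound :=
    (hQ.mul ((hn.mul (.const b)).add (hQ.mul hn))).add (hQ.mul hn)
  -- The length of the advice is at most `e * (clog n + 1)` with `e` constant, and `2 ^ (clog n + 1)
  -- ≤ 4 * n`; so the number of advices is at most `4 * n` to the constant power `b ^ e`.
  have hW : PolyBounded fun n => b ^ (params m D U b g μ n).len := by
    set e := (2 * g + 1) * m * D * (U + 1) with he
    refine (((PolyBounded.const 4).mul hn).pow (b ^ e)).mono fun n hn => ?_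
    have h1 : (params m D U b g μ n).len ≤ e * (Nat.clog 2 n + 1) := by
      have : (params m D U b g μ n).K ≤ (2 * g + 1) * (Nat.clog 2 n + 1) := by
        simp only [params]; rw [add_mul, one_mul]; omega
      calc (params m D U b g μ n).K * m * D * (U + 1) ≤
            (2 * g + 1) * (Nat.clog 2 n + 1) * m * D * (U + 1) := by gcongr
        _ = _ := by rw [he]; ring
    calc b ^ (params m D U b g μ n).len ≤ b ^ (e * (Nat.clog 2 n + 1)) := Nat.pow_le_pow_right hb h1
      _ = (b ^ e) ^ (Nat.clog 2 n + 1) := pow_mul _ _ _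
      _ ≤ (2 ^ b ^ e) ^ (Nat.clog 2 n + 1) := Nat.pow_le_pow_left Nat.lt_two_pow_self.le _
      _ = (2 ^ (Nat.clog 2 n + 1)) ^ b ^ e := by rw [← pow_mul, ← pow_mul, mul_comm]
      _ ≤ (4 * n) ^ b ^ e := by
        refine Nat.pow_le_pow_left ?_ _
        have := two_pow_clog_le hn
        rw [pow_succ]; omega
  exact ((((((((hW.add (hn.pow m)).add hl).add (.const b)).add hn).add (.const m)).add hQ).add
    (hn.mul (.const b))).add ((hF.add (.const 1)).pow m)).add hF

/-- Links what the program computes with the measure-theoretic coupling that the entropy estimates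
speak of. -/
theorem Par.table_eq_coupling {P : Par} {p : ℕ → ℕ → ℝ} {adv : ℕ → ℕ} (hρ : 0 ≤ P.ρ)
    (hp0 : ∀ i a, 0 ≤ p i a) (ht : ∀ i : Fin P.m, total (P.line adv p i).frags = 1)
    (x : Fin P.m → Fin P.n) :
    P.table adv p (∑ i, (x i : ℕ) * P.n ^ (i : ℕ)) = P.coupling adv p x :=
  weight_overlay (fun i _ _ ha => LineData.frags_mem (d := P.line adv p i)
    (fun _ => pow_nonneg hρ _) (fun b => rem_nonneg (hp0 i) b) ha) (fun i hi => ht ⟨i, hi⟩) x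

end MinEntropyCoupling

open MinEntropyCoupling in
theorem mainTheorem2 (m : ℕ) (hm : 2 ≤ m) (ε : ℝ) (hε : 0 < ε) :
    ∃ (P : MinEntropyCoupling.Prog) (C : ℕ),
      ∀ (n : ℕ) (p : Fin m → Fin n → ℝ), (∀ i, p i ∈ stdSimplex ℝ (Fin n)) →
        ∃ (t : ℕ) (s : MinEntropyCoupling.Store),
          MinEntropyCoupling.Run P (MinEntropyCoupling.inputStore p) t s ∧
          t ≤ C * n ^ C ∧
          MinEntropyCoupling.IsCoupling p (MinEntropyCoupling.outputTable m n s) ∧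
          ∃ opt : (Fin m → Fin n) → ℝ,
            MinEntropyCoupling.IsMinEntropyCoupling p opt ∧
            MinEntropyCoupling.entropy (MinEntropyCoupling.outputTable m n s) ≤
              MinEntropyCoupling.entropy opt + ε := by
  obtain ⟨μ, U, D, b, g, hμ, hD, hb, hbU, c1, c2, c3, c4, c5⟩ := exists_constants m hε
  obtain ⟨c, d, htime⟩ := Prog.exists_time_le (mainProg m D U b g μ)
  obtain ⟨C, hC⟩ := (PolyBounded.const c).mul
    (((polyBounded_bound m D U b g μ (by omega)).add (.const 1)).pow d)
  refine ⟨mainProg m D U b g μ, C, fun n p hp => ?_⟩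
  -- There is no probability distribution on the empty set, so the time bound is only needed for
  -- positive `n`.
  have hn : 0 < n := by
    by_contra h
    obtain rfl : n = 0 := by omega
    have := (hp ⟨0, by omega⟩).2
    simp at this
  set p' : ℕ → ℕ → ℝ := (inputStore p).num with hp'
  have hpe : ∀ (i : Fin m) (a : Fin n), p' i a = p i a := fun i a => by
    simp [p', inputStore]
  have hp0 : ∀ i a, 0 ≤ p' i a := fun i a => by
    simp only [p', inputStore]
    split_ifs with h
    · exact (hp _).1 _
    · exact le_rfl
  obtain ⟨t, s, hrun, ht, w, hw, hout, hmin⟩ := wp_main (m := m) (D := D) (U := U) (b := b) (g := g)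
    (μ := μ) (n := n) (s := inputStore p) (p := p') (by omega) (by omega) hD (by simp [inputStore])
    (fun _ _ _ _ => rfl) hp0 (by simp [inputStore])
  set P : Par := params m D U b g μ n with hP
  have hpow : (1 : ℝ) / 2 ^ μ ≤ 1 / 2 := by
    refine one_div_le_one_div_of_le (by norm_num) ?_
    calc (2 : ℝ) = 2 ^ 1 := by norm_num
      _ ≤ 2 ^ μ := pow_le_pow_right₀ (by norm_num) hμ
  have hρ0 : 1 / 2 ≤ P.ρ := by change 1 / 2 ≤ 1 - 1 / (2 : ℝ) ^ μ; linarith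
  have hρ1 : P.ρ < 1 := by
    have : (0 : ℝ) < 1 / 2 ^ μ := by positivity
    change 1 - 1 / (2 : ℝ) ^ μ < 1; linarith
  have hρ : 0 < P.ρ := by linarith
  have hlen : ∀ w < b ^ P.len, ∀ j, P.len ≤ j → P.digits w j = 0 := by
    intro w hw j hj
    rw [Par.digits, Nat.div_eq_of_lt, Nat.zero_mod]
    exact hw.trans_le (Nat.pow_le_pow_right (by omega) hj)
  have hcoup : ∀ w < b ^ P.len, (∀ i : Fin m, total (P.line (P.digits w) p' i).frags = 1) ∧
      IsCoupling p (P.coupling (P.digits w) p') := fun w hw =>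
    Par.isCoupling_coupling (P := P) hρ.le (hlen w hw) hp hpe hp0
  have htab : ∀ w < b ^ P.len, ∀ x : Fin m → Fin n,
      P.table (P.digits w) p' (∑ i, (x i : ℕ) * n ^ (i : ℕ)) = P.coupling (P.digits w) p' x :=
    fun w hw x => Par.table_eq_coupling (P := P) hρ.le hp0 (hcoup w hw).1 x
  have houtput : outputTable m n s = P.coupling (P.digits w) p' := by
    funext x
    rw [← htab w hw, outputTable]
    refine hout _ ?_
    have := (finFunctionFinEquiv x).2
    rwa [finFunctionFinEquiv_apply] at this
  -- The output itself shows that couplings exist, so the minimum is attained.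
  obtain ⟨opt, hopt⟩ := exists_isMinEntropyCoupling ⟨_, (hcoup w hw).2⟩
  refine ⟨t, s, hrun, ht.trans ((htime _).trans (hC n hn)), houtput ▸ (hcoup w hw).2, opt, hopt, ?_⟩
  have hq : Par.IsCouplingOf (P := P) p' opt :=
    ⟨hopt.1.1.1, hopt.1.1.2, fun i a => (hopt.1.2 i a).trans (hpe i a).symm⟩
  obtain ⟨adv, hadv, hadv0, hgood⟩ := Par.exists_goodAdvice (P := P) hρ hρ1
    (show 0 < m by omega) hD hb hbU hq
  obtain ⟨w', hw', rfl⟩ := Par.exists_digits_eq (P := P) (show 0 < b by omega) hadv hadv0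
  have hcost := hmin w' hw'
  rw [Par.cost_eq_sum, Par.cost_eq_sum] at hcost
  have hcost' : ∑ x, P.cls (P.coupling (P.digits w) p' x) * P.coupling (P.digits w) p' x ≤
      ∑ x, P.cls (P.coupling (P.digits w') p' x) * P.coupling (P.digits w') p' x := by
    refine le_trans (le_of_eq ?_) (hcost.trans (le_of_eq ?_))
    · exact Finset.sum_congr rfl fun x _ => by rw [← htab w hw x]; rfl
    · exact Finset.sum_congr rfl fun x _ => by rw [← htab w' hw' x]; rfl
  set G := g * (Nat.clog 2 n + 1) with hG
  have hK : P.K = 2 * G + 1 := by simp only [hP, params, hG]; ring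
  have hnL : (n : ℝ) ≤ 2 ^ Nat.clog 2 n := by exact_mod_cast Nat.le_pow_clog (by norm_num) n
  have hρg : 0 ≤ P.ρ ^ g := by positivity
  -- The exponent `G = g * (clog n + 1)` supplies `clog n` factors `ρ ^ g ≤ 2 ^ (-(m + 1))`, which
  -- beat `n ^ (m + 1)`, and one more factor `ρ ^ g`, which is the error that remains.
  have e1 : P.ρ ^ G ≤ ((1 / 2) ^ (m + 1)) ^ Nat.clog 2 n * P.ρ ^ g := by
    rw [hG, pow_mul, pow_succ]
    exact mul_le_mul_of_nonneg_right (pow_le_pow_left₀ hρg c4 _) hρg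
  have e2 : (n : ℝ) ^ (m + 1) * ((1 / 2) ^ (m + 1)) ^ Nat.clog 2 n ≤ 1 := by
    rw [← pow_mul, mul_comm (m + 1), pow_mul, ← mul_pow]
    refine pow_le_one₀ (by positivity) ?_
    rw [one_div_pow, mul_one_div]
    exact div_le_one_of_le₀ hnL (by positivity)
  have hκ : (n : ℝ) ^ (m + 1) * P.ρ ^ G ≤ P.ρ ^ g := by
    calc (n : ℝ) ^ (m + 1) * P.ρ ^ G ≤
          (n : ℝ) ^ (m + 1) * (((1 / 2) ^ (m + 1)) ^ Nat.clog 2 n * P.ρ ^ g) := by gcongr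
      _ = (n : ℝ) ^ (m + 1) * ((1 / 2) ^ (m + 1)) ^ Nat.clog 2 n * P.ρ ^ g := by ring
      _ ≤ 1 * P.ρ ^ g := by gcongr
      _ = _ := one_mul _
  have hκ1 : (n : ℝ) * P.ρ ^ G ≤ 1 := by
    have hn1 : (1 : ℝ) ≤ n := by exact_mod_cast hn
    calc (n : ℝ) * P.ρ ^ G ≤ (n : ℝ) ^ (m + 1) * P.ρ ^ G := by
          gcongr; exact le_self_pow₀ hn1 (by omega)
      _ ≤ P.ρ ^ g := hκ
      _ ≤ 1 := pow_le_one₀ hρ.le hρ1.le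
  have hfin := Par.entropy_le_of_goodAdvice (P := P) (r := P.coupling (P.digits w) p') hρ0 hρ1 hD hn
    hK hq hp0 hadv0 hgood (hcoup w hw).2.1.1 (hcoup w' hw').2.1 hcost' hκ hκ1
  rw [houtput]
  have f1 : 3 * Real.logb 2 (1 / P.ρ) + 3 * √(1 - P.ρ ^ 2) + 16 * P.m * (1 - P.ρ) ≤ ε / 4 := c1
  have f2 : 10 * P.m * P.ρ ^ P.U ≤ ε / 4 := c2
  have f3 : P.m * ((5 + 8 * (1 - P.ρ) / P.ρ ^ P.U) * (2 * P.patterns / P.D)) ≤ ε / 4 := c3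
  have f4 : (6 + P.m) * P.ρ ^ g ≤ ε / 4 := c5
  change entropy (P.coupling (P.digits w) p') ≤ entropy opt + ε
  change entropy (P.coupling (P.digits w) p') ≤ entropy opt + _ + _ + _ + _ at hfin
  linarith
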